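/- **Parameters.** Let $q_i=e^{\ell_i}$, $i=1,\dots,4$, with $q_1q_2q_3q_4=1$ and otherwise multiplicatively independent ($\prod_i q_i^{n_i}=1$ with $n_i\in\mathbb Z$ only if $n_1=\dots=n_4$); $\log q_i:=\ell_i$. Fix $a$ and let $\bar a=bcd$ be its complement, $b<c<d$; fix a value of $\log(-q_a)$. Put $\mathbf P_a=1-q_a$, $\mathbf P_{\bar a}=(1-q_b)(1-q_c)(1-q_d)$, $\mathbf P_{1234}=\mathbf P_a\mathbf P_{\bar a}$; the dual ${}^\vee$ inverts all weights, and $\mathbb I[\sum_w n_w w]=\prod_w(1-w^{-1})^{n_w}$. **Operators.** Let $[\mathsf a_n,\mathsf a_m]=-\frac1n\prod_{i=1}^4(1-q_i^n)\,\delta_{n+m,0}$ ($n,m\ne0$), acting on the Fock space $\mathbb C[\mathsf a_{-1},\mathsf a_{-2},\dots]$, and let the zero modes $\mathsf t_0,\tilde{\mathsf t}_0,\partial_{\mathsf t},\tilde\partial_{\mathsf t}$, with $[\partial_{\mathsf t},\mathsf t_0]=[\tilde\partial_{\mathsf t},\tilde{\mathsf t}_0]=1$ and the other commutators zero, act on functions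 of $(t,\tilde t)$ by multiplication and translation ($e^{c\partial_{\mathsf t}}$, $e^{c\tilde\partial_{\mathsf t}}$). With $:\ :$ the normal ordering that puts $\mathsf a_{-n}$ ($n>0$), $\mathsf t_0,\tilde{\mathsf t}_0$ to the left, let $$\mathsf A(x)={:}\exp\Big(\mathsf t_0+\sum_{n\ne0}\mathsf a_nx^{-n}\Big){:},\qquad \mathsf S_i(x)={:}\exp\Big(-\tfrac{\log x}{\log q_i}\mathsf t_0-\tfrac1{\log q_i}\tilde\partial_{\mathsf t}+\sum_{n\ne0}\tfrac{\mathsf a_n}{1-q_i^{-n}}x^{-n}\Big){:},$$ $$\mathsf W_{\bar a}(x)={:}\exp\Big(-\log q_a\,\big(\log x+\log(-q_a)\big)\tilde{\mathsf t}_0-\log q_a\,\partial_{\mathsf t}+\sum_{n\ne0}\tfrac{\mathsf a_n}{(1-q_b^{-n})(1-q_c^{-n})(1-q_d^{-n})}x^{-n}\Big){:}.$$ Products of operators are expanded as formal series in $x,x'$ in complex powers. **Boxes.** Let $\lambda,\mu,\nu$ be Young diagrams. In $\mathbb N^3$ put $\mathcal B_\lambda=\{(v_1,v_2,v_3):(v_2,v_3)\in\lambda\}$,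 $\mathcal B_\mu=\{(v_3,v_1)\in\mu\}$, $\mathcal B_\nu=\{(v_1,v_2)\in\nu\}$ (coordinates start at $0$; cells are (row, column)), and $\mathcal B_{\lambda\mu\nu}=\mathcal B_\lambda\cup\mathcal B_\mu\cup\mathcal B_\nu$. Let $\mathcal{PP}_{\lambda\mu\nu}$ be the set of finite sets $\pi\subset\mathbb N^3\setminus\mathcal B_{\lambda\mu\nu}$ such that $\pi\cup\mathcal B_{\lambda\mu\nu}$ is closed downwards. Put $\chi_x(v)=x\,q_b^{v_1}q_c^{v_2}q_d^{v_3}$, $\mathbf N=x$, $\mathbf K_\pi=\sum_{v\in\pi}\chi_x(v)$, $\mathbf N_{\lambda\mu\nu}=\sum_{v\in\mathcal B_{\lambda\mu\nu}}\chi_x(v)$, and $$\widetilde{\mathcal Z}[\pi]=\widetilde{\mathcal Z}^{D6}_{\bar a;\lambda\mu\nu}[\pi]=\mathbb I\big[-\mathbf P_a^\vee\mathbf N^\vee\mathbf K_\pi+\mathbf P_{1234}\mathbf N_{\lambda\mu\nu}^\vee\mathbf K_\pi+\mathbf P_{\bar a}^\vee\mathbf K_\pi^\vee\mathbf K_\pi\big],$$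 $$\mathscr W_\pi(x')=\mathbb I\big[\big(\mathbf N-\mathbf P_{\bar a}(\mathbf K_\pi+\mathbf N_{\lambda\mu\nu})\big)^\vee x'\big],$$ where like weights are collected (using $q_1q_2q_3q_4=1$) before taking the index, so that all products are finite. **The $qq$-character.** Let $$\mathsf T_{\bar a,\lambda\mu\nu}(x)=\sum_{\pi\in\mathcal{PP}_{\lambda\mu\nu}}\mathfrak q^{|\pi|}\,\widetilde{\mathcal Z}[\pi]\,\Lambda_\pi(x),\qquad \Lambda_\pi(x)={:}\mathsf W_{\bar a}(x)\prod_{v\in\mathcal B_{\lambda\mu\nu}}\mathsf A^{-1}(\chi_x(v))\prod_{v\in\pi}\mathsf A^{-1}(\chi_x(v)){:}.$$ The infinite product over $\mathcal B_{\lambda\mu\nu}$ is defined leg by leg through the regularization $\prod_{k\ge0}\mathsf A^{-1}(q_i^kx)=\mathsf S_i(x)^{-1}$, the boxes lying in several legs being counted once by inserting $\mathsf A(\chi_x(v))$ for each $v$ in $\mathcal B_\lambda\cap\mathcal B_\mu$, in $\mathcal B_\mu\cap\mathcal B_\nu$ and in $\mathcal B_\nu\cap\mathcal B_\lambda$, and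 $\mathsf A^{-1}(\chi_x(v))$ for each $v\in\mathcal B_\lambda\cap\mathcal B_\mu\cap\mathcal B_\nu$. The formal parameter $\mathfrak q$ is introduced by the rescaling $\mathsf A\to\mathfrak q^{-1}\mathsf A$. By $\mathsf A(x)={:}\mathsf S_a(x)\mathsf S_a(q_ax)^{-1}{:}$ it rescales the screening current too: up to a prefactor $x'^{\log\mathfrak q/\log q_a}$ common to all terms, the screening charge $\mathscr Q_a(x')=\sum_{k\in\mathbb Z}\mathsf S_a(q_a^kx')$ of the rescaled currents is $\sum_{k\in\mathbb Z}\mathfrak q^k\,\mathsf S_a(q_a^kx')$ in terms of the current $\mathsf S_a$ above. **Proposition.** 1. The coefficients are fixed by a residue recursion: for every $x\neq0$, $C=\widetilde{\mathcal Z}$ is the one and only function $C:\mathcal{PP}_{\lambda\mu\nu}\to\mathbb C$ such that $C[\emptyset]=1$ and, whenever $\pi$ and $\pi+v$ (one more box $v$) are in $\mathcal{PP}_{\lambda\mu\nu}$, $$\frac{C[\pi+v]}{C[\pi]}=-\frac{\operatorname{Res}_{x'=q_a\chi_x(v)}\mathscr W_\pi(q_a^{-1}x')^{-1}}{\operatorname{Res}_{x'=\chi_x(v)}\mathscr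 W_{\pi+v}(q_a^{-1}x')^{-1}},$$ where both points are simple poles with nonzero residues, and $\operatorname{Res}f$ is the residue of the differential $f(x')\,dx'/x'$. 2. The $qq$-character commutes with the screening charge: $[\mathsf T_{\bar a,\lambda\mu\nu}(x),\mathscr Q_a(x')]=0$. That is, for every $M\in\mathbb Z$ the coefficient of $\mathfrak q^M$, $$\sum_{k\in\mathbb Z}\ \sum_{|\pi|=M-k}\widetilde{\mathcal Z}[\pi]\,\big[\Lambda_\pi(x),\mathsf S_a(q_a^kx')\big],$$ vanishes. Here, for each $k$, the summand is a finite combination $x'^{-\mathsf t_0/\log q_a}\sum_r\delta\big(\tfrac{x'}{rx}\big)\beta_{k,r}(x)$ of delta functions $\delta(z)=\sum_{n\in\mathbb Z}z^n$, and the sum over $k$ is taken at each support point $r$ separately: for each $r\in\mathbb C^\times$ only finitely many $\beta_{k,r}$ are nonzero, and $\sum_k\beta_{k,r}=0$. -/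

import Mathlib

noncomputable section

open scoped Classical

namespace GaugeOrigami

/-! ### Parameters

`l i` is a chosen logarithm of the deformation parameter `q i`.  For `a : Fin 4` the complement
`abar = bcd`, `b < c < d`, is enumerated by `a.succAbove 0, a.succAbove 1, a.succAbove 2`. -/

/-- The deformation parameters `q_i = exp (log q_i)`. -/
def q (l : Fin 4 → ℂ) (i : Fin 4) : ℂ := Complex.exp (l i)

/-- The monomial `q_b ^ w_0 * q_c ^ w_1 * q_d ^ w_2`, where `abar = bcd`. -/
def mono (l : Fin 4 → ℂ) (a : Fin 4) (w : Fin 3 → ℤ) : ℂ :=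
  ∏ i, q l (a.succAbove i) ^ w i

/-- Boxes, with coordinates counted from `0`, along the axes `b, c, d`. -/
abbrev Box := Fin 3 → ℕ

/-- `χ_{abar,x}(v) / x`. -/
def chi (l : Fin 4 → ℂ) (a : Fin 4) (v : Box) : ℂ := mono l a (fun i => (v i : ℤ))

/-- The logarithm of `χ_{abar,x}(v) / x` which is compatible with the chosen `log q_i`. -/
def logChi (l : Fin 4 → ℂ) (a : Fin 4) (v : Box) : ℂ := ∑ i, (v i : ℂ) * l (a.succAbove i)

/-! ### Plane partitions with leg boundary conditions

The triple `(λ, μ, ν)` of asymptotic Young diagrams is `Y : Fin 3 → YoungDiagram`. -/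

/-- The leg along the `i`-th axis.  With `Y = (λ, μ, ν)` these are, in terms of boxes `(v₀, v₁, v₂)`,
`B_λ : (v₁, v₂) ∈ λ`, `B_μ : (v₂, v₀) ∈ μ`, `B_ν : (v₀, v₁) ∈ ν` (pairs are (row, column)). -/
def leg (Y : Fin 3 → YoungDiagram) (i : Fin 3) : Set Box :=
  {v | (v (i + 1), v (i + 2)) ∈ Y i}

/-- The vacuum configuration `B_{λμν}`. -/
def bd (Y : Fin 3 → YoungDiagram) : Set Box := ⋃ i, leg Y i

theorem isLowerSet_bd (Y : Fin 3 → YoungDiagram) : IsLowerSet (bd Y) := by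
  intro v w hwv hv
  obtain ⟨i, hi⟩ := Set.mem_iUnion.1 hv
  refine Set.mem_iUnion.2 ⟨i, ?_⟩
  exact (Y i).isLowerSet (show (w (i + 1), w (i + 2)) ≤ (v (i + 1), v (i + 2)) from
    ⟨hwv _, hwv _⟩) hi

/-- `PP_{λμν}`: an infinite plane partition with asymptotics `λ, μ, ν` is recorded by the finite set
of its boxes outside `B_{λμν}`. -/
def PP (Y : Fin 3 → YoungDiagram) : Type :=
  {π : Finset Box // Disjoint (π : Set Box) (bd Y) ∧ IsLowerSet ((π : Set Box) ∪ bd Y)}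

/-- The configuration without boxes outside `B_{λμν}`. -/
def PP.empty (Y : Fin 3 → YoungDiagram) : PP Y :=
  ⟨∅, by simp, by simpa using isLowerSet_bd Y⟩

/-- A bound for the coordinates of the boxes of the asymptotic Young diagrams. -/
theorem exists_bound (Y : Fin 3 → YoungDiagram) :
    ∃ D : ℕ, ∀ i p, p ∈ Y i → p.1 < D ∧ p.2 < D := by
  refine ⟨(∑ i, ∑ p ∈ (Y i).cells, (p.1 + p.2)) + 1, fun i p hp => ?_⟩
  have h1 : p.1 + p.2 ≤ ∑ p ∈ (Y i).cells, (p.1 + p.2) :=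
    Finset.single_le_sum (f := fun p : ℕ × ℕ => p.1 + p.2) (fun _ _ => Nat.zero_le _)
      ((YoungDiagram.mem_cells p).2 hp)
  have h2 : ∑ p ∈ (Y i).cells, (p.1 + p.2) ≤ ∑ i, ∑ p ∈ (Y i).cells, (p.1 + p.2) :=
    Finset.single_le_sum (f := fun i => ∑ p ∈ (Y i).cells, (p.1 + p.2))
      (fun _ _ => Nat.zero_le _) (Finset.mem_univ i)
  omega

/-- There are finitely many elements of `PP_{λμν}` of a given size. -/
theorem finite_size (Y : Fin 3 → YoungDiagram) (N : ℤ) :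
    {π : PP Y | (π.1.card : ℤ) = N}.Finite := by
  obtain ⟨D, hD⟩ := exists_bound Y
  have key : ∀ π : PP Y, (π.1.card : ℤ) = N →
      π.1 ⊆ Fintype.piFinset (fun _ : Fin 3 => Finset.range (N.toNat + D)) := by
    intro π hπ v hv
    rw [Fintype.mem_piFinset]
    intro i
    rw [Finset.mem_range]
    by_contra hlt
    have hvb : v ∉ bd Y := fun h => Set.disjoint_left.1 π.2.1 hv h
    have hsub : (Finset.Icc D (v i)).image (fun j => Function.update v i j) ⊆ π.1 := by
      intro w hw
      obtain ⟨j, hj, rfl⟩ := Finset.mem_image.1 hw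
      rw [Finset.mem_Icc] at hj
      have hle : Function.update v i j ≤ v := by
        intro k
        by_cases hk : k = i
        · subst hk; simpa using hj.2
        · simp [Function.update_of_ne hk]
      rcases π.2.2 hle (Or.inl hv) with h | h
      · exact h
      · exfalso
        obtain ⟨i', hi'⟩ := Set.mem_iUnion.1 h
        have hb := hD i' _ hi'
        by_cases h0 : i = i'
        · apply hvb
          refine Set.mem_iUnion.2 ⟨i', ?_⟩
          have e1 : i' + 1 ≠ i := by subst h0; fin_cases i <;> decide
          have e2 : i' + 2 ≠ i := by subst h0; fin_cases i <;> decide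
          change (_, _) ∈ Y i' at hi'
          rwa [Function.update_of_ne e1, Function.update_of_ne e2] at hi'
        · have : i = i' + 1 ∨ i = i' + 2 := by
            revert h0; fin_cases i <;> fin_cases i' <;> decide
          rcases this with h1 | h1
          · have := hb.1; rw [← h1] at this; simp at this; omega
          · have := hb.2; rw [← h1] at this; simp at this; omega
    have hc := Finset.card_le_card hsub
    rw [Finset.card_image_of_injective _ (Function.update_injective v i), Nat.card_Icc] at hc
    omega
  refine Set.Finite.of_finite_image (f := fun π : PP Y => π.1) ?_
    (fun _ _ _ _ h => Subtype.ext h)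
  refine (Finset.finite_toSet (Fintype.piFinset
    (fun _ : Fin 3 => Finset.range (N.toNat + D))).powerset).subset ?_
  rintro _ ⟨π, hπ, rfl⟩
  exact Finset.mem_coe.2 (Finset.mem_powerset.2 (key π hπ))

/-- Two different legs meet in finitely many boxes. -/
theorem finite_inter (Y : Fin 3 → YoungDiagram) (i : Fin 3) :
    (leg Y i ∩ leg Y (i + 1)).Finite := by
  obtain ⟨D, hD⟩ := exists_bound Y
  refine (Finset.finite_toSet (Fintype.piFinset
    (fun _ : Fin 3 => Finset.range D))).subset ?_
  rintro v ⟨h1, h2⟩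
  have b1 := hD _ _ h1
  have b2 := hD _ _ h2
  rw [Finset.mem_coe, Fintype.mem_piFinset]
  intro j
  rw [Finset.mem_range]
  fin_cases i <;> fin_cases j <;> simp_all

/-- The three legs have finitely many boxes in common. -/
theorem finite_triple (Y : Fin 3 → YoungDiagram) : (⋂ i, leg Y i).Finite :=
  (finite_inter Y 0).subset fun _ hv => ⟨Set.mem_iInter.1 hv 0, Set.mem_iInter.1 hv (0 + 1)⟩

/-- The box at the bottom of the leg along the `i`-th axis over the cell `p` of `Y i`. -/
def foot (i : Fin 3) (p : ℕ × ℕ) : Box :=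
  fun j => if j = i then 0 else if j = i + 1 then p.1 else p.2

/-! ### Characters and indices

A character is recorded by the multiplicities of the weights `q_b ^ w_0 q_c ^ w_1 q_d ^ w_2`; like
terms are collected before an index is taken.  Since `q_1 q_2 q_3 q_4 = 1`, the weight of `q_a` is
`(-1, -1, -1)`.  Powers of `x` are kept separately. -/

/-- Formal sums of weights. -/
abbrev Character := (Fin 3 → ℤ) → ℤ

/-- Multiplication by the weight `u`. -/
def shiftBy (u : Fin 3 → ℤ) (f : Character) : Character := fun w => f (w - u)

/-- Multiplication by `1 - q^u`. -/
def oneSub (u : Fin 3 → ℤ) (f : Character) : Character := f - shiftBy u f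

/-- The weight of the `i`-th element of `abar`. -/
def wt (i : Fin 3) : Fin 3 → ℤ := Pi.single i 1

/-- The weight of `q_a`. -/
def wta : Fin 3 → ℤ := fun _ => -1

/-- Multiplication by `P_{abar} = (1 - q_b)(1 - q_c)(1 - q_d)`. -/
def mulP (f : Character) : Character := oneSub (wt 0) (oneSub (wt 1) (oneSub (wt 2) f))

/-- Multiplication by `P_{abar}^∨`. -/
def mulPdual (f : Character) : Character := oneSub (-wt 0) (oneSub (-wt 1) (oneSub (-wt 2) f))

/-- The dual character. -/
def dual (f : Character) : Character := fun w => f (-w)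

/-- The character `∑_{v ∈ B} χ_{abar,1}(v)` of a (possibly infinite) set of boxes. -/
def chSet (B : Set Box) : Character := fun w => if ∃ v ∈ B, ∀ i, w i = v i then 1 else 0

/-- Multiplication by the character of a finite set of boxes. -/
def mulK (π : Finset Box) (f : Character) : Character := ∑ v ∈ π, shiftBy (fun i => (v i : ℤ)) f

/-- The index `𝕀[∑ n_w q^w] = ∏ (1 - q^{-w})^{n_w}`. -/
def index (l : Fin 4 → ℂ) (a : Fin 4) (f : Character) : ℂ :=
  ∏ᶠ w : Fin 3 → ℤ, (1 - (mono l a w)⁻¹) ^ f w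

/-- The character `-P_a^∨ N^∨ K_π + P_{1234} N_{λμν}^∨ K_π + P_{abar}^∨ K_π^∨ K_π`
(it does not depend on `x`; `P_{1234} = P_a P_{abar}`). -/
def vChar (Y : Fin 3 → YoungDiagram) (π : Finset Box) : Character :=
  -oneSub (-wta) (chSet (π : Set Box))
    + mulK π (oneSub wta (mulP (dual (chSet (bd Y)))))
    + mulK π (mulPdual (dual (chSet (π : Set Box))))

/-- The D6 partition function `Z̃^{D6}_{abar;λμν}[π]`. -/
def Z (l : Fin 4 → ℂ) (a : Fin 4) (Y : Fin 3 → YoungDiagram) (π : PP Y) : ℂ :=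
  index l a (vChar Y π.1)

/-- `x⁻¹ Y_{abar}|_π = 1 - P_{abar} (K_π + N_{λμν}) / x`. -/
def yChar (Y : Fin 3 → YoungDiagram) (π : Finset Box) : Character :=
  Pi.single 0 1 - mulP (chSet (π : Set Box) + chSet (bd Y))

/-- The structure function `𝒲^{abar,λμν}_{π,x}(x') = 𝕀[Y_{abar}^∨ x']`. -/
def structureFun (l : Fin 4 → ℂ) (a : Fin 4) (Y : Fin 3 → YoungDiagram) (π : PP Y)
    (x x' : ℂ) : ℂ :=
  ∏ᶠ w : Fin 3 → ℤ, (1 - mono l a w * x / x') ^ yChar Y π.1 w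

/-- `r` is the residue of the differential `f(x') dx'/x'` at its simple pole `c`
(at which it is nonzero). -/
def IsSimpleResidue (f : ℂ → ℂ) (c r : ℂ) : Prop :=
  r ≠ 0 ∧ Filter.Tendsto (fun z => (1 - c / z) * f z) (nhdsWithin c {c}ᶜ) (nhds r)

/-- The residue recursion for coefficients `C[π]`, with initial value `C[∅] = 1`:
whenever `π' = π + v`,
`C[π'] / C[π] = - Res_{x' = q_a χ(v)} 𝒲_π(q_a⁻¹ x')⁻¹ / Res_{x' = χ(v)} 𝒲_{π'}(q_a⁻¹ x')⁻¹`. -/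
def ResidueRecursion (l : Fin 4 → ℂ) (a : Fin 4) (Y : Fin 3 → YoungDiagram) (x : ℂ)
    (C : PP Y → ℂ) : Prop :=
  C (PP.empty Y) = 1 ∧
  ∀ (π π' : PP Y) (v : Box), v ∉ π.1 → π'.1 = insert v π.1 →
    ∃ r r' : ℂ,
      IsSimpleResidue (fun x' => (structureFun l a Y π x ((q l a)⁻¹ * x'))⁻¹)
        (q l a * (x * chi l a v)) r ∧
      IsSimpleResidue (fun x' => (structureFun l a Y π' x ((q l a)⁻¹ * x'))⁻¹)
        (x * chi l a v) r' ∧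
      C π' / C π = -(r / r')

/-! ### Heisenberg algebra and vertex operators

The Heisenberg algebra `[a_n, a_m] = -(1/n) P_{1234}^{[n]} δ_{n+m,0}` acts on the Fock space
`ℂ[a_{-1}, a_{-2}, …]`.  The zero modes `t₀, t̃₀` act on functions of `(t, t̃)` as multiplication
by `t, t̃`, and `exp (c ∂_t)`, `exp (c ∂̃_t)` act as translations by `c`. -/

/-- The Fock space; the variable `X n` is `a_{-n}`. -/
abbrev Fock := MvPolynomial ℕ+ ℂ

/-- The scalar `[a_n, a_{-n}] = -(1/n) ∏_i (1 - q_i^n)`. -/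
def bracket (l : Fin 4 → ℂ) (n : ℤ) : ℂ := -(1 / (n : ℂ)) * ∏ i, (1 - q l i ^ n)

/-- The oscillators `a_n`, `n ≠ 0`. -/
def heis (l : Fin 4 → ℂ) (n : ℤ) : Module.End ℂ Fock :=
  if 0 < n then bracket l n • (MvPolynomial.pderiv n.natAbs.toPNat').toLinearMap
  else if n < 0 then LinearMap.mulLeft ℂ (MvPolynomial.X n.natAbs.toPNat')
  else 0

/-- The relation `[a_n, a_m] = -(1/n) P_{1234}^{[n]} δ_{n+m,0}`. -/
theorem heis_commutator (l : Fin 4 → ℂ) (n m : ℤ) (hn : n ≠ 0) (hm : m ≠ 0) (hq : ∏ i, q l i = 1) :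
    heis l n * heis l m - heis l m * heis l n = if n + m = 0 then bracket l n • 1 else 0 := by
  have hbr : ∀ k : ℤ, bracket l (-k) = -bracket l k := by
    intro k
    have h0 : ∀ i, q l i ≠ 0 := fun i => Complex.exp_ne_zero _
    have h1 : ∏ i, (1 - q l i ^ (-k)) = ∏ i, (1 - q l i ^ k) := by
      have h2 : ∀ i, 1 - q l i ^ (-k) = -(q l i ^ k)⁻¹ * (1 - q l i ^ k) := by
        intro i
        have := zpow_ne_zero k (h0 i)
        rw [zpow_neg]
        field_simp
        ring
      have h3 : ∏ i, (-(q l i ^ k)⁻¹) = 1 := by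
        have h4 : ∏ i, q l i ^ k = 1 := by rw [Finset.prod_zpow, hq, one_zpow]
        rw [Finset.prod_neg, Finset.prod_inv_distrib, h4]
        norm_num
      rw [Finset.prod_congr rfl fun i _ => h2 i, Finset.prod_mul_distrib, h3, one_mul]
    rw [bracket, bracket, h1]
    push_cast
    rw [one_div_neg_eq_neg_one_div]
    ring
  have main : ∀ n m : ℤ, 0 < n → m < 0 →
      heis l n * heis l m - heis l m * heis l n = if n + m = 0 then bracket l n • 1 else 0 := by
    intro n m hn hm
    refine LinearMap.ext fun p => ?_
    have e1 : ∀ r, heis l n r = bracket l n • MvPolynomial.pderiv n.natAbs.toPNat' r := by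
      intro r; rw [heis, if_pos hn]; rfl
    have e2 : ∀ r, heis l m r = MvPolynomial.X m.natAbs.toPNat' * r := by
      intro r; rw [heis, if_neg (by omega), if_pos hm]; rfl
    rw [LinearMap.sub_apply, Module.End.mul_apply, Module.End.mul_apply, e1, e2, e1, e2,
      Derivation.leibniz]
    by_cases h : n + m = 0
    · have h' : m.natAbs = n.natAbs := by omega
      rw [if_pos h, h', MvPolynomial.pderiv_X_self]
      simp [smul_add]
    · have h' : m.natAbs.toPNat' ≠ n.natAbs.toPNat' := by
        intro h0
        have := congrArg PNat.val h0
        simp only [Nat.toPNat'_coe] at this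
        rw [if_pos (by omega), if_pos (by omega)] at this
        omega
      rw [if_neg h, MvPolynomial.pderiv_X_of_ne h']
      simp
  rcases lt_or_gt_of_ne hn with h1 | h1 <;> rcases lt_or_gt_of_ne hm with h2 | h2
  · rw [if_neg (by omega)]
    refine LinearMap.ext fun p => ?_
    simp only [heis, if_neg (not_lt.2 h1.le), if_neg (not_lt.2 h2.le), if_pos h1, if_pos h2]
    simp [mul_left_comm]
  · have := main m n h2 h1
    rw [← neg_sub, this]
    by_cases h : n + m = 0
    · rw [if_pos h, if_pos (by omega), show m = -n by omega, hbr]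
      module
    · rw [if_neg h, if_neg (by omega), neg_zero]
  · exact main n m h1 h2
  · rw [if_neg (by omega)]
    refine LinearMap.ext fun p => ?_
    have e : ∀ k : ℤ, 0 < k → ∀ r, heis l k r
        = bracket l k • MvPolynomial.pderiv k.natAbs.toPNat' r := by
      intro k hk r; rw [heis, if_pos hk]; rfl
    have hcomm : ∀ (i j : ℕ+) (r : Fock), MvPolynomial.pderiv i (MvPolynomial.pderiv j r)
        = MvPolynomial.pderiv j (MvPolynomial.pderiv i r) := by
      intro i j r
      have h0 : ⁅(MvPolynomial.pderiv i : Derivation ℂ Fock Fock),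
          (MvPolynomial.pderiv j : Derivation ℂ Fock Fock)⁆ = 0 := by
        refine MvPolynomial.derivation_ext fun k => ?_
        rw [Derivation.commutator_apply]
        by_cases h1 : k = i <;> by_cases h2 : k = j <;>
          simp [MvPolynomial.pderiv_X, Pi.single_apply, h1, h2, apply_ite]
      have h1 := congrArg (fun d : Derivation ℂ Fock Fock => d r) h0
      simp only [Derivation.commutator_apply, Derivation.zero_apply] at h1
      exact sub_eq_zero.1 h1
    rw [LinearMap.sub_apply, Module.End.mul_apply, Module.End.mul_apply, e n h1, e m h2, e m h2,
      e n h1, Derivation.map_smul, Derivation.map_smul, smul_comm,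
      hcomm, sub_self, LinearMap.zero_apply]

/-- The coefficient of `x^j` in `exp (∑_{n ≥ 1} φ_{-n} a_{-n} x^n)`. -/
def creation (φ : ℤ → ℂ) (j : ℕ) : Fock :=
  PowerSeries.coeff j ((PowerSeries.exp Fock).subst
    (PowerSeries.mk fun n : ℕ =>
      if n = 0 then 0 else MvPolynomial.C (φ (-(n : ℤ))) * MvPolynomial.X n.toPNat'))

/-- `exp (∑_{n ≥ 1} φ_n a_n y^n)` with `y = x⁻¹`, as a polynomial in `y`: as `a_n` acts as
`[a_n, a_{-n}] ∂/∂a_{-n}`, this is the translation `a_{-n} ↦ a_{-n} + φ_n [a_n, a_{-n}] y^n`. -/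
def annihilation (l : Fin 4 → ℂ) (φ : ℤ → ℂ) : Fock →ₐ[ℂ] Polynomial Fock :=
  MvPolynomial.aeval fun n : ℕ+ =>
    Polynomial.C (MvPolynomial.X n)
      + Polynomial.monomial (n : ℕ) (MvPolynomial.C (φ (n : ℕ) * bracket l (n : ℕ)))

/-- `annihilation l φ p` is `p` at `y = 0`, and its derivative is that of
`exp (∑_{n ≥ 1} φ_n a_n y^n) p`. -/
theorem annihilation_eq_exp (l : Fin 4 → ℂ) (φ : ℤ → ℂ) (p : Fock) :
    (annihilation l φ p).coeff 0 = p ∧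
    ∃ s₀ : Finset ℕ+, ∀ s, s₀ ⊆ s → Polynomial.derivative (annihilation l φ p) =
      ∑ n ∈ s, Polynomial.monomial ((n : ℕ) - 1) (MvPolynomial.C ((n : ℕ) * φ (n : ℕ)))
        * annihilation l φ (heis l (n : ℕ) p) := by
  have hh : ∀ (n : ℕ+) (p : Fock), heis l (n : ℕ) p
      = bracket l (n : ℕ) • MvPolynomial.pderiv n p := by
    intro n p
    have h0 : (0 : ℤ) < ((n : ℕ) : ℤ) := by exact_mod_cast n.pos
    rw [heis, if_pos h0]
    have : ((n : ℕ) : ℤ).natAbs.toPNat' = n := by simp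
    rw [this]
    rfl
  have hX : ∀ m : ℕ+, annihilation l φ (MvPolynomial.X m) = Polynomial.C (MvPolynomial.X m)
      + Polynomial.monomial (m : ℕ) (MvPolynomial.C (φ (m : ℕ) * bracket l (m : ℕ))) := by
    intro m
    simp [annihilation]
  constructor
  · rw [Polynomial.coeff_zero_eq_eval_zero]
    have : ((Polynomial.evalRingHom (0 : Fock)).comp (annihilation l φ).toRingHom)
        = RingHom.id Fock := by
      apply MvPolynomial.ringHom_ext
      · intro r
        simp [annihilation, Polynomial.algebraMap_apply]
      · intro m
        simp only [RingHom.comp_apply, AlgHom.toRingHom_eq_coe, RingHom.coe_coe, hX]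
        simp [Polynomial.eval_monomial]
    exact RingHom.congr_fun this p
  · induction p using MvPolynomial.induction_on with
    | C r =>
      refine ⟨∅, fun s _ => ?_⟩
      simp [hh, annihilation, Polynomial.algebraMap_apply]
    | add p p' h h' =>
      obtain ⟨s₁, h₁⟩ := h
      obtain ⟨s₂, h₂⟩ := h'
      refine ⟨s₁ ∪ s₂, fun s hs => ?_⟩
      rw [map_add, Polynomial.derivative_add, h₁ s (Finset.union_subset_left hs),
        h₂ s (Finset.union_subset_right hs), ← Finset.sum_add_distrib]
      refine Finset.sum_congr rfl fun n _ => ?_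
      rw [map_add, map_add, mul_add]
    | mul_X p m h =>
      obtain ⟨s₁, h₁⟩ := h
      refine ⟨insert m s₁, fun s hs => ?_⟩
      have hm : m ∈ s := hs (Finset.mem_insert_self _ _)
      rw [map_mul, Polynomial.derivative_mul, h₁ s ((Finset.subset_insert _ _).trans hs),
        Finset.sum_mul]
      have hterm : ∀ n ∈ s,
          Polynomial.monomial ((n : ℕ) - 1) (MvPolynomial.C ((n : ℕ) * φ (n : ℕ)))
            * annihilation l φ (heis l (n : ℕ) (p * MvPolynomial.X m))
          = Polynomial.monomial ((n : ℕ) - 1) (MvPolynomial.C ((n : ℕ) * φ (n : ℕ)))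
              * annihilation l φ (heis l (n : ℕ) p) * annihilation l φ (MvPolynomial.X m)
            + if n = m then annihilation l φ p *
                Polynomial.derivative (annihilation l φ (MvPolynomial.X m)) else 0 := by
        intro n _
        have hs' : ∀ (b : ℂ) (r : Fock), annihilation l φ (b • r)
            = Polynomial.C (MvPolynomial.C b) * annihilation l φ r := by
          intro b r
          rw [map_smul, Algebra.smul_def, Polynomial.algebraMap_apply]
          rfl
        rw [hh, hh, Derivation.leibniz, hs', hs', smul_eq_mul, smul_eq_mul,
          map_add (annihilation l φ), map_mul (annihilation l φ), map_mul (annihilation l φ)]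
        by_cases hnm : n = m
        · subst hnm
          have hd : Polynomial.derivative (annihilation l φ (MvPolynomial.X n))
              = Polynomial.monomial ((n : ℕ) - 1) (MvPolynomial.C ((n : ℕ) * φ (n : ℕ)))
                * Polynomial.C (MvPolynomial.C (bracket l (n : ℕ))) := by
            rw [hX, Polynomial.derivative_add, Polynomial.derivative_C,
              Polynomial.derivative_monomial, zero_add, Polynomial.monomial_mul_C, ← map_natCast
              (MvPolynomial.C : ℂ →+* Fock), ← map_mul, ← map_mul]
            congr 2
            ring
          rw [if_pos rfl, MvPolynomial.pderiv_X_self, hd, map_one (annihilation l φ)]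
          generalize annihilation l φ (MvPolynomial.X n) = A
          generalize annihilation l φ p = B
          generalize annihilation l φ (MvPolynomial.pderiv n p) = D
          generalize Polynomial.monomial ((n : ℕ) - 1) (MvPolynomial.C ((n : ℕ) * φ (n : ℕ))) = E
          generalize Polynomial.C (MvPolynomial.C (bracket l (n : ℕ))) = G
          ring
        · rw [if_neg hnm, MvPolynomial.pderiv_X_of_ne (Ne.symm hnm),
            map_zero (annihilation l φ)]
          generalize annihilation l φ (MvPolynomial.X m) = A
          generalize annihilation l φ (MvPolynomial.pderiv n p) = D
          generalize Polynomial.monomial ((n : ℕ) - 1) (MvPolynomial.C ((n : ℕ) * φ (n : ℕ))) = E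
          generalize Polynomial.C (MvPolynomial.C (bracket l (n : ℕ))) = G
          ring
      rw [Finset.sum_congr rfl hterm, Finset.sum_add_distrib, Finset.sum_ite_eq' s m, if_pos hm]

/-- The coefficient of `x^k` in the normal ordered exponential `:exp (∑_{n ≠ 0} φ_n a_n x^{-n}):`. -/
def oscMode (l : Fin 4 → ℂ) (φ : ℤ → ℂ) (k : ℤ) : Module.End ℂ Fock :=
  (Polynomial.lsum fun j : ℕ =>
      if 0 ≤ k + j then LinearMap.mulLeft ℂ (creation φ (k + j).toNat) else 0)
    ∘ₗ (annihilation l φ).toLinearMap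

/-- The indices of the coefficients of an exponent
`∑_{n ≠ 0} φ_n a_n x^{-n} + (φ_t + φ_{logt} log x) t₀ + (φ_s + φ_{logs} log x) t̃₀
  + φ_{dt} ∂_t + φ_{ds} ∂̃_t`. -/
inductive Mode
  | osc (n : ℤ)
  | t
  | logt
  | s
  | logs
  | dt
  | ds

/-- Exponents of normal ordered vertex operators.  Addition of exponents is the normal ordered
product `:V V':`, and subtraction is `:V / V':`. -/
abbrev Exponent := Mode → ℂ

/-- The exponent of `V(e^u x)`, given that of `V(x)`. -/
def rescale (u : ℂ) (φ : Exponent) : Exponent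
  | .osc n => Complex.exp (-(n * u)) * φ (.osc n)
  | .t => φ .t + u * φ .logt
  | .s => φ .s + u * φ .logs
  | m => φ m

/-- The root current `A(x)`. -/
def expA : Exponent
  | .osc _ => 1
  | .t => 1
  | _ => 0

/-- The screening current `S_b(x)`. -/
def expS (l : Fin 4 → ℂ) (b : Fin 4) : Exponent
  | .osc n => (1 - q l b ^ (-n))⁻¹
  | .logt => -(l b)⁻¹
  | .ds => -(l b)⁻¹
  | _ => 0

/-- The current `W_{abar}(x)`; `L` is the chosen value of `log (-q_a)`. -/
def expW (l : Fin 4 → ℂ) (a : Fin 4) (L : ℂ) : Exponent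
  | .osc n => (∏ i, (1 - q l (a.succAbove i) ^ (-n)))⁻¹
  | .logs => -l a
  | .s => -l a * L
  | .dt => -l a
  | _ => 0

/-- The Fock module with zero modes: functions of `(t, t̃)` with values in the Fock space. -/
abbrev Space := ℂ × ℂ → Fock

/-- The coefficient of `x^γ`, `γ ∈ ℂ`, in the normal ordered vertex operator with exponent `φ`
(zero modes `t₀, t̃₀` to the left of `∂_t, ∂̃_t`). On the sector `(t, t̃)` only exponents
`γ ∈ φ_{logt} t + φ_{logs} t̃ + ℤ` occur. -/
def vertexCoeff (l : Fin 4 → ℂ) (φ : Exponent) (γ : ℂ) : Module.End ℂ Space where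
  toFun f := fun z =>
    if h : ∃ k : ℤ, γ = φ .logt * z.1 + φ .logs * z.2 + k then
      Complex.exp (φ .t * z.1 + φ .s * z.2) •
        oscMode l (fun n => φ (.osc n)) h.choose (f (z.1 + φ .dt, z.2 + φ .ds))
    else 0
  map_add' f g := by
    funext z
    by_cases h : ∃ k : ℤ, γ = φ .logt * z.1 + φ .logs * z.2 + k
    · simp only [dif_pos h, Pi.add_apply, map_add, smul_add]
    · simp only [dif_neg h, Pi.add_apply, add_zero]
  map_smul' c f := by
    funext z
    by_cases h : ∃ k : ℤ, γ = φ .logt * z.1 + φ .logs * z.2 + k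
    · simp only [dif_pos h, Pi.smul_apply, map_smul, RingHom.id_apply]
      rw [smul_comm]
    · simp only [dif_neg h, Pi.smul_apply, smul_zero]

/-! ### The `qq`-character -/

/-- The exponent of the highest weight `:W_{abar}(x) ∏_{v ∈ B_{λμν}} A⁻¹(χ_{abar,x}(v)):`, where
the infinite products along the legs are regularized by
`∏_{k ≥ 0} A⁻¹(q_i^k x) = S_i(x)⁻¹`, and the boxes in the intersections of the legs, which are
then counted more than once, are compensated by the finite product over
`(B_λ ∩ B_μ) + (B_μ ∩ B_ν) + (B_ν ∩ B_λ) - B_λ ∩ B_μ ∩ B_ν`. -/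
def expHW (l : Fin 4 → ℂ) (a : Fin 4) (L : ℂ) (Y : Fin 3 → YoungDiagram) : Exponent :=
  expW l a L
    - ∑ i, ∑ p ∈ (Y i).cells, rescale (logChi l a (foot i p)) (expS l (a.succAbove i))
    + (∑ i, ∑ v ∈ (finite_inter Y i).toFinset, rescale (logChi l a v) expA
      - ∑ v ∈ (finite_triple Y).toFinset, rescale (logChi l a v) expA)

/-- The exponent of `Λ^{λμν}_{abar,π}(x)`. -/
def expLambda (l : Fin 4 → ℂ) (a : Fin 4) (L : ℂ) (Y : Fin 3 → YoungDiagram) (π : PP Y) :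
    Exponent :=
  expHW l a L Y - ∑ v ∈ π.1, rescale (logChi l a v) expA

/-- The coefficient of `𝔮^N x^γ` in
`T_{abar,λμν}(x) = ∑_π 𝔮^{|π|} Z̃[π] Λ^{λμν}_{abar,π}(x)`; it is zero for `N < 0`. -/
def qqCharacter (l : Fin 4 → ℂ) (a : Fin 4) (L : ℂ) (Y : Fin 3 → YoungDiagram) (N : ℤ) (γ : ℂ) :
    Module.End ℂ Space :=
  ∑ π ∈ (finite_size Y N).toFinset, Z l a Y π • vertexCoeff l (expLambda l a L Y π) γ

/-- The coefficient of `x'^α` in `S_a(q_a^k x')`. -/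
def screening (l : Fin 4 → ℂ) (a : Fin 4) (k : ℤ) (α : ℂ) : Module.End ℂ Space :=
  vertexCoeff l (rescale (k * l a) (expS l a)) α

/-- The coefficient of `𝔮^M x^γ x'^α` in `𝔮^k [T_{abar,λμν}(x), S_a(q_a^k x')]`.

The parameter `𝔮` enters through the rescaling `A(x) → 𝔮⁻¹ A(x)`, that is `t₀ → t₀ - log 𝔮`, which
by `A(x) = :S_a(x) / S_a(q_a x):` also acts on the screening current.  It multiplies
`S_a(x') = x'^{-t₀ / log q_a} ⋯` by `x'^{log 𝔮 / log q_a}`, hence `S_a(q_a^k x')` by `𝔮^k` and by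
the prefactor `x'^{log 𝔮 / log q_a}`, which is common to all `k` and is left out. -/
def commutatorTerm (l : Fin 4 → ℂ) (a : Fin 4) (L : ℂ) (Y : Fin 3 → YoungDiagram) (M : ℤ)
    (k : ℤ) (γ α : ℂ) : Module.End ℂ Space :=
  qqCharacter l a L Y (M - k) γ * screening l a k α
    - screening l a k α * qqCharacter l a L Y (M - k) γ

/-! ### Formal sums of delta functions

With `δ(z) = ∑_{n ∈ ℤ} z^n`, a bilateral sum over `k` such as `∑_k δ(q_a^k z)` is not a formal
Laurent series, but it is a sum of delta functions at the distinct points `q_a^{-k}`.  Sums over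
`k` of finite combinations of delta functions are taken support point by support point. -/

/-- The family `B γ α` of coefficients of `x^γ x'^α` is a finite combination
`x'^{c t₀} ∑_r δ(x' / (r x)) β_r(x)` of delta functions, where `β_r(x) = ∑_γ (β r γ) x^γ` and
where the operator `x'^{c t₀}` stands to the left. -/
def HasDeltaExpansion (c : ℂ) (B : ℂ → ℂ → Module.End ℂ Space)
    (β : ℂˣ → ℂ → Module.End ℂ Space) : Prop :=
  (Function.support β).Finite ∧
  ∀ (γ α : ℂ) (f : Space) (z : ℂ × ℂ),
    (∀ n : ℤ, α = c * z.1 + n →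
      B γ α f z = ∑ᶠ r : ℂˣ, ((r : ℂ) ^ (-n)) • β r (γ + n) f z) ∧
    ((¬ ∃ n : ℤ, α = c * z.1 + n) → B γ α f z = 0)

/-- The coefficients of the delta functions are determined by the formal series. -/
theorem HasDeltaExpansion.unique {c : ℂ} {B : ℂ → ℂ → Module.End ℂ Space}
    {β β' : ℂˣ → ℂ → Module.End ℂ Space} (h : HasDeltaExpansion c B β)
    (h' : HasDeltaExpansion c B β') : β = β' := by
  funext r₀ γ
  refine LinearMap.ext fun f => ?_
  funext z
  refine MvPolynomial.ext _ _ fun m => ?_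
  have hfin := h.1.union h'.1
  set s := hfin.toFinset with hs
  have hexp : ∀ n : ℤ, ∑ r ∈ s, ((r : ℂ) ^ (-n)) *
      (MvPolynomial.coeff m (β r γ f z) - MvPolynomial.coeff m (β' r γ f z)) = 0 := by
    intro n
    have e1 := ((h.2 (γ - n) (c * z.1 + n) f z).1 n rfl).symm.trans
      ((h'.2 (γ - n) (c * z.1 + n) f z).1 n rfl)
    have aux : ∀ b : ℂˣ → ℂ → Module.End ℂ Space, Function.support b ⊆ s →
        ∑ᶠ r : ℂˣ, ((r : ℂ) ^ (-n)) • b r (γ - n + n) f z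
          = ∑ r ∈ s, ((r : ℂ) ^ (-n)) • b r γ f z := by
      intro b hb
      rw [sub_add_cancel]
      refine finsum_eq_sum_of_support_subset _ fun r hr => hb fun h0 => hr ?_
      simp [h0]
    rw [aux β (by rw [hs, Set.Finite.coe_toFinset]; exact Set.subset_union_left),
      aux β' (by rw [hs, Set.Finite.coe_toFinset]; exact Set.subset_union_right)] at e1
    have e2 := congrArg (MvPolynomial.coeff m) e1
    simp only [MvPolynomial.coeff_sum, MvPolynomial.coeff_smul, smul_eq_mul] at e2
    simp only [mul_sub, Finset.sum_sub_distrib, e2, sub_self]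
  have hli := linearIndependent_monoidHom (Multiplicative ℤ) ℂ
  let χ : ℂˣ → (Multiplicative ℤ →* ℂ) := fun r => (Units.coeHom ℂ).comp (zpowersHom ℂˣ r)
  have hχ : Function.Injective χ := by
    intro r r' hr
    have := DFunLike.congr_fun hr (Multiplicative.ofAdd 1)
    exact Units.ext (by simpa [χ] using this)
  have hli' := hli.comp χ hχ
  rw [linearIndependent_iff'] at hli'
  have key := hli' s (fun r => MvPolynomial.coeff m (β r γ f z)
    - MvPolynomial.coeff m (β' r γ f z)) (by
      funext n
      have := hexp (-(Multiplicative.toAdd n))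
      simpa [χ, mul_comm, Finset.sum_apply] using this)
  by_cases hr : r₀ ∈ s
  · exact sub_eq_zero.1 (key r₀ hr)
  · have : r₀ ∉ Function.support β ∪ Function.support β' := by
      rwa [hs, Set.Finite.mem_toFinset] at hr
    have h0 : β r₀ = 0 := by
      by_contra h0
      exact this (Or.inl h0)
    have h1 : β' r₀ = 0 := by
      by_contra h1
      exact this (Or.inr h1)
    rw [h0, h1]

/-- The formal sum `∑_k B_k`, `k ∈ ℤ`, of finite combinations of delta functions exists and is
zero: at each support point only finitely many `k` contribute, and their contributions add up to
zero. -/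
def DeltaSumEqZero (c : ℂ) (B : ℤ → ℂ → ℂ → Module.End ℂ Space) : Prop :=
  ∃ β : ℤ → ℂˣ → ℂ → Module.End ℂ Space,
    (∀ k, HasDeltaExpansion c (B k) (β k)) ∧
    ∀ r : ℂˣ, (Function.support fun k => β k r).Finite ∧ ∑ᶠ k : ℤ, β k r = 0

end GaugeOrigami

end

open GaugeOrigami

/-! Put `Y_π = 1 - P_abar (K_π + N_{λμν})`, the character `yChar`. It is finite, and both claims
concern the rational function `∏_w (1 - w x / x')^(-y_w)` built from its multiplicities `y_w`. By
multiplicative independence different weights are different numbers. Three facts about `Y_π` carry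
everything. No multiplicity exceeds `1`, and multiplicity `1` occurs exactly at the weights of the
boxes that can be added and at `q_a⁻¹` times the weights of the boxes that can be removed
(`yChar_le_one`, `yChar_eq_one_iff`), so the poles are simple and are labelled by boxes. The
multiplicities add up to `1` (`pairing_one_yChar`), so the function vanishes at one end of the
projective line and is the sum of its partial fractions. The product of the weights with
multiplicity is `1` (`signedProd_yChar`, up to the sign built into `signedProd`), so the expansions
at both ends have matching residues.

Recursion. Adding a box `v` changes the character of the partition function by `v q_a⁻¹ Y_π^∨ - v
Y_{π+v}^∨` plus a piece `X^∨ - X`, where `X` is divisible by `P_abar` and has no constant term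
(`vChar_insert`, `crossTerm_zero`). Since `(1 - w) / (1 - w⁻¹) = -w`, and since the product of the
`-w` over a multiple of `P_abar` is `1`, that piece has index `1`. What remains is the quotient of
two residues; its sign comes from the trivial weight, which occurs once in `P_abar` (`Z_insert`).
Every configuration is reached from the empty one box by box, so there is only one solution
(`residueRecursion_iff`).

Commutator. The contractions of `Λ_π S_a` and of `S_a Λ_π` expand one rational function in opposite
directions, once the zero modes, with `exp L = -q_a`, have supplied the prefactors. Hence the
commutator is a sum over the poles: residue, times delta function, times the normal ordered product
at the pole (`oscMode_exchange`, `commutator_expLambda_screening`). The pole of `Λ_π` at an addable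
`v` in the term `k + 1` and the pole of `Λ_{π+v}` at the removable `v` in the term `k` lie at the
same point. There the relation `A(x) = :S_a(x) / S_a(q_a x):` makes the two operators equal, and the
recursion makes their coefficients opposite (`poleTerm_insert`).

So the term `k` is `D_k - D_{k+1}`, where `D_k` collects the addable poles (`sum_poles_eq`), and the
sum over `k` telescopes. Finiteness at a fixed support point is a matter of growth
(`finite_support_addableSum`): lowering `k` by one moves the addable box by `(1, 1, 1)`, which
forces cubically many boxes into the configuration, while only `M - k` are available. -/

noncomputable section

open scoped Classical

namespace GaugeOrigami

/-! ### Exponentials of power series and partial fractions. -/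

section ExpSeries

open PowerSeries

/-- The series `∑_{n ≥ 1} c_n z^n`. -/
def tailSeries {R : Type*} [CommRing R] (c : ℕ → R) : R⟦X⟧ := PowerSeries.mk fun n => if n = 0 then 0 else c n

theorem coeff_tailSeries {R : Type*} [CommRing R] (c : ℕ → R) (n : ℕ) :
    coeff n (tailSeries c) = if n = 0 then 0 else c n := by
  rw [tailSeries, coeff_mk]

theorem constantCoeff_tailSeries {R : Type*} [CommRing R] (c : ℕ → R) : constantCoeff (tailSeries c) = 0 := by
  rw [← coeff_zero_eq_constantCoeff_apply, coeff_tailSeries, if_pos rfl]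

variable {R S : Type*} [CommRing R] [Algebra ℚ R] [CommRing S] [Algebra ℚ S]

/-- The exponential of a power series without constant term. -/
def expSeries (f : R⟦X⟧) : R⟦X⟧ := (exp R).subst f

theorem constantCoeff_expSeries {f : R⟦X⟧} (hf : constantCoeff f = 0) :
    constantCoeff (expSeries f) = 1 := by
  have h := HasSubst.of_constantCoeff_zero' hf
  rw [expSeries, ← coeff_zero_eq_constantCoeff_apply, coeff_subst' h, finsum_eq_single _ 0]
  · simp
  · intro n hn
    simp [hf, hn]

theorem derivative_expSeries {f : R⟦X⟧} (hf : constantCoeff f = 0) :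
    d⁄dX R (expSeries f) = d⁄dX R f * expSeries f := by
  rw [expSeries, derivative_subst (HasSubst.of_constantCoeff_zero' hf), derivative_exp, mul_comm]

/-- The exponential is characterized by its logarithmic derivative. -/
theorem eq_of_derivative_eq_mul {F G D : R⟦X⟧} (hF : d⁄dX R F = D * F) (hG : d⁄dX R G = D * G)
    (h0 : constantCoeff F = constantCoeff G) : F = G := by
  ext n
  induction n using Nat.strong_induction_on with
  | _ n ih =>
    cases n with
    | zero => simpa using h0
    | succ n =>
      have h1 := congrArg (coeff n) hF
      have h2 := congrArg (coeff n) hG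
      rw [coeff_derivative, coeff_mul] at h1 h2
      have h3 : ∑ p ∈ Finset.HasAntidiagonal.antidiagonal n, coeff p.1 D * coeff p.2 F
          = ∑ p ∈ Finset.HasAntidiagonal.antidiagonal n, coeff p.1 D * coeff p.2 G := by
        refine Finset.sum_congr rfl fun p hp => ?_
        rw [ih p.2 (by have := Finset.HasAntidiagonal.mem_antidiagonal.1 hp; omega)]
      rw [h3, ← h2] at h1
      -- The equation gives `n + 1` times the next coefficient in terms of lower ones; rational
      -- scalars allow the division.
      have hu : IsUnit ((n : R) + 1) := by
        have : (n : R) + 1 = algebraMap ℚ R (n + 1) := by simp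
        rw [this]
        exact (IsUnit.mk0 _ (by positivity)).map _
      exact hu.mul_right_cancel h1

theorem eq_expSeries {f F : R⟦X⟧} (hf : constantCoeff f = 0) (h0 : constantCoeff F = 1)
    (hF : d⁄dX R F = d⁄dX R f * F) : F = expSeries f :=
  eq_of_derivative_eq_mul hF (derivative_expSeries hf) (by rw [h0, constantCoeff_expSeries hf])

theorem expSeries_zero : expSeries (0 : R⟦X⟧) = 1 :=
  (eq_expSeries (by simp) (by simp) (by simp)).symm

theorem expSeries_add {f g : R⟦X⟧} (hf : constantCoeff f = 0) (hg : constantCoeff g = 0) :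
    expSeries (f + g) = expSeries f * expSeries g := by
  refine (eq_expSeries (by simp [hf, hg]) ?_ ?_).symm
  · rw [map_mul, constantCoeff_expSeries hf, constantCoeff_expSeries hg, one_mul]
  · rw [Derivation.leibniz, derivative_expSeries hf, derivative_expSeries hg, map_add,
      smul_eq_mul, smul_eq_mul]
    ring

theorem expSeries_sum {ι : Type*} (s : Finset ι) (f : ι → R⟦X⟧)
    (hf : ∀ i ∈ s, constantCoeff (f i) = 0) :
    expSeries (∑ i ∈ s, f i) = ∏ i ∈ s, expSeries (f i) := by
  induction s using Finset.induction_on with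
  | empty => simp [expSeries_zero]
  | insert i s hi ih =>
    have hs : ∀ j ∈ s, constantCoeff (f j) = 0 := fun j hj => hf j (Finset.mem_insert_of_mem hj)
    rw [Finset.sum_insert hi, Finset.prod_insert hi, expSeries_add (hf i (Finset.mem_insert_self _ _))
      (by rw [map_sum]; exact Finset.sum_eq_zero hs), ih hs]

theorem expSeries_nsmul {f : R⟦X⟧} (hf : constantCoeff f = 0) (n : ℕ) :
    expSeries (n • f) = expSeries f ^ n := by
  have := expSeries_sum (Finset.range n) (fun _ => f) (fun _ _ => hf)
  simpa using this

theorem map_expSeries (h : R →+* S) {f : R⟦X⟧} (hf : constantCoeff f = 0) :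
    PowerSeries.map h (expSeries f) = expSeries (PowerSeries.map h f) := by
  have hd : ∀ g : R⟦X⟧, d⁄dX S (PowerSeries.map h g) = PowerSeries.map h (d⁄dX R g) := by
    intro g
    ext n
    simp [coeff_derivative]
  refine eq_expSeries ?_ ?_ ?_
  · rw [← coeff_zero_eq_constantCoeff_apply, coeff_map, coeff_zero_eq_constantCoeff_apply, hf,
      map_zero]
  · rw [← coeff_zero_eq_constantCoeff_apply, coeff_map, coeff_zero_eq_constantCoeff_apply,
      constantCoeff_expSeries hf, map_one]
  · rw [hd, hd, derivative_expSeries hf, map_mul]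

theorem rescale_expSeries (a : R) {f : R⟦X⟧} (hf : constantCoeff f = 0) :
    PowerSeries.rescale a (expSeries f) = expSeries (PowerSeries.rescale a f) := by
  have hd : ∀ g : R⟦X⟧, d⁄dX R (PowerSeries.rescale a g)
      = PowerSeries.C a * PowerSeries.rescale a (d⁄dX R g) := by
    intro g
    ext n
    simp [coeff_derivative, coeff_rescale]
    ring
  refine eq_expSeries ?_ ?_ ?_
  · rw [← coeff_zero_eq_constantCoeff_apply, coeff_rescale, coeff_zero_eq_constantCoeff_apply, hf,
      mul_zero]
  · rw [← coeff_zero_eq_constantCoeff_apply, coeff_rescale, coeff_zero_eq_constantCoeff_apply,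
      constantCoeff_expSeries hf, pow_zero, one_mul]
  · rw [hd, hd, derivative_expSeries hf, map_mul, mul_assoc]

/-- A translation of the exponent multiplies the exponential by a scalar series. -/
theorem map_coeff_expSeries_of_translation (h : R →+* Polynomial R) {t u : R⟦X⟧}
    (ht : constantCoeff t = 0) (hu : constantCoeff u = 0)
    (htu : ∀ n, h (coeff n t) = Polynomial.C (coeff n t) + Polynomial.monomial n (coeff n u))
    (N : ℕ) :
    h (coeff N (expSeries t)) = ∑ i ∈ Finset.range (N + 1),
      Polynomial.monomial i (coeff i (expSeries u) * coeff (N - i) (expSeries t)) := by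
  have hmap0 : ∀ F : R⟦X⟧, constantCoeff F = 0 →
      constantCoeff (PowerSeries.map (Polynomial.C : R →+* Polynomial R) F) = 0 := by
    intro F hF
    rw [← coeff_zero_eq_constantCoeff_apply, coeff_map, coeff_zero_eq_constantCoeff_apply, hF,
      map_zero]
  have hr0 : constantCoeff (PowerSeries.rescale (Polynomial.X : Polynomial R)
      (PowerSeries.map Polynomial.C u)) = 0 := by
    rw [← coeff_zero_eq_constantCoeff_apply, coeff_rescale, coeff_zero_eq_constantCoeff_apply,
      hmap0 _ hu, mul_zero]
  -- The factor `y^n` in the `n`-th shift is absorbed by rescaling the series variable of `u` by the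
  -- polynomial variable `y`.
  have hlog : PowerSeries.map h t
      = PowerSeries.rescale Polynomial.X (PowerSeries.map Polynomial.C u)
        + PowerSeries.map Polynomial.C t := by
    ext1 n
    rw [map_add, coeff_rescale, coeff_map, coeff_map, coeff_map, htu, add_comm,
      mul_comm (Polynomial.X ^ n), Polynomial.C_mul_X_pow_eq_monomial]
  have key : PowerSeries.map h (expSeries t)
      = PowerSeries.rescale Polynomial.X (PowerSeries.map Polynomial.C (expSeries u))
        * PowerSeries.map Polynomial.C (expSeries t) := by
    rw [map_expSeries h ht, hlog, expSeries_add hr0 (hmap0 _ ht),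
      map_expSeries _ hu, rescale_expSeries _ (hmap0 _ hu), map_expSeries _ ht]
  have := congrArg (coeff N) key
  rw [coeff_map, coeff_mul, Finset.Nat.sum_antidiagonal_eq_sum_range_succ_mk] at this
  refine this.trans (Finset.sum_congr rfl fun i _ => ?_)
  rw [coeff_rescale, coeff_map, coeff_map, mul_comm (Polynomial.X ^ i),
    Polynomial.C_mul_X_pow_eq_monomial, Polynomial.monomial_mul_C]

/-- The logarithmic derivative of the exponential is the geometric series `c / (1 - c z)`, so the
product has derivative zero and constant term `1`. -/
theorem expSeries_geom (c : ℂ) :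
    expSeries (tailSeries fun n => c ^ n / n) * (1 - C c * X) = 1 := by
  set E : ℂ⟦X⟧ := expSeries (tailSeries fun n => c ^ n / n) with hE
  have hc := constantCoeff_tailSeries (fun n : ℕ => c ^ n / n)
  have hd : d⁄dX ℂ (tailSeries fun n : ℕ => c ^ n / n) * (1 - C c * X) = C c := by
    have h1 : d⁄dX ℂ (tailSeries fun n : ℕ => c ^ n / n) = mk fun n => c ^ (n + 1) := by
      ext n
      rw [coeff_derivative, coeff_tailSeries, coeff_mk, if_neg (Nat.succ_ne_zero n)]
      have : ((n : ℂ) + 1) ≠ 0 := by exact_mod_cast Nat.succ_ne_zero n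
      push_cast
      field_simp
    rw [h1]
    ext n
    cases n with
    | zero => simp [mul_sub]
    | succ n =>
      rw [mul_sub, mul_one, map_sub, ← mul_assoc, coeff_succ_mul_X, mul_comm, coeff_C_mul,
        coeff_mk, coeff_mk, coeff_C, if_neg (Nat.succ_ne_zero n)]
      ring
  refine eq_of_derivative_eq_mul (D := 0) ?_ (by simp) ?_
  · rw [Derivation.leibniz, derivative_expSeries hc, smul_eq_mul, smul_eq_mul, map_sub,
      Derivation.leibniz, derivative_one, derivative_C, derivative_X]
    simp only [smul_eq_mul, mul_one, mul_zero, add_zero, zero_sub, zero_mul]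
    rw [mul_comm (1 - C c * X), mul_right_comm, hd]
    ring
  · rw [map_mul, constantCoeff_expSeries hc]
    simp

theorem coeff_expSeries_geom (c : ℂ) (j : ℕ) :
    coeff j (expSeries (tailSeries fun n => c ^ n / n)) = c ^ j := by
  have h : (mk fun n => c ^ n : ℂ⟦X⟧) * (1 - C c * X) = 1 := by
    ext n
    cases n with
    | zero => simp [mul_sub]
    | succ n =>
      rw [mul_sub, mul_one, map_sub, ← mul_assoc, coeff_succ_mul_X, mul_comm, coeff_C_mul,
        coeff_mk, coeff_mk, coeff_one, if_neg (Nat.succ_ne_zero n), pow_succ']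
      ring
  have h' := expSeries_geom c
  rw [mul_comm] at h'
  rw [← left_inv_eq_right_inv h h', coeff_mk]

/-- The coefficients of the expansion at zero of `∏ (1 - ω_i z)^{-y_i}`, when the poles are simple
and the function vanishes at infinity. -/
theorem coeff_expSeries_partialFraction {ι : Type*} (s : Finset ι) (ω : ι → ℂ) (y : ι → ℤ)
    (hω : ∀ i ∈ s, ω i ≠ 0) (hinj : Set.InjOn ω s) (hy : ∀ i ∈ s, y i ≤ 1)
    (hsum : 0 < ∑ i ∈ s, y i) (j : ℕ) :
    coeff j (expSeries (tailSeries fun n => (∑ i ∈ s, (y i : ℂ) * ω i ^ n) / n)) =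
      ∑ i ∈ s with y i = 1, (∏ i' ∈ s.erase i, (1 - ω i' / ω i) ^ (-y i')) * ω i ^ j := by
  set P := s.filter fun i => y i = 1 with hP
  set R : ι → ℂ := fun i => ∏ i' ∈ s.erase i, (1 - ω i' / ω i) ^ (-y i') with hR
  set F := expSeries (tailSeries fun n => (∑ i ∈ s, (y i : ℂ) * ω i ^ n) / n) with hF
  let E : ι → ℂ⟦X⟧ := fun i => expSeries (tailSeries fun n => ω i ^ n / n)
  let d : ι → Polynomial ℂ := fun i => 1 - Polynomial.C (ω i) * Polynomial.X
  have hd : ∀ i, ((d i : Polynomial ℂ) : ℂ⟦X⟧) = 1 - C (ω i) * X := by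
    intro i
    simp [d]
  have hEd : ∀ i, E i * (d i : ℂ⟦X⟧) = 1 := by
    intro i
    rw [hd]
    exact expSeries_geom (ω i)
  -- Splitting `y` into positive and negative parts avoids inverses of power series.
  have hexp : F * ∏ i ∈ s, E i ^ (-y i).toNat = ∏ i ∈ s, E i ^ (y i).toNat := by
    have h0 : ∀ i, constantCoeff (tailSeries fun n : ℕ => ω i ^ n / n) = 0 :=
      fun i => constantCoeff_tailSeries _
    have hs0 : ∀ m : ι → ℕ, ∀ i ∈ s,
        constantCoeff (m i • tailSeries fun n : ℕ => ω i ^ n / n) = 0 := by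
      intro m i _
      rw [map_nsmul, h0, smul_zero]
    have hprod : ∀ m : ι → ℕ, ∏ i ∈ s, E i ^ m i
        = expSeries (∑ i ∈ s, m i • tailSeries fun n : ℕ => ω i ^ n / n) := by
      intro m
      rw [expSeries_sum _ _ (hs0 m)]
      exact Finset.prod_congr rfl fun i _ => (expSeries_nsmul (h0 i) _).symm
    rw [hprod, hprod, ← expSeries_add (constantCoeff_tailSeries _)
      (by rw [map_sum]; exact Finset.sum_eq_zero (hs0 _))]
    congr 1
    ext n
    simp only [map_add, map_sum, map_nsmul, coeff_tailSeries]
    by_cases hn : n = 0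
    · simp [hn]
    · simp only [if_neg hn, nsmul_eq_mul]
      rw [Finset.sum_div, ← Finset.sum_add_distrib]
      refine Finset.sum_congr rfl fun i _ => ?_
      have : ((y i : ℤ) : ℂ) = ((y i).toNat : ℂ) - ((-y i).toNat : ℂ) := by
        have h := Int.toNat_sub_toNat_neg (y i)
        exact_mod_cast h.symm
      rw [this]
      ring
  have hFD : F * ((∏ i ∈ P, d i : Polynomial ℂ) : ℂ⟦X⟧)
      = ((∏ i ∈ s, d i ^ (-y i).toNat : Polynomial ℂ) : ℂ⟦X⟧) := by
    have hcoe : ∀ (t : Finset ι) (m : ι → ℕ), ((∏ i ∈ t, d i ^ m i : Polynomial ℂ) : ℂ⟦X⟧)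
        = ∏ i ∈ t, (d i : ℂ⟦X⟧) ^ m i := by
      intro t m
      rw [← Polynomial.coeToPowerSeries.ringHom_apply, map_prod]
      simp only [map_pow, Polynomial.coeToPowerSeries.ringHom_apply]
    -- Since `y i ≤ 1`, the positive part of `y i` is the indicator of `P`: the denominator is
    -- squarefree.
    have hPp : (∏ i ∈ P, d i) = ∏ i ∈ s, d i ^ (y i).toNat := by
      rw [hP, Finset.prod_filter]
      refine Finset.prod_congr rfl fun i hi => ?_
      by_cases h1 : y i = 1
      · simp [h1]
      · have : (y i).toNat = 0 := by have := hy i hi; omega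
        simp [h1, this]
    have hinv : ∀ m : ι → ℕ, (∏ i ∈ s, E i ^ m i) * ∏ i ∈ s, (d i : ℂ⟦X⟧) ^ m i = 1 := by
      intro m
      rw [← Finset.prod_mul_distrib]
      refine Finset.prod_eq_one fun i _ => ?_
      rw [← mul_pow, hEd, one_pow]
    rw [hPp, hcoe, hcoe]
    have h1 := hinv fun i => (-y i).toNat
    have h2 := hinv fun i => (y i).toNat
    calc F * ∏ i ∈ s, (d i : ℂ⟦X⟧) ^ (y i).toNat
        = (F * ∏ i ∈ s, E i ^ (-y i).toNat) * (∏ i ∈ s, (d i : ℂ⟦X⟧) ^ (-y i).toNat)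
            * ∏ i ∈ s, (d i : ℂ⟦X⟧) ^ (y i).toNat := by rw [mul_assoc F, h1, mul_one]
      _ = ((∏ i ∈ s, E i ^ (y i).toNat) * ∏ i ∈ s, (d i : ℂ⟦X⟧) ^ (y i).toNat)
            * ∏ i ∈ s, (d i : ℂ⟦X⟧) ^ (-y i).toNat := by rw [hexp]; ring
      _ = _ := by rw [h2, one_mul]
  have hPs : ∀ i ∈ P, i ∈ s ∧ y i = 1 := fun i hi => Finset.mem_filter.1 hi
  have hdeg1 : ∀ i, (d i).natDegree ≤ 1 := by
    intro i
    refine (Polynomial.natDegree_sub_le _ _).trans ?_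
    simp only [Polynomial.natDegree_one]
    exact max_le (Nat.zero_le _) ((Polynomial.natDegree_C_mul_le _ _).trans
      Polynomial.natDegree_X_le)
  -- The hypothesis that the exponents have positive sum says that the numerator has smaller degree
  -- than the denominator, so the partial fractions have no polynomial part.
  have hcard : ∑ i ∈ s, (-y i).toNat < P.card := by
    have h1 : ∑ i ∈ s, y i = (P.card : ℤ) - ((∑ i ∈ s, (-y i).toNat : ℕ) : ℤ) := by
      rw [hP, Finset.card_filter, Nat.cast_sum, Nat.cast_sum, ← Finset.sum_sub_distrib]
      refine Finset.sum_congr rfl fun i hi => ?_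
      have := hy i hi
      by_cases h1 : y i = 1
      · simp [h1]
      · rw [if_neg h1]
        push_cast
        omega
    omega
  have hev : ∀ i i', i ∈ s → (d i').eval (ω i)⁻¹ = 1 - ω i' / ω i := by
    intro i i' _
    simp [d, div_eq_mul_inv]
  -- Lagrange interpolation: both sides have degree below the number of poles and agree at every
  -- pole `(ω i)⁻¹`.
  have hN : (∏ i ∈ s, d i ^ (-y i).toNat)
      = ∑ i ∈ P, Polynomial.C (R i) * ∏ i' ∈ P.erase i, d i' := by
    refine Polynomial.eq_of_degrees_lt_of_eval_index_eq P (v := fun i => (ω i)⁻¹) ?_ ?_ ?_ ?_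
    · intro i hi i' hi' h
      exact hinj (hPs i hi).1 (hPs i' hi').1 (inv_injective h)
    · refine lt_of_le_of_lt Polynomial.degree_le_natDegree ?_
      have : (∏ i ∈ s, d i ^ (-y i).toNat).natDegree ≤ ∑ i ∈ s, (-y i).toNat := by
        refine (Polynomial.natDegree_prod_le _ _).trans (Finset.sum_le_sum fun i _ => ?_)
        exact Polynomial.natDegree_pow_le.trans (by simpa using Nat.mul_le_mul_left _ (hdeg1 i))
      exact_mod_cast lt_of_le_of_lt this hcard
    · refine lt_of_le_of_lt (Polynomial.degree_sum_le _ _) ?_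
      rw [Finset.sup_lt_iff (by simp)]
      intro i hi
      refine lt_of_le_of_lt Polynomial.degree_le_natDegree ?_
      have : (Polynomial.C (R i) * ∏ i' ∈ P.erase i, d i').natDegree ≤ (P.erase i).card := by
        refine (Polynomial.natDegree_C_mul_le _ _).trans ?_
        refine (Polynomial.natDegree_prod_le _ _).trans ?_
        simpa using Finset.sum_le_sum fun i' (_ : i' ∈ P.erase i) => hdeg1 i'
      have h2 := Finset.card_erase_lt_of_mem hi
      exact_mod_cast lt_of_le_of_lt this h2
    · intro i hi
      have hi' := hPs i hi
      have hself : (d i).eval (ω i)⁻¹ = 0 := by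
        rw [hev i i hi'.1, div_self (hω i hi'.1), sub_self]
      have hne : ∀ i' ∈ s.erase i, (1 - ω i' / ω i) ≠ 0 := by
        intro i' h h0
        have h1 := Finset.mem_erase.1 h
        refine h1.1 (hinj h1.2 hi'.1 ?_)
        have := hω i hi'.1
        field_simp at h0
        rw [mul_zero] at h0
        exact (sub_eq_zero.1 h0).symm
      rw [Polynomial.eval_finsetSum, Finset.sum_eq_single i]
      · rw [Polynomial.eval_mul, Polynomial.eval_C, Polynomial.eval_prod, Polynomial.eval_prod,
          ← Finset.mul_prod_erase s _ hi'.1]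
        have hz : (-y i).toNat = 0 := by rw [hi'.2]; rfl
        have hPe : ∏ i' ∈ P.erase i, (d i').eval (ω i)⁻¹
            = ∏ i' ∈ s.erase i, (1 - ω i' / ω i) ^ (y i').toNat := by
          rw [hP, ← Finset.filter_erase, Finset.prod_filter]
          refine Finset.prod_congr rfl fun i' h => ?_
          have h1 := hy i' (Finset.mem_of_mem_erase h)
          by_cases h2 : y i' = 1
          · rw [if_pos h2, h2, hev i i' hi'.1]
            simp
          · have : (y i').toNat = 0 := by omega
            rw [if_neg h2, this, pow_zero]
        rw [hz, pow_zero, Polynomial.eval_one, one_mul, hPe, hR, ← Finset.prod_mul_distrib]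
        refine Finset.prod_congr rfl fun i' h => ?_
        rw [Polynomial.eval_pow, hev i i' hi'.1, ← zpow_natCast, ← zpow_natCast,
          ← zpow_add₀ (hne i' h)]
        congr 1
        omega
      · intro i' hi'' hne'
        rw [Polynomial.eval_mul, Polynomial.eval_prod, Finset.prod_eq_zero
          (Finset.mem_erase.2 ⟨hne'.symm, hi⟩) hself, mul_zero]
      · exact fun h => absurd hi h
  have hD0 : ((∏ i ∈ P, d i : Polynomial ℂ) : ℂ⟦X⟧) ≠ 0 := by
    intro h0
    have h1 := congrArg (Polynomial.eval 0) (Polynomial.coe_eq_zero_iff.1 h0)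
    rw [Polynomial.eval_prod] at h1
    simp [d] at h1
  have hFG : F = ∑ i ∈ P, C (R i) * E i := by
    refine mul_right_cancel₀ hD0 ?_
    rw [hFD, hN, Finset.sum_mul, ← Polynomial.coeToPowerSeries.ringHom_apply, map_sum]
    refine Finset.sum_congr rfl fun i hi => ?_
    rw [map_mul, ← Finset.mul_prod_erase P _ hi, Polynomial.coeToPowerSeries.ringHom_apply,
      Polynomial.coeToPowerSeries.ringHom_apply, Polynomial.coe_mul, Polynomial.coe_C,
      mul_assoc, ← mul_assoc (E i), hEd, one_mul]
  rw [hFG, map_sum]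
  refine Finset.sum_congr rfl fun i _ => ?_
  rw [coeff_C_mul, coeff_expSeries_geom]

end ExpSeries

/-! ### Products of normal ordered exponentials of oscillators -/

section Osc

open PowerSeries (coeff)

/-- The exponent `∑_{n ≥ 1} φ_{-n} a_{-n} x^n` of the creation part. -/
def creationLog (φ : ℤ → ℂ) : PowerSeries Fock :=
  tailSeries fun n : ℕ => MvPolynomial.C (φ (-(n : ℤ))) * MvPolynomial.X n.toPNat'

theorem constantCoeff_creationLog (φ : ℤ → ℂ) :
    PowerSeries.constantCoeff (creationLog φ) = 0 := constantCoeff_tailSeries _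

theorem creation_eq (φ : ℤ → ℂ) (j : ℕ) :
    creation φ j = coeff j (expSeries (creationLog φ)) := rfl

/-- `creation` extended by zero to negative degrees. -/
def creationZ (φ : ℤ → ℂ) (k : ℤ) : Fock := if 0 ≤ k then creation φ k.toNat else 0

theorem creationZ_natCast (φ : ℤ → ℂ) (n : ℕ) : creationZ φ n = creation φ n := by
  simp [creationZ]

theorem creationZ_of_neg (φ : ℤ → ℂ) {k : ℤ} (hk : k < 0) : creationZ φ k = 0 :=
  if_neg (not_le.2 hk)

/-- The map `y^j ↦ creation φ (k + j)`. -/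
def creationShift (φ : ℤ → ℂ) (k : ℤ) : Polynomial Fock →ₗ[ℂ] Fock :=
  Polynomial.lsum fun j : ℕ =>
      if 0 ≤ k + j then LinearMap.mulLeft ℂ (creation φ (k + j).toNat) else 0

theorem oscMode_apply (l : Fin 4 → ℂ) (φ : ℤ → ℂ) (k : ℤ) (f : Fock) :
    oscMode l φ k f = creationShift φ k (annihilation l φ f) := rfl

theorem creationShift_monomial (φ : ℤ → ℂ) (k : ℤ) (j : ℕ) (p : Fock) :
    creationShift φ k (Polynomial.monomial j p) = creationZ φ (k + j) * p := by
  rw [creationShift, Polynomial.lsum_apply, Polynomial.sum_monomial_index p _ (by simp), creationZ]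
  split_ifs <;> simp

theorem creationShift_monomial_mul (φ : ℤ → ℂ) (k : ℤ) (i : ℕ) (p : Fock) (P : Polynomial Fock) :
    creationShift φ k (Polynomial.monomial i p * P) = p * creationShift φ (k + i) P := by
  induction P using Polynomial.induction_on' with
  | add P Q hP hQ => rw [mul_add, map_add, map_add, hP, hQ, mul_add]
  | monomial j r =>
    rw [Polynomial.monomial_mul_monomial, creationShift_monomial, creationShift_monomial]
    push_cast
    rw [add_assoc]
    ring

theorem creationShift_eq_sum (φ : ℤ → ℂ) (k : ℤ) (P : Polynomial Fock) (B : ℕ)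
    (hB : P.natDegree < B) :
    creationShift φ k P = ∑ j ∈ Finset.range B, creationZ φ (k + j) * P.coeff j := by
  conv_lhs => rw [P.as_sum_range' B hB]
  rw [map_sum]
  exact Finset.sum_congr rfl fun j _ => creationShift_monomial φ k j _

/-- The logarithm of the contraction of two normal ordered exponentials. -/
def contractionLog (l : Fin 4 → ℂ) (φ σ : ℤ → ℂ) : PowerSeries ℂ :=
  tailSeries fun n : ℕ => φ n * σ (-(n : ℤ)) * bracket l n

/-- The contraction of two normal ordered exponentials. -/
def contraction (l : Fin 4 → ℂ) (φ σ : ℤ → ℂ) (j : ℕ) : ℂ :=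
  coeff j (expSeries (contractionLog l φ σ))

theorem annihilation_X (l : Fin 4 → ℂ) (φ : ℤ → ℂ) (n : ℕ+) :
    annihilation l φ (MvPolynomial.X n) = Polynomial.C (MvPolynomial.X n)
      + Polynomial.monomial (n : ℕ) (MvPolynomial.C (φ (n : ℕ) * bracket l (n : ℕ))) := by
  simp [annihilation]

theorem annihilation_C (l : Fin 4 → ℂ) (φ : ℤ → ℂ) (c : ℂ) :
    annihilation l φ (MvPolynomial.C c) = Polynomial.C (MvPolynomial.C c) := by
  simp [annihilation, Polynomial.algebraMap_apply]

/-- The annihilation part acts as a translation of the generators. It shifts the exponent of the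
creation part by a scalar series, and so multiplies the exponential by the contraction. -/
theorem annihilation_creation (l : Fin 4 → ℂ) (φ σ : ℤ → ℂ) (N : ℕ) :
    annihilation l φ (creation σ N) = ∑ i ∈ Finset.range (N + 1),
      Polynomial.monomial i (MvPolynomial.C (contraction l φ σ i) * creation σ (N - i)) := by
  have h1 : PowerSeries.constantCoeff (contractionLog l φ σ) = 0 := constantCoeff_tailSeries _
  have key := map_coeff_expSeries_of_translation (annihilation l φ : Fock →+* Polynomial Fock)
    (t := creationLog σ) (u := PowerSeries.map MvPolynomial.C (contractionLog l φ σ))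
    (constantCoeff_creationLog σ) ?_ ?_ N
  · rw [← map_expSeries _ h1] at key
    simp only [PowerSeries.coeff_map] at key
    exact key
  · rw [← PowerSeries.coeff_zero_eq_constantCoeff_apply, PowerSeries.coeff_map,
      PowerSeries.coeff_zero_eq_constantCoeff_apply, h1, map_zero]
  · intro n
    rw [PowerSeries.coeff_map, creationLog, contractionLog, coeff_tailSeries, coeff_tailSeries]
    by_cases hn : n = 0
    · simp [hn]
    · have hn' : ((n.toPNat' : ℕ+) : ℕ) = n := by
        rw [Nat.toPNat'_coe, if_pos (Nat.pos_of_ne_zero hn)]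
      rw [if_neg hn, if_neg hn]
      change annihilation l φ _ = _
      rw [map_mul, annihilation_X, annihilation_C, hn', mul_add, ← Polynomial.C_mul,
        Polynomial.C_mul_monomial, ← map_mul]
      congr 3
      ring

/-- Commuting an exponential through a creation operator. -/
theorem oscMode_creation_mul (l : Fin 4 → ℂ) (φ σ : ℤ → ℂ) (m N : ℤ) (f : Fock) (B : ℕ)
    (hB : N < B) :
    oscMode l φ m (creationZ σ N * f) = ∑ i ∈ Finset.range B,
      contraction l φ σ i • (creationZ σ (N - i) * oscMode l φ (m + i) f) := by
  by_cases hN : 0 ≤ N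
  · obtain ⟨N, rfl⟩ := Int.eq_ofNat_of_zero_le hN
    have hNB : N < B := by exact_mod_cast hB
    rw [creationZ_natCast, oscMode_apply, map_mul, annihilation_creation, Finset.sum_mul, map_sum]
    -- Enlarging the range is free because `creationZ` vanishes in negative degree; a bound
    -- independent of `N` is what later allows sums to be exchanged.
    rw [← Finset.sum_subset (Finset.range_mono (Nat.succ_le_of_lt hNB))]
    · refine Finset.sum_congr rfl fun i hi => ?_
      have hi : i ≤ N := Nat.lt_succ_iff.1 (Finset.mem_range.1 hi)
      rw [creationShift_monomial_mul, ← Nat.cast_sub hi, creationZ_natCast, oscMode_apply,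
        mul_assoc, MvPolynomial.smul_eq_C_mul]
    · intro i _ hi
      have hi : N < i := by simpa using hi
      rw [creationZ_of_neg _ (by omega), zero_mul, smul_zero]
  · rw [creationZ_of_neg _ (not_le.1 hN), zero_mul, map_zero]
    refine (Finset.sum_eq_zero fun i _ => ?_).symm
    rw [creationZ_of_neg _ (by omega), zero_mul, smul_zero]

/-- The translation `a_{-n} ↦ a_{-n} + φ_n [a_n, a_{-n}] y^n + σ_n [a_n, a_{-n}] y'^n`, where `y`
is the inner variable. -/
def annihilation₂ (l : Fin 4 → ℂ) (φ σ : ℤ → ℂ) : Fock →ₐ[ℂ] Polynomial (Polynomial Fock) :=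
  MvPolynomial.aeval fun n : ℕ+ => Polynomial.C (annihilation l φ (MvPolynomial.X n))
    + Polynomial.monomial (n : ℕ) (Polynomial.C (MvPolynomial.C (σ (n : ℕ) * bracket l (n : ℕ))))

theorem map_annihilation (l : Fin 4 → ℂ) (φ σ : ℤ → ℂ) (f : Fock) :
    (annihilation l σ f).map (annihilation l φ : Fock →+* Polynomial Fock)
      = annihilation₂ l φ σ f := by
  have : (Polynomial.mapAlgHom (annihilation l φ)).comp (annihilation l σ)
      = annihilation₂ l φ σ := by
    refine MvPolynomial.algHom_ext fun n => ?_
    simp [annihilation₂, annihilation_X]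
  exact DFunLike.congr_fun this f

/-- Nested annihilation becomes one bivariate polynomial, whose symmetry lets the two orders of a
product be compared coefficient by coefficient. -/
theorem coeff_annihilation_coeff (l : Fin 4 → ℂ) (φ σ : ℤ → ℂ) (f : Fock) (i j : ℕ) :
    (annihilation l φ ((annihilation l σ f).coeff j)).coeff i
      = ((annihilation₂ l φ σ f).coeff j).coeff i := by
  rw [← map_annihilation, Polynomial.coeff_map]
  rfl

theorem coeff_coeff_swap {R : Type*} [CommRing R] (p : Polynomial (Polynomial R)) (i j : ℕ) :
    ((Polynomial.Bivariate.swap p).coeff j).coeff i = (p.coeff i).coeff j := by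
  induction p using Polynomial.induction_on' with
  | add p q hp hq => simp only [map_add, Polynomial.coeff_add, hp, hq]
  | monomial n p =>
    induction p using Polynomial.induction_on' with
    | add p q hp hq => simp only [map_add, Polynomial.coeff_add, hp, hq]
    | monomial m r =>
      rw [Polynomial.Bivariate.swap_monomial_monomial, Polynomial.coeff_monomial,
        Polynomial.coeff_monomial]
      split_ifs <;> simp_all [Polynomial.coeff_monomial]

theorem coeff_eval_mul_X {R : Type*} [CommRing R] (c : R) (p : Polynomial (Polynomial R)) (J : ℕ) :
    (p.eval (Polynomial.C c * Polynomial.X)).coeff J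
      = ∑ j ∈ Finset.range (J + 1), c ^ j * (p.coeff j).coeff (J - j) := by
  induction p using Polynomial.induction_on' with
  | add p q hp hq =>
    simp only [Polynomial.eval_add, Polynomial.coeff_add, hp, hq, mul_add, Finset.sum_add_distrib]
  | monomial n p =>
    rw [Polynomial.eval_monomial, mul_pow, ← Polynomial.C_pow, mul_left_comm,
      Polynomial.coeff_C_mul, Polynomial.coeff_mul_X_pow']
    simp only [Polynomial.coeff_monomial]
    by_cases h : n ≤ J
    · rw [if_pos h, Finset.sum_eq_single n]
      · rw [if_pos rfl]
      · intro j _ hj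
        rw [if_neg (Ne.symm hj), Polynomial.coeff_zero, mul_zero]
      · exact fun h' => absurd (Finset.mem_range.2 (Nat.lt_succ_of_le h)) h'
    · rw [if_neg h, mul_zero]
      refine (Finset.sum_eq_zero fun j hj => ?_).symm
      have := Finset.mem_range.1 hj
      rw [if_neg (by omega), Polynomial.coeff_zero, mul_zero]

theorem swap_C_monomial {R : Type*} [CommRing R] (n : ℕ) (r : R) :
    Polynomial.Bivariate.swap (Polynomial.C (Polynomial.monomial n r))
      = Polynomial.monomial n (Polynomial.C r) :=
  Polynomial.Bivariate.swap_monomial_monomial 0 n r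

theorem swap_monomial_C {R : Type*} [CommRing R] (n : ℕ) (r : R) :
    Polynomial.Bivariate.swap (Polynomial.monomial n (Polynomial.C r))
      = Polynomial.C (Polynomial.monomial n r) :=
  Polynomial.Bivariate.swap_monomial_monomial n 0 r

theorem eval_translation {R : Type*} [CommRing R] (c x a b : R) (n : ℕ) :
    (Polynomial.C (Polynomial.C x) + Polynomial.C (Polynomial.monomial n a)
      + Polynomial.monomial n (Polynomial.C b)).eval (Polynomial.C c * Polynomial.X)
      = Polynomial.C x + Polynomial.monomial n (a + c ^ n * b) := by
  rw [Polynomial.eval_add, Polynomial.eval_add, Polynomial.eval_C, Polynomial.eval_C,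
    Polynomial.eval_monomial, mul_pow, ← Polynomial.C_pow, ← mul_assoc, ← Polynomial.C_mul,
    Polynomial.C_mul_X_pow_eq_monomial, add_assoc, ← map_add, mul_comm b]

theorem annihilation₂_X (l : Fin 4 → ℂ) (φ σ : ℤ → ℂ) (n : ℕ+) :
    annihilation₂ l φ σ (MvPolynomial.X n) = Polynomial.C (Polynomial.C (MvPolynomial.X n))
      + Polynomial.C (Polynomial.monomial (n : ℕ)
          (MvPolynomial.C (φ (n : ℕ) * bracket l (n : ℕ))))
      + Polynomial.monomial (n : ℕ)
          (Polynomial.C (MvPolynomial.C (σ (n : ℕ) * bracket l (n : ℕ)))) := by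
  rw [annihilation₂, MvPolynomial.aeval_X, annihilation_X, Polynomial.C_add]

theorem annihilation₂_C (l : Fin 4 → ℂ) (φ σ : ℤ → ℂ) (c : ℂ) :
    annihilation₂ l φ σ (MvPolynomial.C c)
      = Polynomial.C (Polynomial.C (MvPolynomial.C c)) := by
  simp [annihilation₂, Polynomial.algebraMap_apply]

/-- Annihilation operators commute: on a generator the two shifts simply add. -/
theorem swap_annihilation₂ (l : Fin 4 → ℂ) (φ σ : ℤ → ℂ) (f : Fock) :
    Polynomial.Bivariate.swap (annihilation₂ l φ σ f) = annihilation₂ l σ φ f := by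
  have : ((Polynomial.Bivariate.swap (R := Fock)) : _ →+* Polynomial (Polynomial Fock)).comp
      (annihilation₂ l φ σ : Fock →+* Polynomial (Polynomial Fock))
      = (annihilation₂ l σ φ : Fock →+* Polynomial (Polynomial Fock)) := by
    refine MvPolynomial.ringHom_ext (fun c => ?_) fun n => ?_
    · change Polynomial.Bivariate.swap (annihilation₂ l φ σ _) = annihilation₂ l σ φ _
      rw [annihilation₂_C, annihilation₂_C, Polynomial.Bivariate.swap_C_C]
    · change Polynomial.Bivariate.swap (annihilation₂ l φ σ _) = annihilation₂ l σ φ _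
      rw [annihilation₂_X, annihilation₂_X, map_add, map_add, Polynomial.Bivariate.swap_C_C,
        swap_C_monomial, swap_monomial_C, add_right_comm]
  exact RingHom.congr_fun this f

theorem coeff_annihilation₂_comm (l : Fin 4 → ℂ) (φ σ : ℤ → ℂ) (f : Fock) (i j : ℕ) :
    ((annihilation₂ l φ σ f).coeff j).coeff i = ((annihilation₂ l σ φ f).coeff i).coeff j := by
  rw [← swap_annihilation₂, coeff_coeff_swap]

/-- The inner and outer variables stand for `1/x` and `1/x'`, so `x' = ρ x` means substituting `ρ⁻¹`
times the inner variable for the outer one. -/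
theorem eval_annihilation₂ (l : Fin 4 → ℂ) (φ σ : ℤ → ℂ) (ρ : ℂ) (f : Fock) :
    (annihilation₂ l φ σ f).eval (Polynomial.C (MvPolynomial.C ρ⁻¹) * Polynomial.X)
      = annihilation l (fun n => φ n + ρ ^ (-n) * σ n) f := by
  have : (Polynomial.evalRingHom (Polynomial.C (MvPolynomial.C ρ⁻¹) * Polynomial.X)).comp
      (annihilation₂ l φ σ : Fock →+* Polynomial (Polynomial Fock))
      = (annihilation l (fun n => φ n + ρ ^ (-n) * σ n) : Fock →+* Polynomial Fock) := by
    refine MvPolynomial.ringHom_ext (fun c => ?_) fun n => ?_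
    · rw [RingHom.comp_apply, RingHom.coe_coe, RingHom.coe_coe, Polynomial.coe_evalRingHom]
      rw [annihilation₂_C, annihilation_C, Polynomial.eval_C]
    · rw [RingHom.comp_apply, RingHom.coe_coe, RingHom.coe_coe, Polynomial.coe_evalRingHom]
      rw [annihilation₂_X, annihilation_X, eval_translation, ← map_pow, ← map_mul, ← map_add]
      congr 3
      rw [zpow_neg, zpow_natCast, inv_pow]
      ring
  exact RingHom.congr_fun this f

/-- The first sum runs down from `K - 1` and the second up from `K`; the bounds on `I` make them
reach `0` and `T`, beyond which `g` vanishes. -/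
theorem sum_int_window {M : Type*} [AddCommMonoid M] (g : ℤ → M) (K : ℤ) (I T : ℕ)
    (hg : ∀ b : ℤ, b < 0 ∨ (T : ℤ) < b → g b = 0) (h1 : K ≤ I) (h2 : T - K < I) :
    ∑ i ∈ Finset.range I, g (K - 1 - i) + ∑ i ∈ Finset.range I, g (K + i)
      = ∑ b ∈ Finset.range (T + 1), g b := by
  have e1 : ∑ i ∈ Finset.range I, g (K - 1 - i) = ∑ b ∈ Finset.Ico (K - I) K, g b := by
    refine Finset.sum_nbij' (fun i => K - 1 - i) (fun b => (K - 1 - b).toNat) ?_ ?_ ?_ ?_ ?_ <;>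
      intro i hi <;> simp only [Finset.mem_range, Finset.mem_Ico] at * <;> omega
  have e2 : ∑ i ∈ Finset.range I, g (K + i) = ∑ b ∈ Finset.Ico K (K + I), g b := by
    refine Finset.sum_nbij' (fun i => K + i) (fun b => (b - K).toNat) ?_ ?_ ?_ ?_ ?_ <;>
      intro i hi <;> simp only [Finset.mem_range, Finset.mem_Ico] at * <;> omega
  have e3 : ∑ b ∈ Finset.range (T + 1), g b = ∑ b ∈ Finset.Icc (0 : ℤ) T, g b := by
    refine Finset.sum_nbij' (fun i => (i : ℤ)) (fun b => b.toNat) ?_ ?_ ?_ ?_ ?_ <;>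
      intro i hi <;> simp only [Finset.mem_range, Finset.mem_Icc] at * <;> omega
  rw [e1, e2, e3, ← Finset.sum_union (by
    rw [Finset.disjoint_left]
    intro b hb hb'
    simp only [Finset.mem_Ico] at hb hb'
    omega)]
  refine (Finset.sum_subset ?_ ?_).symm
  · intro b hb
    simp only [Finset.mem_union, Finset.mem_Ico, Finset.mem_Icc] at *
    omega
  · intro b _ hb
    refine hg b ?_
    simp only [Finset.mem_Icc] at hb
    omega

/-- Creation operators of a product of currents with proportional arguments. -/
theorem creation_add (φ σ : ℤ → ℂ) (ρ : ℂ) (T : ℕ) :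
    creation (fun n => φ n + ρ ^ (-n) * σ n) T = ∑ b ∈ Finset.range (T + 1),
      ρ ^ b • (creation φ (T - b) * creation σ b) := by
  have hlog : creationLog (fun n => φ n + ρ ^ (-n) * σ n)
      = PowerSeries.rescale (MvPolynomial.C ρ) (creationLog σ) + creationLog φ := by
    ext1 n
    rw [map_add, PowerSeries.coeff_rescale, creationLog, creationLog, creationLog,
      coeff_tailSeries, coeff_tailSeries, coeff_tailSeries]
    split_ifs
    · simp
    · rw [neg_neg, zpow_natCast, map_add, map_mul, map_pow]
      ring
  rw [creation_eq, hlog, expSeries_add _ (constantCoeff_creationLog φ),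
    ← rescale_expSeries _ (constantCoeff_creationLog σ), PowerSeries.coeff_mul,
    Finset.Nat.sum_antidiagonal_eq_sum_range_succ_mk]
  · refine Finset.sum_congr rfl fun b _ => ?_
    rw [PowerSeries.coeff_rescale, creation_eq, creation_eq, MvPolynomial.smul_eq_C_mul, map_pow]
    ring
  · rw [← PowerSeries.coeff_zero_eq_constantCoeff_apply, PowerSeries.coeff_rescale,
      PowerSeries.coeff_zero_eq_constantCoeff_apply, constantCoeff_creationLog, mul_zero]

/-- The powers `ρ^(-(i+1))` and `ρ^i` are the coefficients of the two one-sided expansions of a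
simple pole. Together they form a bilateral series, a delta function, which places the second
current at `ρ` times the argument of the first. -/
theorem creationZ_add_window (φ σ : ℤ → ℂ) {ρ : ℂ} (hρ : ρ ≠ 0) (M K : ℤ) (I : ℕ) (h1 : K ≤ I)
    (h2 : M < I) :
    ∑ i ∈ Finset.range I, ρ ^ (-((i : ℤ) + 1)) • (creationZ φ (M + 1 + i) * creationZ σ (K - 1 - i))
      + ∑ i ∈ Finset.range I, ρ ^ (i : ℤ) • (creationZ φ (M - i) * creationZ σ (K + i))
      = ρ ^ (-K) • creationZ (fun n => φ n + ρ ^ (-n) * σ n) (M + K) := by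
  by_cases hT : 0 ≤ M + K
  · obtain ⟨T, hT⟩ := Int.eq_ofNat_of_zero_le hT
    rw [hT, creationZ_natCast, creation_add, Finset.smul_sum]
    have key := sum_int_window (fun b : ℤ => ρ ^ (b - K) • (creationZ φ (T - b) * creationZ σ b))
      K I T ?_ h1 (by omega)
    · refine Eq.trans ?_ (key.trans (Finset.sum_congr rfl fun b hb => ?_))
      · congr 1
        · refine Finset.sum_congr rfl fun i _ => ?_
          congr 2
          · ring
          · congr 1
            omega
        · refine Finset.sum_congr rfl fun i _ => ?_
          congr 2
          · ring
          · congr 1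
            omega
      · have hb := Finset.mem_range.1 hb
        rw [creationZ_natCast, ← Nat.cast_sub (by omega), creationZ_natCast, smul_smul,
          ← zpow_natCast, ← zpow_add₀ hρ, add_comm, sub_eq_add_neg]
    · rintro b (hb | hb)
      · rw [creationZ_of_neg σ hb, mul_zero, smul_zero]
      · rw [creationZ_of_neg φ (by omega), zero_mul, smul_zero]
  · rw [creationZ_of_neg _ (not_le.1 hT), smul_zero]
    have hz : ∀ a b : ℤ, a + b < 0 → creationZ φ a * creationZ σ b = 0 := by
      intro a b hab
      by_cases ha : a < 0
      · rw [creationZ_of_neg φ ha, zero_mul]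
      · rw [creationZ_of_neg σ (by omega), mul_zero]
    rw [Finset.sum_eq_zero, Finset.sum_eq_zero, add_zero]
    · intro i _
      rw [hz _ _ (by omega), smul_zero]
    · intro i _
      rw [hz _ _ (by omega), smul_zero]

theorem oscMode_eq_sum (l : Fin 4 → ℂ) (φ : ℤ → ℂ) (k : ℤ) (f : Fock) (B : ℕ)
    (hB : ∀ j, B ≤ j → (annihilation l φ f).coeff j = 0) :
    oscMode l φ k f = ∑ j ∈ Finset.range B, creationZ φ (k + j) * (annihilation l φ f).coeff j := by
  rw [oscMode_apply, creationShift_eq_sum φ k _ (B + (annihilation l φ f).natDegree + 1) (by omega)]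
  refine (Finset.sum_subset (Finset.range_mono (by omega)) fun j _ hj => ?_).symm
  rw [hB j (by simpa using hj), mul_zero]

/-- Product of modes in terms of the contraction. -/
theorem oscMode_oscMode (l : Fin 4 → ℂ) (φ σ : ℤ → ℂ) (m n : ℤ) (f : Fock) (B I : ℕ)
    (hB : ∀ i j, B ≤ i ∨ B ≤ j → ((annihilation₂ l φ σ f).coeff j).coeff i = 0)
    (hI : n + B ≤ I) :
    oscMode l φ m (oscMode l σ n f) = ∑ j ∈ Finset.range B, ∑ i' ∈ Finset.range B,
      (∑ i ∈ Finset.range I, contraction l φ σ i •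
        (creationZ φ (m + i + i') * creationZ σ (n + j - i)))
        * ((annihilation₂ l φ σ f).coeff j).coeff i' := by
  have hσ : ∀ j, B ≤ j → (annihilation l σ f).coeff j = 0 := by
    intro j hj
    rw [← (annihilation_eq_exp l φ ((annihilation l σ f).coeff j)).1, coeff_annihilation_coeff,
      hB 0 j (Or.inr hj)]
  rw [oscMode_eq_sum l σ n f B hσ, map_sum]
  refine Finset.sum_congr rfl fun j hj => ?_
  have hj := Finset.mem_range.1 hj
  rw [oscMode_creation_mul l φ σ m (n + j) _ I (by omega)]
  have h1 : ∀ k : ℤ, oscMode l φ k ((annihilation l σ f).coeff j) = ∑ i' ∈ Finset.range B,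
      creationZ φ (k + i') * ((annihilation₂ l φ σ f).coeff j).coeff i' := by
    intro k
    rw [oscMode_eq_sum l φ k _ B]
    · exact Finset.sum_congr rfl fun i' _ => by rw [coeff_annihilation_coeff]
    · intro i hi
      rw [coeff_annihilation_coeff, hB i j (Or.inl hi)]
  simp only [h1, Finset.sum_mul]
  rw [Finset.sum_comm]
  refine Finset.sum_congr rfl fun i _ => ?_
  rw [Finset.mul_sum, Finset.smul_sum]
  refine Finset.sum_congr rfl fun i' _ => ?_
  rw [smul_mul_assoc]
  congr 1
  ring

/-- The degree of a bivariate polynomial sees only the outer variable; the inner one is bounded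
through the swapped polynomial. -/
theorem exists_annihilation₂_bound (l : Fin 4 → ℂ) (φ σ : ℤ → ℂ) (f : Fock) :
    ∃ B : ℕ, ∀ i j, B ≤ i ∨ B ≤ j → ((annihilation₂ l φ σ f).coeff j).coeff i = 0 := by
  refine ⟨(annihilation₂ l φ σ f).natDegree + (annihilation₂ l σ φ f).natDegree + 1, ?_⟩
  rintro i j (h | h)
  · rw [coeff_annihilation₂_comm, Polynomial.coeff_eq_zero_of_natDegree_lt (p := annihilation₂ _ _ _ _)
      (by omega), Polynomial.coeff_zero]
  · rw [Polynomial.coeff_eq_zero_of_natDegree_lt (p := annihilation₂ _ _ _ _)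
      (by omega), Polynomial.coeff_zero]

/-- The merged current is expanded over the same bivariate coefficients as in `oscMode_oscMode`, so
that the exchange relation reduces to an identity of creation parts. -/
theorem oscMode_add (l : Fin 4 → ℂ) (φ σ : ℤ → ℂ) (ρ : ℂ) (N : ℤ) (f : Fock) (B : ℕ)
    (hB : ∀ i j, B ≤ i ∨ B ≤ j → ((annihilation₂ l φ σ f).coeff j).coeff i = 0) :
    oscMode l (fun n => φ n + ρ ^ (-n) * σ n) N f =
      ∑ j ∈ Finset.range B, ∑ i' ∈ Finset.range B, (ρ ^ (-(j : ℤ)) •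
        creationZ (fun n => φ n + ρ ^ (-n) * σ n) (N + i' + j))
        * ((annihilation₂ l φ σ f).coeff j).coeff i' := by
  set ψ : ℤ → ℂ := fun n => φ n + ρ ^ (-n) * σ n with hψ
  have hc : ∀ J, (annihilation l ψ f).coeff J = ∑ j ∈ Finset.range (J + 1),
      MvPolynomial.C ρ⁻¹ ^ j * ((annihilation₂ l φ σ f).coeff j).coeff (J - j) := by
    intro J
    rw [hψ, ← eval_annihilation₂, coeff_eval_mul_X]
  -- After the substitution the degree is the sum of two degrees below `B`.
  rw [oscMode_eq_sum l ψ N f (2 * B)]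
  · simp only [hc, Finset.mul_sum]
    rw [Finset.sum_sigma', Finset.sum_sigma']
    symm
    refine Finset.sum_of_injOn (fun x => ⟨x.1 + x.2, x.1⟩) ?_ ?_ ?_ ?_
    · rintro ⟨a, b⟩ _ ⟨c, d⟩ _ h
      simp only [Sigma.mk.injEq, heq_eq_eq] at h ⊢
      omega
    · rintro ⟨a, b⟩ h
      simp only [Finset.coe_sigma, Set.mem_sigma_iff, Finset.mem_coe, Finset.mem_range] at h ⊢
      omega
    · rintro ⟨J, j⟩ h h'
      simp only [Finset.mem_sigma, Finset.mem_range] at h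
      have : B ≤ J - j ∨ B ≤ j := by
        by_contra! hlt
        refine h' ⟨⟨j, J - j⟩, ?_, Sigma.ext (show j + (J - j) = J by omega) (heq_of_eq rfl)⟩
        simp only [Finset.coe_sigma, Set.mem_sigma_iff, Finset.mem_coe, Finset.mem_range]
        omega
      simp only [hB _ _ this, mul_zero]
    · rintro ⟨j, i⟩ h
      simp only [Nat.add_sub_cancel_left]
      rw [MvPolynomial.smul_eq_C_mul, zpow_neg, zpow_natCast, ← inv_pow, map_pow]
      push_cast
      rw [add_assoc, add_comm (i : ℤ)]
      ring
  · intro J hJ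
    rw [hc]
    refine Finset.sum_eq_zero fun j hj => ?_
    have := Finset.mem_range.1 hj
    rw [hB _ _ (by omega), mul_zero]

/-- The difference of the two expansions of a product of currents, when the contractions are the
expansions of one rational function with simple poles. -/
theorem oscMode_exchange {ι : Type*} (l : Fin 4 → ℂ) (φ σ : ℤ → ℂ) (κ : ℂ) (P : Finset ι)
    (R ρ : ι → ℂ) (hρ : ∀ w ∈ P, ρ w ≠ 0)
    (h1 : ∀ i : ℕ, κ * contraction l φ σ i = ∑ w ∈ P, R w * ρ w ^ (-((i : ℤ) + 1)))
    (h2 : ∀ i : ℕ, contraction l σ φ i = ∑ w ∈ P, R w * ρ w ^ (i : ℤ)) (m n : ℤ) (f : Fock) :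
    κ • oscMode l φ m (oscMode l σ (n - 1) f) + oscMode l σ n (oscMode l φ (m - 1) f)
      = ∑ w ∈ P, (R w * ρ w ^ (-n)) •
          oscMode l (fun k => φ k + ρ w ^ (-k) * σ k) (m + n - 1) f := by
  obtain ⟨B, hB⟩ := exists_annihilation₂_bound l φ σ f
  have hB' : ∀ i j, B ≤ i ∨ B ≤ j → ((annihilation₂ l σ φ f).coeff j).coeff i = 0 := by
    intro i j h
    rw [coeff_annihilation₂_comm, hB j i h.symm]
  obtain ⟨I, hI⟩ : ∃ I : ℕ, m + B ≤ I ∧ n + B ≤ I := ⟨(max (m + B) (n + B)).toNat, by omega, by omega⟩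
  rw [oscMode_oscMode l φ σ m (n - 1) f B I hB (by omega),
    oscMode_oscMode l σ φ n (m - 1) f B I hB' (by omega)]
  simp only [fun w => oscMode_add l φ σ (ρ w) (m + n - 1) f B hB]
  -- In the reversed product the two variables have exchanged roles; reordering the sum aligns its
  -- coefficients with those of the other product.
  rw [Finset.sum_comm (s := Finset.range B) (t := Finset.range B)
    (f := fun j i' => (∑ i ∈ Finset.range I, contraction l σ φ i •
        (creationZ σ (n + i + i') * creationZ φ (m - 1 + j - i)))
        * ((annihilation₂ l σ φ f).coeff j).coeff i')]
  simp only [Finset.smul_sum]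
  rw [Finset.sum_comm (s := P), ← Finset.sum_add_distrib]
  refine Finset.sum_congr rfl fun j hj => ?_
  rw [Finset.sum_comm (s := P), ← Finset.sum_add_distrib]
  refine Finset.sum_congr rfl fun i' hi' => ?_
  have hj := Finset.mem_range.1 hj
  have hi' := Finset.mem_range.1 hi'
  rw [coeff_annihilation₂_comm l σ φ, ← smul_mul_assoc, ← add_mul]
  have hpull : ∀ (g : ι → ℂ) (h : ι → Fock) (A : Fock),
      ∑ w ∈ P, g w • (h w * A) = (∑ w ∈ P, g w • h w) * A := by
    intro g h A
    rw [Finset.sum_mul]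
    exact Finset.sum_congr rfl fun w _ => (smul_mul_assoc _ _ _).symm
  rw [hpull]
  congr 1
  -- For each pole separately, the merged creation part is the sum of the two one-sided expansions.
  have hw : ∀ w ∈ P, (R w * ρ w ^ (-n)) • ρ w ^ (-(j : ℤ)) •
      creationZ (fun k => φ k + ρ w ^ (-k) * σ k) (m + n - 1 + i' + j)
      = R w • (∑ i ∈ Finset.range I, ρ w ^ (-((i : ℤ) + 1)) •
          (creationZ φ (m + i + i') * creationZ σ (n - 1 + j - i))
        + ∑ i ∈ Finset.range I, ρ w ^ (i : ℤ) •
          (creationZ σ (n + i + j) * creationZ φ (m - 1 + i' - i))) := by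
    intro w hw
    have := creationZ_add_window φ σ (hρ w hw) (m - 1 + i') (n + j) I (by omega) (by omega)
    rw [mul_smul, smul_smul (ρ w ^ (-n)), ← zpow_add₀ (hρ w hw),
      show -n + -(j : ℤ) = -(n + j) by ring,
      show m + n - 1 + (i' : ℤ) + j = m - 1 + i' + (n + j) by ring, ← this]
    congr 2
    · refine Finset.sum_congr rfl fun i _ => ?_
      congr 3 <;> ring
    · refine Finset.sum_congr rfl fun i _ => ?_
      rw [mul_comm (creationZ σ _)]
      congr 3
      ring
  rw [Finset.sum_congr rfl hw]
  simp only [smul_add, Finset.smul_sum, smul_smul]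
  rw [Finset.sum_add_distrib, Finset.sum_comm (s := P), Finset.sum_comm (s := P)]
  congr 1
  · refine Finset.sum_congr rfl fun i _ => ?_
    rw [h1, Finset.sum_smul]
  · refine Finset.sum_congr rfl fun i _ => ?_
    rw [h2, Finset.sum_smul]

end Osc

/-! ### Characters -/

section Characters

open Function (support)

/-- The weight of a box. -/
def boxWeight (v : Box) : Fin 3 → ℤ := fun i => (v i : ℤ)

/-- The character of a single weight. -/
def single (w : Fin 3 → ℤ) : Character := Pi.single w 1

theorem boxWeight_injective : Function.Injective boxWeight := fun v w h =>
  funext fun i => by simpa [boxWeight] using congrFun h i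

theorem single_apply (w u : Fin 3 → ℤ) : single w u = if u = w then 1 else 0 := by
  rw [single, Pi.single_apply]

theorem chSet_apply (B : Set Box) (w : Fin 3 → ℤ) :
    chSet B w = if ∃ v ∈ B, boxWeight v = w then 1 else 0 := by
  unfold chSet
  congr 1
  refine propext (exists_congr fun v => and_congr_right fun _ => ?_)
  rw [funext_iff]
  exact forall_congr' fun i => eq_comm

theorem chSet_boxWeight (B : Set Box) (v : Box) :
    chSet B (boxWeight v) = if v ∈ B then 1 else 0 := by
  rw [chSet_apply]
  congr 1
  refine propext ⟨?_, fun h => ⟨v, h, rfl⟩⟩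
  rintro ⟨w, hw, h⟩
  rwa [← boxWeight_injective h]

theorem chSet_of_neg (B : Set Box) {w : Fin 3 → ℤ} {i : Fin 3} (hi : w i < 0) :
    chSet B w = 0 := by
  rw [chSet_apply, if_neg]
  rintro ⟨v, _, rfl⟩
  simp [boxWeight] at hi
  omega

theorem exists_box {w : Fin 3 → ℤ} (hw : ∀ i, 0 ≤ w i) : ∃ v, boxWeight v = w :=
  ⟨fun i => (w i).toNat, funext fun i => Int.toNat_of_nonneg (hw i)⟩

/-- Two characters agree if they vanish at weights with a negative exponent and agree at boxes. -/
theorem ext_boxWeight {f g : Character} (h : ∀ v, f (boxWeight v) = g (boxWeight v))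
    (hn : ∀ w i, w i < 0 → f w = g w) : f = g := by
  funext w
  by_cases hw : ∀ i, 0 ≤ w i
  · obtain ⟨v, rfl⟩ := exists_box hw
    exact h v
  · push Not at hw
    obtain ⟨i, hi⟩ := hw
    exact hn w i hi

theorem single_boxWeight_of_neg (v : Box) {w : Fin 3 → ℤ} {i : Fin 3} (hi : w i < 0) :
    single (boxWeight v) w = 0 := by
  rw [single_apply, if_neg]
  rintro rfl
  simp [boxWeight] at hi
  omega

theorem single_boxWeight_boxWeight (v u : Box) :
    single (boxWeight v) (boxWeight u) = if u = v then 1 else 0 := by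
  rw [single_apply]
  congr 1
  exact propext ⟨fun h => boxWeight_injective h, fun h => h ▸ rfl⟩

theorem chSet_finset (s : Finset Box) : chSet (s : Set Box) = ∑ v ∈ s, single (boxWeight v) := by
  refine ext_boxWeight (fun v => ?_) fun w i hi => ?_
  · rw [chSet_boxWeight, Finset.sum_apply]
    simp [single_boxWeight_boxWeight]
  · rw [chSet_of_neg _ hi, Finset.sum_apply]
    exact (Finset.sum_eq_zero fun v _ => single_boxWeight_of_neg v hi).symm

theorem chSet_insert (s : Finset Box) {v : Box} (hv : v ∉ s) :
    chSet ((insert v s : Finset Box) : Set Box) = chSet (s : Set Box) + single (boxWeight v) := by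
  rw [chSet_finset, chSet_finset, Finset.sum_insert hv, add_comm]

theorem chSet_union {A B : Set Box} (h : Disjoint A B) : chSet (A ∪ B) = chSet A + chSet B := by
  refine ext_boxWeight (fun v => ?_) fun w i hi => ?_
  · rw [Pi.add_apply, chSet_boxWeight, chSet_boxWeight, chSet_boxWeight]
    by_cases hA : v ∈ A
    · have : v ∉ B := Set.disjoint_left.1 h hA
      simp [hA, this]
    · simp [hA]
  · rw [Pi.add_apply, chSet_of_neg _ hi, chSet_of_neg _ hi, chSet_of_neg _ hi, add_zero]

/-! Linearity and commutation rules. -/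

theorem shiftBy_add (u : Fin 3 → ℤ) (f g : Character) :
    shiftBy u (f + g) = shiftBy u f + shiftBy u g := rfl

theorem shiftBy_sub (u : Fin 3 → ℤ) (f g : Character) :
    shiftBy u (f - g) = shiftBy u f - shiftBy u g := rfl

theorem shiftBy_neg (u : Fin 3 → ℤ) (f : Character) : shiftBy u (-f) = -shiftBy u f := rfl

theorem shiftBy_shiftBy (u v : Fin 3 → ℤ) (f : Character) :
    shiftBy u (shiftBy v f) = shiftBy (u + v) f := by
  funext w
  simp only [shiftBy, sub_sub]

theorem shiftBy_zero (f : Character) : shiftBy 0 f = f := by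
  funext w
  simp [shiftBy]

theorem shiftBy_single (u w : Fin 3 → ℤ) : shiftBy u (single w) = single (u + w) := by
  funext z
  rw [shiftBy, single_apply, single_apply]
  congr 1
  rw [sub_eq_iff_eq_add']

theorem oneSub_add (u : Fin 3 → ℤ) (f g : Character) :
    oneSub u (f + g) = oneSub u f + oneSub u g := by
  simp only [oneSub, shiftBy_add]
  abel

theorem oneSub_neg (u : Fin 3 → ℤ) (f : Character) : oneSub u (-f) = -oneSub u f := by
  simp only [oneSub, shiftBy_neg]
  abel

theorem oneSub_sub (u : Fin 3 → ℤ) (f g : Character) :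
    oneSub u (f - g) = oneSub u f - oneSub u g := by
  simp only [oneSub, shiftBy_sub]
  abel

theorem oneSub_shiftBy (u v : Fin 3 → ℤ) (f : Character) :
    oneSub u (shiftBy v f) = shiftBy v (oneSub u f) := by
  simp only [oneSub, shiftBy_sub, shiftBy_shiftBy, add_comm]

theorem oneSub_comm (u v : Fin 3 → ℤ) (f : Character) :
    oneSub u (oneSub v f) = oneSub v (oneSub u f) := by
  rw [oneSub, ← oneSub_shiftBy, ← oneSub_sub, ← oneSub]

theorem mulP_add (f g : Character) : mulP (f + g) = mulP f + mulP g := by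
  simp only [mulP, oneSub_add]

theorem mulP_sub (f g : Character) : mulP (f - g) = mulP f - mulP g := by
  simp only [mulP, oneSub_sub]

theorem mulP_shiftBy (u : Fin 3 → ℤ) (f : Character) : mulP (shiftBy u f) = shiftBy u (mulP f) := by
  simp only [mulP, oneSub_shiftBy]

/-- This is `1 - q^(-u) = -q^(-u) (1 - q^u)`. -/
theorem oneSub_neg_weight (u : Fin 3 → ℤ) (f : Character) :
    oneSub (-u) f = -shiftBy (-u) (oneSub u f) := by
  rw [oneSub, oneSub, shiftBy_sub, shiftBy_shiftBy, neg_add_cancel, shiftBy_zero]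
  abel

theorem wta_eq : -wt 2 + -wt 1 + -wt 0 = wta := by
  funext i
  fin_cases i <;> simp [wt, wta]

/-- `P^∨ = - q_a P`. -/
theorem mulPdual_eq (f : Character) : mulPdual f = -shiftBy wta (mulP f) := by
  rw [mulPdual, mulP]
  simp only [oneSub_neg_weight, oneSub_neg, oneSub_shiftBy, shiftBy_neg, neg_neg, shiftBy_shiftBy]
  rw [wta_eq]

theorem dual_add (f g : Character) : dual (f + g) = dual f + dual g := rfl

theorem dual_sub (f g : Character) : dual (f - g) = dual f - dual g := rfl

theorem dual_dual (f : Character) : dual (dual f) = f := by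
  funext w
  simp [dual]

theorem dual_shiftBy (u : Fin 3 → ℤ) (f : Character) :
    dual (shiftBy u f) = shiftBy (-u) (dual f) := by
  funext w
  simp only [dual, shiftBy]
  congr 1
  abel

theorem dual_oneSub (u : Fin 3 → ℤ) (f : Character) :
    dual (oneSub u f) = oneSub (-u) (dual f) := by
  rw [oneSub, dual_sub, dual_shiftBy, oneSub]

theorem dual_mulP (f : Character) : dual (mulP f) = mulPdual (dual f) := by
  simp only [mulP, mulPdual, dual_oneSub]

theorem dual_single (w : Fin 3 → ℤ) : dual (single w) = single (-w) := by
  funext u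
  rw [dual, single_apply, single_apply]
  congr 1
  rw [neg_eq_iff_eq_neg]

theorem mulK_insert (s : Finset Box) {v : Box} (hv : v ∉ s) (f : Character) :
    mulK (insert v s) f = mulK s f + shiftBy (boxWeight v) f := by
  rw [mulK, Finset.sum_insert hv, add_comm]
  rfl

theorem mulK_single (s : Finset Box) (u : Fin 3 → ℤ) :
    mulK s (single u) = shiftBy u (chSet (s : Set Box)) := by
  rw [chSet_finset]
  funext w
  simp only [mulK, Finset.sum_apply, shiftBy]
  refine Finset.sum_congr rfl fun v _ => ?_
  rw [single_apply, single_apply]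
  congr 1
  refine propext ⟨fun h => ?_, fun h => ?_⟩
  · rw [← h]
    funext i
    simp [boxWeight]
  · rw [← sub_eq_zero] at h ⊢
    rw [← h]
    funext i
    simp [boxWeight]
    ring

theorem mulK_add (s : Finset Box) (f g : Character) : mulK s (f + g) = mulK s f + mulK s g := by
  simp only [mulK, shiftBy_add, Finset.sum_add_distrib]

theorem mulK_neg (s : Finset Box) (f : Character) : mulK s (-f) = -mulK s f := by
  simp only [mulK, shiftBy_neg, Finset.sum_neg_distrib]

theorem shiftBy_sum {ι : Type*} (u : Fin 3 → ℤ) (s : Finset ι) (f : ι → Character) :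
    shiftBy u (∑ i ∈ s, f i) = ∑ i ∈ s, shiftBy u (f i) := by
  funext w
  simp [shiftBy, Finset.sum_apply]

theorem mulK_shiftBy (s : Finset Box) (u : Fin 3 → ℤ) (f : Character) :
    mulK s (shiftBy u f) = shiftBy u (mulK s f) := by
  simp only [mulK, shiftBy_sum, shiftBy_shiftBy, add_comm]

theorem mulK_mulP (s : Finset Box) (f : Character) : mulK s (mulP f) = mulP (mulK s f) := by
  have h : ∀ u g, mulK s (oneSub u g) = oneSub u (mulK s g) := by
    intro u g
    rw [oneSub, oneSub, sub_eq_add_neg, mulK_add, mulK_neg, mulK_shiftBy, ← sub_eq_add_neg]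
  simp only [mulP, h]

/-- The dual of `yChar`. -/
theorem dual_yChar (Y : Fin 3 → YoungDiagram) (π : Finset Box) :
    dual (yChar Y π)
      = single 0 + shiftBy wta (mulP (dual (chSet (π : Set Box)) + dual (chSet (bd Y)))) := by
  have h0 : yChar Y π = single 0 - mulP (chSet (π : Set Box) + chSet (bd Y)) := rfl
  rw [h0, dual_sub, dual_single, neg_zero, dual_mulP, mulPdual_eq, dual_add, sub_neg_eq_add]

theorem yChar_insert (Y : Fin 3 → YoungDiagram) (π : Finset Box) {v : Box} (hv : v ∉ π) :
    yChar Y (insert v π) = yChar Y π - mulP (single (boxWeight v)) := by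
  rw [yChar, yChar, chSet_insert π hv, add_right_comm, mulP_add]
  abel

/-- The change of the character of the partition function when a box is added. -/
theorem vChar_insert (Y : Fin 3 → YoungDiagram) (π : Finset Box) {v : Box} (hv : v ∉ π) :
    vChar Y (insert v π) - vChar Y π =
      shiftBy (boxWeight v - wta) (dual (yChar Y π))
      - shiftBy (boxWeight v) (dual (yChar Y (insert v π)))
      + (dual (shiftBy (boxWeight v) (mulP (dual (chSet (π : Set Box)))))
        - shiftBy (boxWeight v) (mulP (dual (chSet (π : Set Box))))) := by
  -- The new term `P_abar^∨ v^∨ K` is the dual of `X = P_abar v K^∨`, whereas the two `Y`-terms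
  -- produce `X` itself; the last bracket makes up for the difference.
  have hX : dual (shiftBy (boxWeight v) (mulP (dual (chSet (π : Set Box)))))
      = mulK π (mulPdual (dual (single (boxWeight v)))) := by
    rw [dual_shiftBy, dual_mulP, dual_dual, dual_single, mulPdual_eq, mulPdual_eq, mulK_neg,
      mulK_shiftBy, mulK_mulP, mulK_single, shiftBy_neg, mulP_shiftBy, shiftBy_shiftBy,
      shiftBy_shiftBy, add_comm]
  rw [hX, vChar, vChar, chSet_insert π hv, mulK_insert π hv, mulK_insert π hv, dual_add]
  have hK : mulPdual (dual (chSet (π : Set Box)) + dual (single (boxWeight v)))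
      = mulPdual (dual (chSet (π : Set Box))) + mulPdual (dual (single (boxWeight v))) := by
    simp only [mulPdual, oneSub_add]
  rw [hK, mulK_add, oneSub_add, yChar_insert Y π hv, dual_sub, dual_yChar, dual_mulP]
  set v' := boxWeight v
  set K := dual (chSet (π : Set Box))
  set B := dual (chSet (bd Y))
  simp only [shiftBy_add, shiftBy_sub, mulP_add, shiftBy_shiftBy, sub_add_cancel, mulPdual_eq K,
    shiftBy_neg]
  have h1 : oneSub (-wta) (single v') = single v' - single (v' - wta) := by
    rw [oneSub, shiftBy_single]
    congr 2
    abel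
  have h2 : shiftBy v' (oneSub wta (mulP B)) = shiftBy v' (mulP B) - shiftBy (v' + wta) (mulP B) := by
    rw [oneSub, shiftBy_sub, shiftBy_shiftBy]
  rw [h1, h2, shiftBy_single, shiftBy_single, add_zero, add_zero]
  abel

/-! Functionals on finitely supported characters. -/

theorem finite_support_shiftBy {f : Character} (hf : (support f).Finite) (u : Fin 3 → ℤ) :
    (support (shiftBy u f)).Finite :=
  hf.preimage (sub_left_injective.injOn)

theorem finite_support_sub {f g : Character} (hf : (support f).Finite) (hg : (support g).Finite) :
    (support (f - g)).Finite := (hf.union hg).subset (Function.support_sub f g)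

theorem finite_support_add {f g : Character} (hf : (support f).Finite) (hg : (support g).Finite) :
    (support (f + g)).Finite := (hf.union hg).subset (Function.support_add f g)

theorem finite_support_neg {f : Character} (hf : (support f).Finite) :
    (support (-f)).Finite := by rwa [Function.support_neg]

theorem finite_support_oneSub {f : Character} (hf : (support f).Finite) (u : Fin 3 → ℤ) :
    (support (oneSub u f)).Finite := finite_support_sub hf (finite_support_shiftBy hf u)

theorem finite_support_mulP {f : Character} (hf : (support f).Finite) :
    (support (mulP f)).Finite :=
  finite_support_oneSub (finite_support_oneSub (finite_support_oneSub hf _) _) _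

theorem finite_support_dual {f : Character} (hf : (support f).Finite) :
    (support (dual f)).Finite :=
  hf.preimage (neg_injective.injOn)

theorem finite_support_single (w : Fin 3 → ℤ) : (support (single w)).Finite := by
  refine (Set.finite_singleton w).subset fun u hu => ?_
  rw [Function.mem_support, single_apply] at hu
  by_contra h
  exact hu (if_neg h)

theorem finite_support_sum {ι : Type*} (s : Finset ι) (f : ι → Character)
    (hf : ∀ i ∈ s, (support (f i)).Finite) : (support (∑ i ∈ s, f i)).Finite := by
  induction s using Finset.induction_on with
  | empty => simp
  | insert i s hi ih =>
    rw [Finset.sum_insert hi]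
    exact finite_support_add (hf i (Finset.mem_insert_self _ _))
      (ih fun j hj => hf j (Finset.mem_insert_of_mem hj))

/-- The additive functional with values `h` on weights. -/
def pairing {R : Type*} [CommRing R] (h : (Fin 3 → ℤ) → R) (f : Character) : R :=
  ∑ᶠ w, (f w : R) * h w

theorem pairing_eq_sum {R : Type*} [CommRing R] (h : (Fin 3 → ℤ) → R) {f : Character}
    {s : Finset (Fin 3 → ℤ)} (hs : support f ⊆ s) : pairing h f = ∑ w ∈ s, (f w : R) * h w :=
  finsum_eq_sum_of_support_subset _ fun w hw => hs fun h0 => hw (by simp [h0])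

theorem pairing_add {R : Type*} [CommRing R] (h : (Fin 3 → ℤ) → R) {f g : Character}
    (hf : (support f).Finite) (hg : (support g).Finite) :
    pairing h (f + g) = pairing h f + pairing h g := by
  have h1 := hf.union hg
  rw [pairing_eq_sum (s := h1.toFinset) h (by simpa using Function.support_add f g),
    pairing_eq_sum (s := h1.toFinset) (f := f) h (by simp),
    pairing_eq_sum (s := h1.toFinset) (f := g) h (by simp), ← Finset.sum_add_distrib]
  exact Finset.sum_congr rfl fun w _ => by rw [Pi.add_apply]; push_cast; ring

theorem pairing_neg {R : Type*} [CommRing R] (h : (Fin 3 → ℤ) → R) (f : Character) :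
    pairing h (-f) = -pairing h f := by
  rw [pairing, pairing, ← finsum_neg_distrib]
  exact finsum_congr fun w => by rw [Pi.neg_apply]; push_cast; ring

theorem pairing_sub {R : Type*} [CommRing R] (h : (Fin 3 → ℤ) → R) {f g : Character}
    (hf : (support f).Finite) (hg : (support g).Finite) :
    pairing h (f - g) = pairing h f - pairing h g := by
  rw [sub_eq_add_neg, pairing_add h hf (finite_support_neg hg), pairing_neg, sub_eq_add_neg]

theorem pairing_single {R : Type*} [CommRing R] (h : (Fin 3 → ℤ) → R) (w : Fin 3 → ℤ) :
    pairing h (single w) = h w := by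
  rw [pairing, finsum_eq_single _ w]
  · simp [single_apply]
  · intro u hu
    simp [single_apply, hu]

theorem pairing_zero {R : Type*} [CommRing R] (h : (Fin 3 → ℤ) → R) : pairing h 0 = 0 := by
  simp [pairing]

theorem pairing_sum {R ι : Type*} [CommRing R] (h : (Fin 3 → ℤ) → R) (s : Finset ι)
    (f : ι → Character) (hf : ∀ i ∈ s, (support (f i)).Finite) :
    pairing h (∑ i ∈ s, f i) = ∑ i ∈ s, pairing h (f i) := by
  induction s using Finset.induction_on with
  | empty => simp [pairing_zero]
  | insert i s hi ih =>
    have hs : ∀ j ∈ s, (support (f j)).Finite := fun j hj => hf j (Finset.mem_insert_of_mem hj)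
    rw [Finset.sum_insert hi, Finset.sum_insert hi, pairing_add h (hf i (Finset.mem_insert_self _ _))
      (finite_support_sum s f hs), ih hs]

theorem pairing_shiftBy {R : Type*} [CommRing R] (h : (Fin 3 → ℤ) → R) (u : Fin 3 → ℤ)
    (f : Character) : pairing h (shiftBy u f) = pairing (fun w => h (w + u)) f := by
  rw [pairing, pairing, ← finsum_comp_equiv (Equiv.addRight u)]
  exact finsum_congr fun w => by simp [shiftBy]

theorem pairing_oneSub {R : Type*} [CommRing R] {h : (Fin 3 → ℤ) → R}
    (hh : ∀ u v, h (u + v) = h u * h v) (u : Fin 3 → ℤ) {f : Character}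
    (hf : (support f).Finite) : pairing h (oneSub u f) = (1 - h u) * pairing h f := by
  rw [oneSub, pairing_sub h hf (finite_support_shiftBy hf u), pairing_shiftBy, sub_mul, one_mul]
  congr 1
  rw [pairing, pairing, mul_finsum']
  · exact finsum_congr fun w => by rw [hh]; ring
  · exact hf.subset fun w hw h0 => hw (by simp [h0])

/-- The multiplicative functional with values `h` on weights. -/
def mulPairing (h : (Fin 3 → ℤ) → ℂ) (f : Character) : ℂ := ∏ᶠ w, h w ^ f w

theorem mulPairing_eq_prod (h : (Fin 3 → ℤ) → ℂ) {f : Character}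
    {s : Finset (Fin 3 → ℤ)} (hs : support f ⊆ s) : mulPairing h f = ∏ w ∈ s, h w ^ f w :=
  finprod_eq_prod_of_mulSupport_subset _ fun w hw => hs fun h0 => hw (by simp [h0])

theorem mulPairing_add {h : (Fin 3 → ℤ) → ℂ} (hh : ∀ w, h w ≠ 0) {f g : Character}
    (hf : (support f).Finite) (hg : (support g).Finite) :
    mulPairing h (f + g) = mulPairing h f * mulPairing h g := by
  have h1 := hf.union hg
  rw [mulPairing_eq_prod (s := h1.toFinset) h (by simpa using Function.support_add f g),
    mulPairing_eq_prod (s := h1.toFinset) (f := f) h (by simp),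
    mulPairing_eq_prod (s := h1.toFinset) (f := g) h (by simp), ← Finset.prod_mul_distrib]
  exact Finset.prod_congr rfl fun w _ => zpow_add₀ (hh w) _ _

theorem mulPairing_neg (h : (Fin 3 → ℤ) → ℂ) (f : Character) :
    mulPairing h (-f) = (mulPairing h f)⁻¹ := by
  rw [mulPairing, mulPairing, ← finprod_inv_distrib]
  exact finprod_congr fun w => by rw [Pi.neg_apply, zpow_neg]

theorem mulPairing_sub {h : (Fin 3 → ℤ) → ℂ} (hh : ∀ w, h w ≠ 0) {f g : Character}
    (hf : (support f).Finite) (hg : (support g).Finite) :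
    mulPairing h (f - g) = mulPairing h f / mulPairing h g := by
  rw [sub_eq_add_neg, mulPairing_add hh hf (finite_support_neg hg), mulPairing_neg, div_eq_mul_inv]

theorem mulPairing_ne_zero {h : (Fin 3 → ℤ) → ℂ} (hh : ∀ w, h w ≠ 0) (f : Character) :
    mulPairing h f ≠ 0 :=
  finprod_induction (p := fun z => z ≠ 0) one_ne_zero (fun _ _ => mul_ne_zero)
    fun w => zpow_ne_zero _ (hh w)

theorem mulPairing_shiftBy (h : (Fin 3 → ℤ) → ℂ) (u : Fin 3 → ℤ)
    (f : Character) : mulPairing h (shiftBy u f) = mulPairing (fun w => h (w + u)) f := by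
  rw [mulPairing, mulPairing, ← finprod_comp_equiv (Equiv.addRight u)]
  exact finprod_congr fun w => by simp [shiftBy]

theorem mulPairing_dual (h : (Fin 3 → ℤ) → ℂ) (f : Character) :
    mulPairing h (dual f) = mulPairing (fun w => h (-w)) f := by
  rw [mulPairing, mulPairing, ← finprod_comp_equiv (Equiv.neg (Fin 3 → ℤ))]
  exact finprod_congr fun w => by simp [dual]

theorem mulPairing_single (h : (Fin 3 → ℤ) → ℂ) (w : Fin 3 → ℤ) :
    mulPairing h (single w) = h w := by
  rw [mulPairing, finprod_eq_single _ w]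
  · simp [single_apply]
  · intro u hu
    simp [single_apply, hu]

end Characters

/-! ### Evaluation of weights, reflection of the index, finiteness and global invariants of `yChar`.
-/

section Parameters

open Function (support)

variable (l : Fin 4 → ℂ) (a : Fin 4)

theorem q_ne_zero (i : Fin 4) : q l i ≠ 0 := Complex.exp_ne_zero _

theorem mono_add (u v : Fin 3 → ℤ) : mono l a (u + v) = mono l a u * mono l a v := by
  rw [mono, mono, mono, ← Finset.prod_mul_distrib]
  exact Finset.prod_congr rfl fun i _ => zpow_add₀ (q_ne_zero l _) _ _

theorem mono_ne_zero (u : Fin 3 → ℤ) : mono l a u ≠ 0 :=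
  Finset.prod_ne_zero_iff.2 fun _ _ => zpow_ne_zero _ (q_ne_zero l _)

theorem mono_zero : mono l a 0 = 1 := by simp [mono]

theorem mono_neg (u : Fin 3 → ℤ) : mono l a (-u) = (mono l a u)⁻¹ := by
  refine eq_inv_of_mul_eq_one_left ?_
  rw [← mono_add, neg_add_cancel, mono_zero]

theorem mono_sub (u v : Fin 3 → ℤ) : mono l a (u - v) = mono l a u / mono l a v := by
  rw [sub_eq_add_neg, mono_add, mono_neg, div_eq_mul_inv]

theorem mono_zsmul (n : ℤ) (u : Fin 3 → ℤ) : mono l a (n • u) = mono l a u ^ n := by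
  rw [mono, mono, ← Finset.prod_zpow]
  exact Finset.prod_congr rfl fun i _ => by rw [Pi.smul_apply, smul_eq_mul, mul_comm, zpow_mul]

theorem mono_wt (i : Fin 3) : mono l a (wt i) = q l (a.succAbove i) := by
  rw [mono, Finset.prod_eq_single i]
  · simp [wt]
  · intro j _ hj
    simp [wt, hj]
  · simp

variable {l a}

theorem mono_wta (hprod : ∏ i, q l i = 1) : mono l a wta = q l a := by
  rw [Fin.prod_univ_succAbove _ a] at hprod
  simp only [mono, wta, zpow_neg, zpow_one, Finset.prod_inv_distrib]
  exact (eq_inv_of_mul_eq_one_left hprod).symm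

/-- With exponent `0` at `a` a relation among three parameters becomes one among four; its exponents
are all equal, hence all `0`. -/
theorem mono_eq_one (hgen : ∀ n : Fin 4 → ℤ, ∏ i, q l i ^ n i = 1 → ∀ i j, n i = n j)
    {w : Fin 3 → ℤ} (hw : mono l a w = 1) : w = 0 := by
  have h := hgen (Fin.insertNth a 0 w) (by
    rw [Fin.prod_univ_succAbove _ a]
    simpa [mono] using hw)
  funext i
  simpa using h (a.succAbove i) a

theorem mono_injective (hnd : ∀ w, mono l a w = 1 → w = 0) : Function.Injective (mono l a) := by
  intro u v h
  rw [← sub_eq_zero]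
  refine hnd _ ?_
  rw [mono_sub, h, div_self (mono_ne_zero l a v)]

variable (l a)

/-- The index with the factor of the trivial weight left out. -/
def regIndex (f : Character) : ℂ :=
  mulPairing (fun w => if w = 0 then 1 else 1 - (mono l a w)⁻¹) f

/-- The product of the negatives of the weights of a character. -/
def signedProd (f : Character) : ℂ := mulPairing (fun w => -mono l a w) f

variable {l a}

theorem regIndex_factor_ne_zero (hnd : ∀ w, mono l a w = 1 → w = 0) (w : Fin 3 → ℤ) :
    (if w = 0 then 1 else 1 - (mono l a w)⁻¹) ≠ 0 := by
  split_ifs with h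
  · exact one_ne_zero
  · intro h0
    exact h (hnd w (inv_eq_one.1 (sub_eq_zero.1 h0).symm))

/-- The factor of the trivial weight is `0`, which spoils multiplicativity of the index. All factors
of `regIndex` are nonzero, so it turns sums of characters into products. -/
theorem index_eq_regIndex {f : Character} (hf : f 0 = 0) : index l a f = regIndex l a f := by
  refine finprod_congr fun w => ?_
  beta_reduce
  by_cases h : w = 0
  · rw [if_pos h, h, hf, zpow_zero, zpow_zero]
  · rw [if_neg h]

theorem neg_mono_ne_zero (w : Fin 3 → ℤ) : -mono l a w ≠ 0 := neg_ne_zero.2 (mono_ne_zero l a w)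

theorem signedProd_shiftBy {f : Character} (hf : (support f).Finite) (u : Fin 3 → ℤ) :
    signedProd l a (shiftBy u f) = mono l a u ^ pairing (1 : (Fin 3 → ℤ) → ℤ) f * signedProd l a f := by
  rw [signedProd, mulPairing_shiftBy, signedProd, mulPairing_eq_prod _ (s := hf.toFinset) (by simp),
    mulPairing_eq_prod _ (s := hf.toFinset) (by simp),
    pairing_eq_sum _ (s := hf.toFinset) (by simp)]
  have : mono l a u ^ (∑ w ∈ hf.toFinset, Int.cast (f w) * (1 : (Fin 3 → ℤ) → ℤ) w)
      = ∏ w ∈ hf.toFinset, mono l a u ^ f w := by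
    induction hf.toFinset using Finset.induction_on with
    | empty => simp
    | insert i s hi ih =>
      rw [Finset.sum_insert hi, Finset.prod_insert hi, zpow_add₀ (mono_ne_zero l a u), ih]
      simp
  rw [this, ← Finset.prod_mul_distrib]
  refine Finset.prod_congr rfl fun w _ => ?_
  rw [← mul_zpow, mono_add]
  congr 1
  ring

theorem pairing_one_oneSub {f : Character} (hf : (support f).Finite) (u : Fin 3 → ℤ) :
    pairing (1 : (Fin 3 → ℤ) → ℤ) (oneSub u f) = 0 := by
  rw [pairing_oneSub (fun _ _ => by simp) u hf]
  simp

/-- One factor `1 - q^v` makes the total multiplicity zero; then a shift by `u` leaves the product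
unchanged, and the second factor gives a quotient of equal numbers. -/
theorem signedProd_oneSub_oneSub {f : Character} (hf : (support f).Finite) (u v : Fin 3 → ℤ) :
    signedProd l a (oneSub u (oneSub v f)) = 1 := by
  have h1 := finite_support_oneSub hf v
  rw [oneSub, signedProd, mulPairing_sub neg_mono_ne_zero h1 (finite_support_shiftBy h1 u),
    ← signedProd, ← signedProd, signedProd_shiftBy h1, pairing_one_oneSub hf, zpow_zero, one_mul,
    div_self]
  exact mulPairing_ne_zero neg_mono_ne_zero _

theorem signedProd_mulP {f : Character} (hf : (support f).Finite) :
    signedProd l a (mulP f) = 1 :=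
  signedProd_oneSub_oneSub (finite_support_oneSub hf _) _ _

/-- Weight by weight this is `(1 - w) / (1 - w⁻¹) = -w`. The trivial weight contributes nothing on
the left but `(-1) ^ f 0` to `signedProd`, which the prefactor removes. -/
theorem regIndex_dual_sub_self (hnd : ∀ w, mono l a w = 1 → w = 0) {f : Character}
    (hf : (support f).Finite) :
    regIndex l a (dual f - f) = (-1) ^ f 0 * signedProd l a f := by
  have hne := regIndex_factor_ne_zero hnd
  rw [regIndex, mulPairing_sub hne (finite_support_dual hf) hf, mulPairing_dual]
  have hs : support f ⊆ (insert 0 hf.toFinset : Finset (Fin 3 → ℤ)) := by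
    intro w hw
    simp only [Finset.coe_insert, Set.Finite.coe_toFinset]
    exact Or.inr hw
  rw [signedProd, mulPairing_eq_prod _ hs, mulPairing_eq_prod _ hs, mulPairing_eq_prod _ hs,
    ← Finset.mul_prod_erase _ _ (Finset.mem_insert_self 0 _),
    ← Finset.mul_prod_erase _ _ (Finset.mem_insert_self 0 _),
    ← Finset.mul_prod_erase _ _ (Finset.mem_insert_self 0 _)]
  simp only [neg_zero, if_true, one_zpow, one_mul, mono_zero]
  rw [← mul_assoc, ← mul_zpow, neg_mul_neg, one_mul, one_zpow, one_mul, ← Finset.prod_div_distrib]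
  refine Finset.prod_congr rfl fun w hw => ?_
  have hw : w ≠ 0 := Finset.ne_of_mem_erase hw
  rw [← div_zpow, if_neg hw, if_neg (neg_ne_zero.2 hw), mono_neg, inv_inv]
  congr 1
  have h0 := mono_ne_zero l a w
  have h1 := hne w
  rw [if_neg hw] at h1
  rw [div_eq_iff h1]
  field_simp
  ring

/-! The character `yChar`. -/

/-- The character of the feet of the `i`-th leg. -/
def footChar (Y : Fin 3 → YoungDiagram) (i : Fin 3) : Character :=
  ∑ p ∈ (Y i).cells, single (boxWeight (foot i p))

/-- The correction for the boxes which lie in several legs. -/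
def overlapChar (Y : Fin 3 → YoungDiagram) : Character :=
  ∑ i, ∑ v ∈ (finite_inter Y i).toFinset, single (boxWeight v)
    - ∑ v ∈ (finite_triple Y).toFinset, single (boxWeight v)

theorem fin3_ne (i : Fin 3) : i + 1 ≠ i ∧ i + 2 ≠ i ∧ i + 2 ≠ i + 1 := by
  fin_cases i <;> decide

theorem fin3_cases (i j : Fin 3) : j = i ∨ j = i + 1 ∨ j = i + 2 := by
  fin_cases i <;> fin_cases j <;> decide

theorem eq_foot_iff (i : Fin 3) (v : Box) (p : ℕ × ℕ) :
    v = foot i p ↔ v i = 0 ∧ (v (i + 1), v (i + 2)) = p := by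
  obtain ⟨h1, h2, h3⟩ := fin3_ne i
  constructor
  · rintro rfl
    simp [foot, h1, h2, h3]
  · rintro ⟨h0, rfl⟩
    funext j
    rcases fin3_cases i j with rfl | rfl | rfl
    · simp [foot, h0]
    · simp [foot, h1]
    · simp [foot, h2, h3]

/-- A leg is a union of half-lines in direction `i`, and each telescopes to its first box. -/
theorem oneSub_wt_leg (Y : Fin 3 → YoungDiagram) (i : Fin 3) :
    oneSub (wt i) (chSet (leg Y i)) = footChar Y i := by
  obtain ⟨h1, h2, h3⟩ := fin3_ne i
  refine ext_boxWeight (fun v => ?_) fun w j hj => ?_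
  · rw [oneSub, Pi.sub_apply, shiftBy, chSet_boxWeight, footChar, Finset.sum_apply]
    simp only [single_boxWeight_boxWeight, eq_foot_iff]
    by_cases h0 : v i = 0
    · rw [chSet_of_neg (i := i) _ (by simp [boxWeight, wt, h0]), sub_zero]
      simp [h0, leg]
      congr
    · have : boxWeight v - wt i = boxWeight (Function.update v i (v i - 1)) := by
        funext j
        by_cases hj : j = i
        · subst hj
          simp only [boxWeight, wt, Pi.sub_apply, Pi.single_eq_same, Function.update_self]
          omega
        · simp [boxWeight, wt, hj]
      rw [this, chSet_boxWeight]
      simp [leg, h0, h1, h2]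
      rw [sub_eq_zero]
      congr
  · have hj' : (w - wt i) j < 0 := by
      have : 0 ≤ wt i j := by
        rw [wt, Pi.single_apply]
        split_ifs <;> norm_num
      rw [Pi.sub_apply]
      omega
    rw [oneSub, Pi.sub_apply, shiftBy, chSet_of_neg _ hj, chSet_of_neg _ hj', footChar,
      Finset.sum_apply]
    exact (Finset.sum_eq_zero fun p _ => single_boxWeight_of_neg _ hj).symm

/-- Inclusion–exclusion for the three legs; the overlaps are finite. -/
theorem chSet_bd (Y : Fin 3 → YoungDiagram) :
    chSet (bd Y) = ∑ i, chSet (leg Y i) - overlapChar Y := by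
  rw [overlapChar]
  simp only [← chSet_finset, Set.Finite.coe_toFinset]
  refine ext_boxWeight (fun v => ?_) fun w j hj => ?_
  · simp only [Fin.sum_univ_three, Pi.sub_apply, Pi.add_apply, chSet_boxWeight, bd,
      Set.mem_iUnion, Set.mem_iInter, Fin.exists_fin_succ, Fin.forall_fin_succ, Set.mem_inter_iff]
    by_cases h0 : v ∈ leg Y 0 <;> by_cases h1 : v ∈ leg Y 1 <;> by_cases h2 : v ∈ leg Y 2 <;>
      simp [h0, h1, h2]
  · simp only [Pi.sub_apply, Finset.sum_apply, chSet_of_neg _ hj]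
    simp

theorem mulP_leg (Y : Fin 3 → YoungDiagram) (i : Fin 3) :
    mulP (chSet (leg Y i)) = oneSub (wt (i + 1)) (oneSub (wt (i + 2)) (footChar Y i)) := by
  rw [← oneSub_wt_leg, mulP]
  fin_cases i
  · change _ = oneSub (wt 1) (oneSub (wt 2) (oneSub (wt 0) _))
    rw [oneSub_comm (wt 0) (wt 1), oneSub_comm (wt 0) (wt 2)]
  · change _ = oneSub (wt 2) (oneSub (wt 0) (oneSub (wt 1) _))
    rw [oneSub_comm (wt 1) (wt 2), oneSub_comm (wt 0) (wt 2)]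
  · rfl

theorem finite_support_footChar (Y : Fin 3 → YoungDiagram) (i : Fin 3) :
    (support (footChar Y i)).Finite :=
  finite_support_sum _ _ fun _ _ => finite_support_single _

theorem finite_support_overlapChar (Y : Fin 3 → YoungDiagram) :
    (support (overlapChar Y)).Finite :=
  finite_support_sub (finite_support_sum _ _ fun _ _ => finite_support_sum _ _ fun _ _ =>
    finite_support_single _) (finite_support_sum _ _ fun _ _ => finite_support_single _)

theorem finite_support_chSet (s : Finset Box) : (support (chSet (s : Set Box))).Finite := by
  rw [chSet_finset]
  exact finite_support_sum _ _ fun _ _ => finite_support_single _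

/-- The infinite vacuum is gone: only finite characters remain, and every one except the trivial
weight carries at least two factors `1 - q^u`. Finiteness, total multiplicity and signed product are
all read off from this form. -/
theorem yChar_eq (Y : Fin 3 → YoungDiagram) (π : Finset Box) :
    yChar Y π = single 0 - ∑ i, oneSub (wt (i + 1)) (oneSub (wt (i + 2)) (footChar Y i))
      + mulP (overlapChar Y - chSet (π : Set Box)) := by
  have h : ∀ f : Fin 3 → Character, mulP (∑ i, f i) = ∑ i, mulP (f i) := by
    intro f
    simp only [Fin.sum_univ_three, mulP_add]
  change single 0 - _ = _
  simp only [← mulP_leg]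
  rw [mulP_add, chSet_bd, mulP_sub, mulP_sub, h]
  abel

theorem finite_support_yChar (Y : Fin 3 → YoungDiagram) (π : Finset Box) :
    (support (yChar Y π)).Finite := by
  rw [yChar_eq]
  exact finite_support_add (finite_support_sub (finite_support_single _) (finite_support_sum _ _
    fun i _ => finite_support_oneSub (finite_support_oneSub (finite_support_footChar Y i) _) _))
    (finite_support_mulP (finite_support_sub (finite_support_overlapChar Y)
      (finite_support_chSet π)))

theorem pairing_yChar {R : Type*} [CommRing R] {h : (Fin 3 → ℤ) → R}
    (hh : ∀ u v, h (u + v) = h u * h v) (Y : Fin 3 → YoungDiagram) (π : Finset Box) :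
    pairing h (yChar Y π) = h 0
      - ∑ i, (1 - h (wt (i + 1))) * ((1 - h (wt (i + 2))) * pairing h (footChar Y i))
      + (1 - h (wt 0)) * ((1 - h (wt 1)) * ((1 - h (wt 2)) *
        (pairing h (overlapChar Y) - pairing h (chSet (π : Set Box))))) := by
  have h1 := finite_support_footChar Y
  have h2 := finite_support_sub (finite_support_overlapChar Y) (finite_support_chSet π)
  have h3 : ∀ i, (support (oneSub (wt (i + 1)) (oneSub (wt (i + 2)) (footChar Y i)))).Finite :=
    fun i => finite_support_oneSub (finite_support_oneSub (h1 i) _) _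
  rw [yChar_eq, pairing_add h (finite_support_sub (finite_support_single _)
    (finite_support_sum _ _ fun i _ => h3 i)) (finite_support_mulP h2), pairing_sub h
    (finite_support_single _) (finite_support_sum _ _ fun i _ => h3 i), pairing_single,
    pairing_sum _ _ _ fun i _ => h3 i, mulP, pairing_oneSub hh _
      (finite_support_oneSub (finite_support_oneSub h2 _) _), pairing_oneSub hh _
      (finite_support_oneSub h2 _), pairing_oneSub hh _ h2, pairing_sub h
      (finite_support_overlapChar Y) (finite_support_chSet π)]
  congr 2
  refine Finset.sum_congr rfl fun i _ => ?_
  rw [pairing_oneSub hh _ (finite_support_oneSub (h1 i) _), pairing_oneSub hh _ (h1 i)]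

/-- Each factor `1 - q^u` has total multiplicity zero. Positivity of the total is the degree
condition for the partial fractions. -/
theorem pairing_one_yChar (Y : Fin 3 → YoungDiagram) (π : Finset Box) :
    pairing (1 : (Fin 3 → ℤ) → ℤ) (yChar Y π) = 1 := by
  rw [pairing_yChar (fun _ _ => by simp)]
  simp

/-- Only the trivial weight contributes. This value compares the residues of the two expansions in
`residueAt_inversion`. -/
theorem signedProd_yChar (Y : Fin 3 → YoungDiagram) (π : Finset Box) :
    signedProd l a (yChar Y π) = -1 := by
  have h1 := finite_support_footChar Y
  have h2 := finite_support_sub (finite_support_overlapChar Y) (finite_support_chSet π)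
  have h3 : ∀ i, (support (oneSub (wt (i + 1)) (oneSub (wt (i + 2)) (footChar Y i)))).Finite :=
    fun i => finite_support_oneSub (finite_support_oneSub (h1 i) _) _
  have hne := neg_mono_ne_zero (l := l) (a := a)
  have hs : signedProd l a (∑ i, oneSub (wt (i + 1)) (oneSub (wt (i + 2)) (footChar Y i))) = 1 := by
    rw [Fin.sum_univ_three, signedProd, mulPairing_add hne (finite_support_add (h3 _) (h3 _)) (h3 _),
      mulPairing_add hne (h3 _) (h3 _)]
    simp only [fun i => show mulPairing (fun w => -mono l a w) _ = 1 from
      signedProd_oneSub_oneSub (l := l) (a := a) (h1 i) (wt (i + 1)) (wt (i + 2)), mul_one]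
  have h4 := finite_support_sum Finset.univ _ fun i _ => h3 i
  rw [yChar_eq, signedProd, mulPairing_add hne (finite_support_sub (finite_support_single _) h4)
    (finite_support_mulP h2), mulPairing_sub hne (finite_support_single _) h4, ← signedProd,
    ← signedProd, ← signedProd, hs, signedProd_mulP h2, signedProd, mulPairing_single, mono_zero]
  norm_num

end Parameters

/-! ### Addable and removable boxes as the weights of multiplicity one. -/

section Corners

/-- The box `v` can be added to the configuration `U`. -/
def IsAddable (U : Set Box) (v : Box) : Prop := v ∉ U ∧ ∀ u, u < v → u ∈ U

/-- The box `v` is a maximal element of the configuration `U`. -/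
def IsCorner (U : Set Box) (v : Box) : Prop := v ∈ U ∧ ∀ u, v < u → u ∉ U

theorem chSet_nonneg (U : Set Box) (w : Fin 3 → ℤ) : 0 ≤ chSet U w := by
  rw [chSet_apply]
  split_ifs <;> norm_num

theorem chSet_le_one (U : Set Box) (w : Fin 3 → ℤ) : chSet U w ≤ 1 := by
  rw [chSet_apply]
  split_ifs <;> norm_num

theorem chSet_eq_one_iff (U : Set Box) (v : Box) : chSet U (boxWeight v) = 1 ↔ v ∈ U := by
  rw [chSet_boxWeight]
  split_ifs with h <;> simp [h]

theorem chSet_eq_zero_iff (U : Set Box) (v : Box) : chSet U (boxWeight v) = 0 ↔ v ∉ U := by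
  rw [chSet_boxWeight]
  split_ifs with h <;> simp [h]

theorem boxWeight_sub_wt {v : Box} {i : Fin 3} (h : 1 ≤ v i) :
    boxWeight v - wt i = boxWeight (Function.update v i (v i - 1)) := by
  funext j
  by_cases hj : j = i
  · subst hj
    simp only [boxWeight, wt, Pi.sub_apply, Pi.single_eq_same, Function.update_self]
    omega
  · simp [boxWeight, wt, hj]

theorem boxWeight_add_wt (v : Box) (i : Fin 3) :
    boxWeight v + wt i = boxWeight (Function.update v i (v i + 1)) := by
  funext j
  by_cases hj : j = i
  · subst hj
    simp [boxWeight, wt]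
  · simp [boxWeight, wt, hj]

theorem chSet_le_chSet_sub_wt {U : Set Box} (hU : IsLowerSet U) {w : Fin 3 → ℤ} {i : Fin 3}
    (hi : 1 ≤ w i) : chSet U w ≤ chSet U (w - wt i) := by
  by_cases hw : ∀ j, 0 ≤ w j
  · obtain ⟨v, rfl⟩ := exists_box hw
    have hv : 1 ≤ v i := by simpa [boxWeight] using hi
    rw [boxWeight_sub_wt hv]
    by_cases h : v ∈ U
    · have : Function.update v i (v i - 1) ∈ U := by
        refine hU (fun j => ?_) h
        by_cases hj : j = i
        · subst hj; simp
        · simp [hj]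
      rw [(chSet_eq_one_iff U _).2 this]
      exact chSet_le_one U _
    · rw [(chSet_eq_zero_iff U v).2 h]
      exact chSet_nonneg U _
  · push Not at hw
    obtain ⟨j, hj⟩ := hw
    rw [chSet_of_neg U hj]
    exact chSet_nonneg U _

theorem isAddable_iff {U : Set Box} (hU : IsLowerSet U) (v : Box) :
    IsAddable U v ↔ chSet U (boxWeight v) = 0 ∧
      ∀ i, 1 ≤ boxWeight v i → chSet U (boxWeight v - wt i) = 1 := by
  rw [IsAddable, chSet_eq_zero_iff]
  refine and_congr_right fun _ => ⟨fun h i hi => ?_, fun h u hu => ?_⟩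
  · have hv : 1 ≤ v i := by simpa [boxWeight] using hi
    rw [boxWeight_sub_wt hv, chSet_eq_one_iff]
    refine h _ ((update_lt_self_iff).2 (by omega))
  · obtain ⟨hle, i, hi⟩ := Pi.lt_def.1 hu
    have hv : 1 ≤ v i := by omega
    have := h i (by simpa [boxWeight] using hv)
    rw [boxWeight_sub_wt hv, chSet_eq_one_iff] at this
    refine hU (fun j => ?_) this
    by_cases hj : j = i
    · subst hj
      rw [Function.update_self]
      exact Nat.le_sub_one_of_lt hi
    · rw [Function.update_of_ne hj]
      exact hle j

theorem isCorner_iff {U : Set Box} (hU : IsLowerSet U) (v : Box) :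
    IsCorner U v ↔ chSet U (boxWeight v) = 1 ∧ ∀ i, chSet U (boxWeight v + wt i) = 0 := by
  rw [IsCorner, chSet_eq_one_iff]
  refine and_congr_right fun _ => ⟨fun h i => ?_, fun h u hu hu' => ?_⟩
  · rw [boxWeight_add_wt, chSet_eq_zero_iff]
    exact h _ ((lt_update_self_iff).2 (by omega))
  · obtain ⟨hle, i, hi⟩ := Pi.lt_def.1 hu
    have := h i
    rw [boxWeight_add_wt, chSet_eq_zero_iff] at this
    refine this (hU (fun j => ?_) hu')
    by_cases hj : j = i
    · subst hj
      rw [Function.update_self]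
      exact hi
    · rw [Function.update_of_ne hj]
      exact hle j

/-- The value at `w` is an alternating sum over the eight vertices of the unit cube below `w`, where
the indicator of `U` decreases along each edge that stays inside the octant. The claim is thus a
finite check, split by the position of `w` relative to the walls. -/
theorem single_zero_sub_mulP_classification {U : Set Box} (hU : IsLowerSet U) (w : Fin 3 → ℤ) :
    (single 0 - mulP (chSet U)) w ≤ 1 ∧ ((single 0 - mulP (chSet U)) w = 1 ↔
      ((∀ i, 0 ≤ w i) ∧ chSet U w = 0 ∧ ∀ i, 1 ≤ w i → chSet U (w - wt i) = 1) ∨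
      ((∀ i, 1 ≤ w i) ∧ chSet U (w + wta) = 1 ∧ ∀ i, chSet U (w + wta + wt i) = 0)) := by
  set f := chSet U
  have h0 : ∀ w, 0 ≤ f w := chSet_nonneg U
  have h1 : ∀ w, f w ≤ 1 := chSet_le_one U
  have hn : ∀ w i, w i < 0 → f w = 0 := fun w i hi => chSet_of_neg U hi
  have hm : ∀ w i, 1 ≤ w i → f w ≤ f (w - wt i) := fun w i hi => chSet_le_chSet_sub_wt hU hi
  have e0 : single 0 w = if w 0 = 0 ∧ w 1 = 0 ∧ w 2 = 0 then 1 else 0 := by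
    rw [single_apply]
    congr 1
    rw [funext_iff]
    simp [Fin.forall_fin_succ]
  have e3 : w + wta = w - wt 0 - wt 1 - wt 2 := by
    rw [← wta_eq]
    abel
  have e4 : w - wt 0 - wt 1 - wt 2 + wt 0 = w - wt 1 - wt 2 := by abel
  have e5 : w - wt 0 - wt 1 - wt 2 + wt 1 = w - wt 0 - wt 2 := by abel
  have e6 : w - wt 0 - wt 1 - wt 2 + wt 2 = w - wt 0 - wt 1 := by abel
  simp only [Fin.forall_fin_succ, IsEmpty.forall_iff, and_true, Pi.sub_apply, mulP, oneSub, shiftBy,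
    e0, Fin.succ_zero_eq_one, Fin.succ_one_eq_two, e4, e5, e6, e3]
  have c01 : w - wt 1 - wt 0 = w - wt 0 - wt 1 := by abel
  have c02 : w - wt 2 - wt 0 = w - wt 0 - wt 2 := by abel
  have c12 : w - wt 2 - wt 1 = w - wt 1 - wt 2 := by abel
  have c012 : w - wt 0 - wt 2 - wt 1 = w - wt 0 - wt 1 - wt 2 := by abel
  have c120 : w - wt 1 - wt 2 - wt 0 = w - wt 0 - wt 1 - wt 2 := by abel
  have w00 : wt 0 0 = 1 := rfl
  have w01 : wt 0 1 = 0 := rfl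
  have w02 : wt 0 2 = 0 := rfl
  have w10 : wt 1 0 = 0 := rfl
  have w11 : wt 1 1 = 1 := rfl
  have w12 : wt 1 2 = 0 := rfl
  have w20 : wt 2 0 = 0 := rfl
  have w21 : wt 2 1 = 0 := rfl
  have w22 : wt 2 2 = 1 := rfl
  have A0 := h0 w
  have B0 := h1 w
  have A1 := h0 (w - wt 0)
  have B1 := h1 (w - wt 0)
  have A2 := h0 (w - wt 1)
  have B2 := h1 (w - wt 1)
  have A3 := h0 (w - wt 2)
  have B3 := h1 (w - wt 2)
  have A4 := h0 (w - wt 0 - wt 1)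
  have B4 := h1 (w - wt 0 - wt 1)
  have A5 := h0 (w - wt 0 - wt 2)
  have B5 := h1 (w - wt 0 - wt 2)
  have A6 := h0 (w - wt 1 - wt 2)
  have B6 := h1 (w - wt 1 - wt 2)
  have A7 := h0 (w - wt 0 - wt 1 - wt 2)
  have B7 := h1 (w - wt 0 - wt 1 - wt 2)
  have N := fun i => hn w i
  have N0 := fun i => hn (w - wt 0) i
  have N1 := fun i => hn (w - wt 1) i
  have N2 := fun i => hn (w - wt 2) i
  have N01 := fun i => hn (w - wt 0 - wt 1) i
  have N02 := fun i => hn (w - wt 0 - wt 2) i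
  have N12 := fun i => hn (w - wt 1 - wt 2) i
  have N012 := fun i => hn (w - wt 0 - wt 1 - wt 2) i
  have M := fun i => hm w i
  have M0 := fun i => hm (w - wt 0) i
  have M1 := fun i => hm (w - wt 1) i
  have M2 := fun i => hm (w - wt 2) i
  have M01 := fun i => hm (w - wt 0 - wt 1) i
  have M02 := fun i => hm (w - wt 0 - wt 2) i
  have M12 := fun i => hm (w - wt 1 - wt 2) i
  simp only [Fin.forall_fin_succ, IsEmpty.forall_iff, and_true, Fin.succ_zero_eq_one,
    Fin.succ_one_eq_two, Pi.sub_apply, w00, w01, w02, w10, w11, w12, w20, w21, w22, sub_zero,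
    c01, c02, c12, c012, c120] at *
  generalize w 0 = n0 at *
  generalize w 1 = n1 at *
  generalize w 2 = n2 at *
  generalize f (w - wt 0 - wt 1 - wt 2) = x7 at *
  generalize f (w - wt 0 - wt 1) = x4 at *
  generalize f (w - wt 0 - wt 2) = x5 at *
  generalize f (w - wt 1 - wt 2) = x6 at *
  generalize f (w - wt 0) = x1 at *
  generalize f (w - wt 1) = x2 at *
  generalize f (w - wt 2) = x3 at *
  generalize f w = x0 at *
  clear hn hm h0 h1
  clear e0 e3 e4 e5 e6 w00 w01 w02 w10 w11 w12 w20 w21 w22 c01 c02 c12 c012 c120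
  -- Only the monotonicity along the twelve edges of the cube is kept.
  replace M01 := M01.2.2
  replace M02 := M02.2.1
  replace M12 := M12.1
  replace M0 := M0.2
  replace M1 := And.intro M1.1 M1.2.2
  replace M2 := And.intro M2.1 M2.2.1
  -- Each coordinate matters only through being negative, zero or positive; rewriting the side
  -- conditions to `True` and `False` leaves linear arithmetic in the eight values.
  have key : ∀ n : ℤ,
      ((n < 0) = True ∧ (n - 1 < 0) = True ∧ (1 ≤ n) = False ∧ (0 ≤ n) = False ∧ (n = 0) = False) ∨
      ((n < 0) = False ∧ (n - 1 < 0) = True ∧ (1 ≤ n) = False ∧ (0 ≤ n) = True ∧ (n = 0) = True) ∨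
      ((n < 0) = False ∧ (n - 1 < 0) = False ∧ (1 ≤ n) = True ∧ (0 ≤ n) = True ∧
        (n = 0) = False) := by
    intro n
    simp only [eq_iff_iff, iff_true, iff_false]
    omega
  rcases key n0 with ⟨a1, a2, a3, a4, a5⟩ | ⟨a1, a2, a3, a4, a5⟩ | ⟨a1, a2, a3, a4, a5⟩ <;>
    rcases key n1 with ⟨b1, b2, b3, b4, b5⟩ | ⟨b1, b2, b3, b4, b5⟩ | ⟨b1, b2, b3, b4, b5⟩ <;>
    rcases key n2 with ⟨c1, c2, c3, c4, c5⟩ | ⟨c1, c2, c3, c4, c5⟩ | ⟨c1, c2, c3, c4, c5⟩ <;>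
    clear key <;>
    simp only [a1, a2, a3, a4, a5, b1, b2, b3, b4, b5, c1, c2, c3, c4, c5, true_imp_iff,
      false_imp_iff, and_true, true_and, and_self, and_false, false_and, if_true, if_false,
      or_false, iff_false] at N N0 N1 N2 N01 N02 N12 N012 M M0 M1 M2 M01 M02 M12 ⊢ <;>
    omega

/-- The infinite plane partition `π ∪ B_{λμν}`. -/
def PP.config {Y : Fin 3 → YoungDiagram} (π : PP Y) : Set Box := (π.1 : Set Box) ∪ bd Y

variable {Y : Fin 3 → YoungDiagram}

theorem yChar_eq_config (π : PP Y) : yChar Y π.1 = single 0 - mulP (chSet π.config) := by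
  rw [PP.config, chSet_union π.2.1]
  rfl

theorem yChar_le_one (π : PP Y) (w : Fin 3 → ℤ) : yChar Y π.1 w ≤ 1 := by
  rw [yChar_eq_config]
  exact (single_zero_sub_mulP_classification π.2.2 w).1

theorem yChar_eq_one_iff (π : PP Y) (w : Fin 3 → ℤ) : yChar Y π.1 w = 1 ↔
    (∃ v, boxWeight v = w ∧ IsAddable π.config v) ∨
      ∃ v, boxWeight v - wta = w ∧ IsCorner π.config v := by
  have hU : IsLowerSet π.config := π.2.2
  rw [yChar_eq_config, (single_zero_sub_mulP_classification hU w).2]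
  refine or_congr ⟨?_, ?_⟩ ⟨?_, ?_⟩
  · rintro ⟨h0, h⟩
    obtain ⟨v, rfl⟩ := exists_box h0
    exact ⟨v, rfl, (isAddable_iff π.2.2 v).2 h⟩
  · rintro ⟨v, rfl, h⟩
    exact ⟨fun i => by simp [boxWeight], (isAddable_iff π.2.2 v).1 h⟩
  · rintro ⟨h0, h⟩
    obtain ⟨v, hv⟩ := exists_box (w := w + wta) fun i => by
      have := h0 i
      simp only [Pi.add_apply, wta]
      omega
    refine ⟨v, by rw [hv]; abel, (isCorner_iff π.2.2 v).2 ?_⟩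
    rwa [hv]
  · rintro ⟨v, rfl, h⟩
    rw [sub_add_cancel]
    exact ⟨fun i => by simp [boxWeight, wta], (isCorner_iff π.2.2 v).1 h⟩

theorem isAddable_of_insert {π π' : PP Y} {v : Box} (hv : v ∉ π.1) (h : π'.1 = insert v π.1) :
    IsAddable π.config v := by
  have hv' : v ∈ π'.1 := h ▸ Finset.mem_insert_self v _
  have hbd : v ∉ bd Y := Set.disjoint_left.1 π'.2.1 hv'
  refine ⟨fun h0 => h0.elim hv hbd, fun u hu => ?_⟩
  rcases π'.2.2 hu.le (Or.inl hv') with h1 | h1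
  · rw [h] at h1
    rcases Finset.mem_insert.1 h1 with h2 | h2
    · exact absurd h2 hu.ne
    · exact Or.inl h2
  · exact Or.inr h1

theorem isCorner_of_insert {π π' : PP Y} {v : Box} (hv : v ∉ π.1) (h : π'.1 = insert v π.1) :
    IsCorner π'.config v := by
  have hv' : v ∈ π'.1 := h ▸ Finset.mem_insert_self v _
  have hbd : v ∉ bd Y := Set.disjoint_left.1 π'.2.1 hv'
  refine ⟨Or.inl hv', fun u hu hu' => ?_⟩
  have : u ∈ π.config := by
    rcases hu' with h1 | h1
    · rw [h] at h1
      rcases Finset.mem_insert.1 h1 with h2 | h2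
      · exact absurd h2 hu.ne'
      · exact Or.inl h2
    · exact Or.inr h1
  exact (π.2.2 hu.le this).elim hv hbd

theorem exists_insert_of_isAddable {π : PP Y} {v : Box} (h : IsAddable π.config v) :
    v ∉ π.1 ∧ ∃ π' : PP Y, π'.1 = insert v π.1 := by
  refine ⟨fun h0 => h.1 (Or.inl h0), ⟨insert v π.1, ?_, ?_⟩, rfl⟩
  · rw [Finset.coe_insert, Set.disjoint_insert_left]
    exact ⟨fun h0 => h.1 (Or.inr h0), π.2.1⟩
  · rw [Finset.coe_insert, Set.insert_union]
    intro u w hwu hu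
    rcases Set.mem_insert_iff.1 hu with rfl | hu
    · rcases hwu.eq_or_lt with rfl | hlt
      · exact Set.mem_insert _ _
      · exact Set.mem_insert_of_mem _ (h.2 w hlt)
    · exact Set.mem_insert_of_mem _ (π.2.2 hwu hu)

/-- A leg contains the translate of each of its boxes along its axis, so a maximal box never belongs
to the vacuum and can be removed. -/
theorem exists_erase_of_isCorner {π' : PP Y} {v : Box} (h : IsCorner π'.config v) :
    ∃ π : PP Y, v ∉ π.1 ∧ π'.1 = insert v π.1 := by
  have hbd : v ∉ bd Y := by
    intro h0
    obtain ⟨i, hi⟩ := Set.mem_iUnion.1 h0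
    obtain ⟨h1, h2, -⟩ := fin3_ne i
    refine h.2 (Function.update v i (v i + 1)) ((lt_update_self_iff).2 (by omega))
      (Or.inr (Set.mem_iUnion.2 ⟨i, ?_⟩))
    change (_, _) ∈ Y i
    rwa [Function.update_of_ne h1, Function.update_of_ne h2]
  have hv : v ∈ π'.1 := h.1.resolve_right hbd
  refine ⟨⟨π'.1.erase v, ?_, ?_⟩, Finset.notMem_erase v _, (Finset.insert_erase hv).symm⟩
  · exact π'.2.1.mono_left (by simp)
  · intro u w hwu hu
    have hu' : u ∈ π'.config := hu.imp_left fun h => Finset.mem_of_mem_erase h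
    have hw : w ∈ π'.config := π'.2.2 hwu hu'
    have hne : w ≠ v := by
      rintro rfl
      rcases hwu.eq_or_lt with rfl | hlt
      · exact hu.elim (Finset.notMem_erase _ _) hbd
      · exact h.2 u hlt hu'
    exact hw.imp_left fun h => Finset.mem_erase.2 ⟨hne, h⟩

theorem exists_isCorner {π : PP Y} (h : π.1.Nonempty) : ∃ v ∈ π.1, IsCorner π.config v := by
  obtain ⟨v, hv, hmax⟩ := π.1.exists_maximal h
  refine ⟨v, hv, Or.inl hv, fun u hu hu' => ?_⟩
  rcases hu' with h1 | h1
  · exact hu.not_ge (hmax h1 hu.le)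
  · exact Set.disjoint_left.1 π.2.1 hv (isLowerSet_bd Y hu.le h1)

end Corners

/-! ### Residues of the structure function and the recursion for the partition function. -/

section Recursion

open Function (support)

variable {l : Fin 4 → ℂ} {a : Fin 4} {Y : Fin 3 → YoungDiagram}

variable (l a) in
/-- The residue at the weight `u` of the product `∏ (1 - w / z)^{-y_w}`. -/
def residueAt (y : Character) (u : Fin 3 → ℤ) : ℂ := (regIndex l a (shiftBy u (dual y)))⁻¹

theorem residueAt_eq_prod {y : Character} {s : Finset (Fin 3 → ℤ)} (hs : support y ⊆ s)
    (u : Fin 3 → ℤ) :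
    residueAt l a y u = ∏ w ∈ s.erase u, (1 - mono l a w / mono l a u) ^ (-y w) := by
  rw [residueAt, regIndex, mulPairing_shiftBy, mulPairing_dual, mulPairing_eq_prod _ hs,
    ← Finset.prod_inv_distrib, ← Finset.prod_subset (Finset.erase_subset u s)]
  · refine Finset.prod_congr rfl fun w hw => ?_
    have hw : -w + u ≠ 0 := by
      rw [neg_add_eq_sub, sub_ne_zero]
      exact (Finset.ne_of_mem_erase hw).symm
    rw [if_neg hw, zpow_neg, ← mono_neg, neg_add, neg_neg, ← sub_eq_add_neg, mono_sub]
  · intro w hw hw'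
    have : w = u := by
      by_contra h
      exact hw' (Finset.mem_erase.2 ⟨h, hw⟩)
    rw [this, neg_add_cancel, if_pos rfl, one_zpow, inv_one]

theorem residueAt_ne_zero (hnd : ∀ w, mono l a w = 1 → w = 0) (y : Character) (u : Fin 3 → ℤ) :
    residueAt l a y u ≠ 0 :=
  inv_ne_zero (mulPairing_ne_zero (regIndex_factor_ne_zero hnd) _)

/-- The factor of the weight `u` is `(1 - c/z)⁻¹` and cancels; the others are continuous and nonzero
at `c` because different weights take different values. -/
theorem isSimpleResidue_structureFun (hnd : ∀ w, mono l a w = 1 → w = 0) {x : ℂ} (hx : x ≠ 0)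
    (π : PP Y) {u : Fin 3 → ℤ} (hu : yChar Y π.1 u = 1) :
    IsSimpleResidue (fun x' => (structureFun l a Y π x ((q l a)⁻¹ * x'))⁻¹)
      (q l a * (x * mono l a u)) (residueAt l a (yChar Y π.1) u) := by
  refine ⟨residueAt_ne_zero hnd _ _, ?_⟩
  set y := yChar Y π.1
  set c := q l a * (x * mono l a u) with hc
  have hfin := finite_support_yChar Y π.1
  have hs : support y ⊆ hfin.toFinset := by simp [y]
  have hus : u ∈ hfin.toFinset := by
    rw [Set.Finite.mem_toFinset, Function.mem_support]
    change y u ≠ 0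
    rw [hu]
    exact one_ne_zero
  have hqa := q_ne_zero l a
  have hmu := mono_ne_zero l a u
  have hc0 : c ≠ 0 := mul_ne_zero hqa (mul_ne_zero hx hmu)
  have hfac : ∀ z w, 1 - mono l a w * x / ((q l a)⁻¹ * z) = 1 - mono l a w / mono l a u * (c / z) := by
    intro z w
    rw [hc]
    congr 1
    by_cases hz : z = 0
    · simp [hz]
    · field_simp
  have hF : ∀ z, (structureFun l a Y π x ((q l a)⁻¹ * z))⁻¹
      = ∏ w ∈ hfin.toFinset, (1 - mono l a w / mono l a u * (c / z)) ^ (-y w) := by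
    intro z
    rw [structureFun, finprod_eq_prod_of_mulSupport_subset (s := hfin.toFinset),
      ← Finset.prod_inv_distrib]
    · exact Finset.prod_congr rfl fun w _ => by rw [hfac, zpow_neg]
    · exact fun w hw => hs fun h0 => hw (by
        change _ ^ y w = _
        rw [h0, zpow_zero])
  rw [residueAt_eq_prod hs]
  have hlim : Filter.Tendsto (fun z => ∏ w ∈ hfin.toFinset.erase u,
      (1 - mono l a w / mono l a u * (c / z)) ^ (-y w)) (nhdsWithin c {c}ᶜ)
      (nhds (∏ w ∈ hfin.toFinset.erase u, (1 - mono l a w / mono l a u) ^ (-y w))) := by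
    refine Filter.Tendsto.mono_left ?_ nhdsWithin_le_nhds
    refine tendsto_finsetProd _ fun w hw => ?_
    have hne : 1 - mono l a w / mono l a u ≠ 0 := by
      intro h0
      rw [← mono_sub] at h0
      exact Finset.ne_of_mem_erase hw (sub_eq_zero.1 (hnd _ (sub_eq_zero.1 h0).symm))
    have h1 : Filter.Tendsto (fun z => c / z) (nhds c) (nhds 1) := by
      have := Filter.Tendsto.div (tendsto_const_nhds (x := c)) Filter.tendsto_id hc0
      rw [div_self hc0] at this
      exact this
    have h2 : Filter.Tendsto (fun z => 1 - mono l a w / mono l a u * (c / z)) (nhds c)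
        (nhds (1 - mono l a w / mono l a u)) := by
      simpa using (tendsto_const_nhds (x := (1 : ℂ))).sub (h1.const_mul (mono l a w / mono l a u))
    exact h2.zpow₀ _ (Or.inl hne)
  refine hlim.congr' ?_
  have hz0 : ∀ᶠ z in nhdsWithin c {c}ᶜ, z ≠ 0 :=
    (eventually_ne_nhds hc0).filter_mono nhdsWithin_le_nhds
  filter_upwards [hz0, self_mem_nhdsWithin] with z hz hzc
  rw [hF, ← Finset.mul_prod_erase _ _ hus, ← mul_assoc]
  have h1 : 1 - c / z ≠ 0 := by
    intro h0
    have h2 := (sub_eq_zero.1 h0).symm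
    rw [div_eq_one_iff_eq hz] at h2
    exact hzc h2.symm
  rw [div_self hmu, one_mul]
  change _ = ((1 - c / z) * (1 - c / z) ^ (-y u)) * _
  rw [show y u = 1 from hu, zpow_neg, zpow_one, mul_inv_cancel₀ h1, one_mul]

theorem mulP_single_zero : mulP (single 0) 0 = 1 ∧ mulP (single 0) (-wta) = -1 := by
  constructor <;>
    simp [mulP, oneSub, shiftBy, single_apply, wt, wta, funext_iff, Fin.forall_fin_succ]

theorem mulP_single (u : Fin 3 → ℤ) : mulP (single u) = shiftBy u (mulP (single 0)) := by
  rw [← mulP_shiftBy, shiftBy_single, add_zero]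

variable {π π' : PP Y} {v : Box}

/-- The constant term reads the indicator of `π` at the vertices of the unit cube above `v`, none of
which lies in `π`: `v` itself is missing and is maximal once added. -/
theorem crossTerm_zero (hv : v ∉ π.1) (h : π'.1 = insert v π.1) :
    shiftBy (boxWeight v) (mulP (dual (chSet (π.1 : Set Box)))) 0 = 0 := by
  have hz : ∀ w : Fin 3 → ℤ, (∀ i, (v i : ℤ) ≤ w i) → chSet (π.1 : Set Box) w = 0 := by
    intro w hw
    obtain ⟨u, rfl⟩ := exists_box (w := w) fun i => (Int.natCast_nonneg _).trans (hw i)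
    rw [chSet_eq_zero_iff]
    intro hu
    have hle : v ≤ u := fun i => Int.ofNat_le.1 (hw i)
    rcases hle.eq_or_lt with rfl | hlt
    · exact hv hu
    · exact (isCorner_of_insert hv h).2 u hlt (Or.inl (by rw [h]; exact Finset.mem_insert_of_mem hu))
  simp only [mulP, oneSub, shiftBy, dual, Pi.sub_apply]
  have hp : ∀ i j, 0 ≤ wt i j := by
    intro i j
    rw [wt, Pi.single_apply]
    split_ifs <;> norm_num
  have hw : ∀ w : Fin 3 → ℤ, (∀ i, w i ≤ -(v i : ℤ)) → chSet (π.1 : Set Box) (-w) = 0 :=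
    fun w hw => hz _ fun i => by have := hw i; rw [Pi.neg_apply]; omega
  repeat rw [hw]
  · norm_num
  all_goals
    intro i
    have := hp 0 i
    have := hp 1 i
    have := hp 2 i
    simp only [Pi.sub_apply, Pi.zero_apply, boxWeight]
    omega

/-- Adding `v` raises the multiplicity of `Y` at the removable weight from `0` to `1` and lowers it
at the addable weight from `1` to `0`. The two `Y`-terms of `vChar_insert` read the two zeros. -/
theorem vChar_insert_apply_zero (hv : v ∉ π.1) (h : π'.1 = insert v π.1) :
    vChar Y π'.1 0 = vChar Y π.1 0 := by
  have h1 := congrFun (vChar_insert Y π.1 hv) 0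
  have h2 := crossTerm_zero hv h
  have h3 : dual (shiftBy (boxWeight v) (mulP (dual (chSet (π.1 : Set Box))))) 0 = 0 := by
    rw [dual, neg_zero, h2]
  rw [← h] at h1
  simp only [Pi.sub_apply, Pi.add_apply, h2, h3, sub_zero, add_zero] at h1
  have e1 : shiftBy (boxWeight v - wta) (dual (yChar Y π.1)) 0 = 0 := by
    have e := (yChar_eq_one_iff π' (boxWeight v - wta)).2 (Or.inr ⟨v, rfl, isCorner_of_insert hv h⟩)
    rw [h, yChar_insert Y π.1 hv, Pi.sub_apply, mulP_single, shiftBy, sub_sub_cancel_left,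
      mulP_single_zero.2] at e
    rw [shiftBy, dual, zero_sub, neg_neg]
    omega
  have e2 : shiftBy (boxWeight v) (dual (yChar Y π'.1)) 0 = 0 := by
    have e := (yChar_eq_one_iff π (boxWeight v)).2 (Or.inl ⟨v, rfl, isAddable_of_insert hv h⟩)
    rw [shiftBy, dual, zero_sub, neg_neg, h, yChar_insert Y π.1 hv, Pi.sub_apply, mulP_single,
      shiftBy, sub_self, mulP_single_zero.1, e, sub_self]
  rw [e1, e2] at h1
  omega

theorem vChar_empty : vChar Y ∅ = 0 := by
  have h : chSet ((∅ : Finset Box) : Set Box) = 0 := by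
    funext w
    simp [chSet]
  have h0 : ∀ u, oneSub u (0 : Character) = 0 := by
    intro u
    funext w
    simp [oneSub, shiftBy]
  have h1 : ∀ f, mulK ∅ f = 0 := fun f => by simp [mulK]
  rw [vChar, h, h0, h1, h1]
  simp

/-- Induction on plane partitions, one box at a time. -/
theorem PP.induction {p : PP Y → Prop} (h0 : p (PP.empty Y))
    (h1 : ∀ (π π' : PP Y) (v : Box), v ∉ π.1 → π'.1 = insert v π.1 → p π → p π') (π : PP Y) :
    p π := by
  induction hn : π.1.card generalizing π with
  | zero =>
    have : π = PP.empty Y := Subtype.ext (Finset.card_eq_zero.1 hn)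
    rwa [this]
  | succ n ih =>
    obtain ⟨v, -, hv⟩ := exists_isCorner (Finset.card_pos.1 (show 0 < π.1.card by omega))
    obtain ⟨π₀, h2, h3⟩ := exists_erase_of_isCorner hv
    refine h1 π₀ π v h2 h3 (ih π₀ ?_)
    rw [h3, Finset.card_insert_of_notMem h2] at hn
    omega

/-- Absence of the trivial weight is what makes the partition function a product of nonzero factors.
-/
theorem vChar_apply_zero (π : PP Y) : vChar Y π.1 0 = 0 := by
  induction π using PP.induction with
  | h0 => exact congrFun vChar_empty 0
  | h1 π π' v hv h ih => rw [vChar_insert_apply_zero hv h, ih]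

theorem Z_empty : Z l a Y (PP.empty Y) = 1 := by
  rw [Z]
  change index l a (vChar Y ∅) = 1
  rw [vChar_empty, index]
  simp

theorem finite_support_vChar (π : PP Y) : (support (vChar Y π.1)).Finite := by
  induction π using PP.induction with
  | h0 =>
    change (support (vChar Y ∅)).Finite
    rw [vChar_empty]
    simp
  | h1 π π' v hv h ih =>
    have h2 := vChar_insert Y π.1 hv
    rw [← h, sub_eq_iff_eq_add] at h2
    have hX := finite_support_shiftBy (finite_support_mulP (finite_support_dual
      (finite_support_chSet π.1))) (boxWeight v)
    rw [h2]
    exact finite_support_add (finite_support_add (finite_support_sub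
      (finite_support_shiftBy (finite_support_dual (finite_support_yChar Y _)) _)
      (finite_support_shiftBy (finite_support_dual (finite_support_yChar Y _)) _))
      (finite_support_sub (finite_support_dual hX) hX)) ih

theorem Z_ne_zero (hnd : ∀ w, mono l a w = 1 → w = 0) (π : PP Y) : Z l a Y π ≠ 0 := by
  rw [Z, index_eq_regIndex (vChar_apply_zero π)]
  exact mulPairing_ne_zero (regIndex_factor_ne_zero hnd) _

/-- The recursion for the partition function. -/
theorem Z_insert (hnd : ∀ w, mono l a w = 1 → w = 0) (hv : v ∉ π.1) (h : π'.1 = insert v π.1) :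
    Z l a Y π' / Z l a Y π = -(residueAt l a (yChar Y π.1) (boxWeight v) /
      residueAt l a (yChar Y π'.1) (boxWeight v - wta)) := by
  have hne := regIndex_factor_ne_zero hnd
  have hsub : ∀ {f g : Character}, (support f).Finite → (support g).Finite →
      regIndex l a (f - g) = regIndex l a f / regIndex l a g := fun hf hg => mulPairing_sub hne hf hg
  have hy := finite_support_yChar Y π.1
  have hy' := finite_support_yChar Y π'.1
  set A := shiftBy (boxWeight v - wta) (dual (yChar Y π.1)) with hA
  set B := shiftBy (boxWeight v) (dual (yChar Y π.1)) with hB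
  set X := shiftBy (boxWeight v) (mulP (dual (chSet (π.1 : Set Box)))) with hX
  set P := mulP (single 0) with hP
  have fA : (support A).Finite := finite_support_shiftBy (finite_support_dual hy) _
  have fB : (support B).Finite := finite_support_shiftBy (finite_support_dual hy) _
  have fP : (support P).Finite := finite_support_mulP (finite_support_single 0)
  have fK := finite_support_dual (finite_support_chSet π.1)
  have fX : (support X).Finite := finite_support_shiftBy (finite_support_mulP fK) _
  have hyP : yChar Y π'.1 = yChar Y π.1 - shiftBy (boxWeight v) P := by
    rw [h, yChar_insert Y π.1 hv, mulP_single]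
  -- Everything is expressed through `yChar` of the smaller configuration; the corrections are `P^∨`
  -- here and `-P` in the residue of the larger one.
  have hB' : shiftBy (boxWeight v) (dual (yChar Y π'.1)) = B - dual P := by
    rw [hyP, dual_sub, shiftBy_sub, dual_shiftBy, shiftBy_shiftBy, add_neg_cancel, shiftBy_zero]
  have hA' : shiftBy (boxWeight v - wta) (dual (yChar Y π'.1)) = A - -P := by
    rw [hyP, dual_sub, shiftBy_sub, dual_shiftBy, shiftBy_shiftBy, hP, dual_mulP, mulPdual_eq,
      dual_single, neg_zero, shiftBy_neg, shiftBy_shiftBy,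
      show boxWeight v - wta + -boxWeight v + wta = 0 by abel, shiftBy_zero]
  have hXI : regIndex l a (dual X - X) = 1 := by
    have hX0 : X 0 = 0 := crossTerm_zero hv h
    rw [regIndex_dual_sub_self hnd fX, hX0, zpow_zero, one_mul, hX, ← mulP_shiftBy]
    exact signedProd_mulP (finite_support_shiftBy fK _)
  -- The sign of the recursion: reflection gives `(-1) ^ P 0`, and `P` contains the trivial weight
  -- once.
  have hPI : regIndex l a (dual P) * regIndex l a (-P) = -1 := by
    have h1 := regIndex_dual_sub_self hnd fP
    rw [sub_eq_add_neg, hP, mulP_single_zero.1, signedProd_mulP (finite_support_single 0)] at h1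
    rw [← hP] at h1
    have h2 : regIndex l a (dual P + -P) = regIndex l a (dual P) * regIndex l a (-P) :=
      mulPairing_add hne (finite_support_dual fP) (finite_support_neg fP)
    rw [← h2, h1]
    norm_num
  have hZ : Z l a Y π' / Z l a Y π = regIndex l a A / (regIndex l a B / regIndex l a (dual P)) := by
    rw [Z, Z, index_eq_regIndex (vChar_apply_zero π), index_eq_regIndex (vChar_apply_zero π'),
      ← hsub (finite_support_vChar π') (finite_support_vChar π), h, vChar_insert Y π.1 hv, ← h, hB']
    rw [show regIndex l a (A - (B - dual P) + (dual X - X)) = _ from mulPairing_add hne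
      (finite_support_sub fA (finite_support_sub fB (finite_support_dual fP)))
      (finite_support_sub (finite_support_dual fX) fX)]
    change regIndex l a (A - (B - dual P)) * regIndex l a (dual X - X) = _
    rw [hXI, mul_one, hsub fA (finite_support_sub fB (finite_support_dual fP)),
      hsub fB (finite_support_dual fP)]
  rw [hZ, residueAt, residueAt, hA', ← hB, hsub fA (finite_support_neg fP)]
  have n1 : regIndex l a A ≠ 0 := mulPairing_ne_zero hne _
  have n2 : regIndex l a B ≠ 0 := mulPairing_ne_zero hne _
  have n3 : regIndex l a (dual P) ≠ 0 := mulPairing_ne_zero hne _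
  have n4 : regIndex l a (-P) ≠ 0 := mulPairing_ne_zero hne _
  have h3 : regIndex l a (dual P) = -(regIndex l a (-P))⁻¹ := by
    field_simp
    exact hPI
  rw [h3]
  field_simp

/-- Limits are unique, so the recursion prescribes every ratio. In the induction the previous value
is already that of `Z`, which is nonzero; no nonvanishing of `C` has to be assumed. -/
theorem residueRecursion_iff (hprod : ∏ i, q l i = 1) (hnd : ∀ w, mono l a w = 1 → w = 0) {x : ℂ}
    (hx : x ≠ 0) (C : PP Y → ℂ) : ResidueRecursion l a Y x C ↔ C = Z l a Y := by
  have hres : ∀ (π π' : PP Y) (v : Box), v ∉ π.1 → π'.1 = insert v π.1 →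
      IsSimpleResidue (fun x' => (structureFun l a Y π x ((q l a)⁻¹ * x'))⁻¹)
        (q l a * (x * chi l a v)) (residueAt l a (yChar Y π.1) (boxWeight v)) ∧
      IsSimpleResidue (fun x' => (structureFun l a Y π' x ((q l a)⁻¹ * x'))⁻¹)
        (x * chi l a v) (residueAt l a (yChar Y π'.1) (boxWeight v - wta)) := by
    intro π π' v hv h
    refine ⟨isSimpleResidue_structureFun hnd hx π ((yChar_eq_one_iff π _).2
      (Or.inl ⟨v, rfl, isAddable_of_insert hv h⟩)), ?_⟩
    have h1 := isSimpleResidue_structureFun hnd hx π' ((yChar_eq_one_iff π' _).2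
      (Or.inr ⟨v, rfl, isCorner_of_insert hv h⟩))
    -- The removable box sits at the weight `q_a⁻¹ χ(v)`, and the argument `q_a⁻¹ x'` of the
    -- structure function undoes the factor.
    have h2 : q l a * (x * mono l a (boxWeight v - wta)) = x * chi l a v := by
      have := q_ne_zero l a
      rw [mono_sub, mono_wta hprod]
      change q l a * (x * (chi l a v / q l a)) = _
      field_simp
    rwa [h2] at h1
  constructor
  · rintro ⟨h0, hrec⟩
    funext π
    induction π using PP.induction with
    | h0 => rw [h0, Z_empty]
    | h1 π π' v hv h ih =>
      obtain ⟨r, r', hr, hr', hC⟩ := hrec π π' v hv h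
      obtain ⟨g, g'⟩ := hres π π' v hv h
      rw [tendsto_nhds_unique hr.2 g.2, tendsto_nhds_unique hr'.2 g'.2, ← Z_insert hnd hv h, ih] at hC
      exact (div_left_inj' (Z_ne_zero hnd π)).1 hC
  · rintro rfl
    refine ⟨Z_empty, fun π π' v hv h => ?_⟩
    obtain ⟨g, g'⟩ := hres π π' v hv h
    exact ⟨_, _, g, g', Z_insert hnd hv h⟩

end Recursion

/-! ### Contractions of the terms of the `qq`-character with the screening current. -/

section Exponents

open Function (support)

variable {l : Fin 4 → ℂ} {a : Fin 4} {Y : Fin 3 → YoungDiagram}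

theorem exp_logChi (v : Box) : Complex.exp (logChi l a v) = mono l a (boxWeight v) := by
  rw [logChi, Complex.exp_sum, mono]
  refine Finset.prod_congr rfl fun i _ => ?_
  rw [Complex.exp_nat_mul, boxWeight, zpow_natCast, q]

theorem exp_neg_mul_logChi (n : ℤ) (v : Box) :
    Complex.exp (-(n * logChi l a v)) = mono l a (boxWeight v) ^ (-n) := by
  rw [← exp_logChi, ← Complex.exp_int_mul]
  push_cast
  rw [neg_mul]

theorem mono_zpow_add (n : ℤ) (u v : Fin 3 → ℤ) :
    mono l a (u + v) ^ n = mono l a u ^ n * mono l a v ^ n := by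
  rw [mono_add, mul_zpow]

theorem one_sub_q_zpow_ne_zero (hnd : ∀ w, mono l a w = 1 → w = 0) (i : Fin 3) {n : ℤ}
    (hn : n ≠ 0) : 1 - q l (a.succAbove i) ^ n ≠ 0 := by
  intro h
  have h1 : mono l a (n • wt i) = 1 := by
    rw [mono_zsmul, mono_wt]
    exact (sub_eq_zero.1 h).symm
  have := congrFun (hnd _ h1) i
  simp [wt] at this
  exact hn this

theorem one_sub_q_self_zpow_ne_zero (hprod : ∏ i, q l i = 1)
    (hnd : ∀ w, mono l a w = 1 → w = 0) {n : ℤ} (hn : n ≠ 0) : 1 - q l a ^ n ≠ 0 := by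
  intro h
  have h1 : mono l a (n • wta) = 1 := by
    rw [mono_zsmul, mono_wta hprod]
    exact (sub_eq_zero.1 h).symm
  have := congrFun (hnd _ h1) 0
  simp [wta] at this
  exact hn this

/-- The oscillator part of the exponent of `Λ_π`. -/
theorem expLambda_osc (hnd : ∀ w, mono l a w = 1 → w = 0) (L : ℂ) (π : PP Y) {n : ℤ} (hn : n ≠ 0) :
    expLambda l a L Y π (.osc n) = (∏ i, (1 - q l (a.succAbove i) ^ (-n)))⁻¹ *
      pairing (fun w => mono l a w ^ (-n)) (yChar Y π.1) := by
  have hQ := fun i => one_sub_q_zpow_ne_zero hnd i (neg_ne_zero.2 hn)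
  have hsum : ∀ s : Finset Box, pairing (fun w => mono l a w ^ (-n))
      (∑ v ∈ s, single (boxWeight v)) = ∑ v ∈ s, mono l a (boxWeight v) ^ (-n) := by
    intro s
    rw [pairing_sum _ _ _ fun _ _ => finite_support_single _]
    exact Finset.sum_congr rfl fun v _ => pairing_single _ _
  have hfoot : ∀ i, pairing (fun w => mono l a w ^ (-n)) (footChar Y i)
      = ∑ p ∈ (Y i).cells, mono l a (boxWeight (foot i p)) ^ (-n) := by
    intro i
    rw [footChar, pairing_sum _ _ _ fun _ _ => finite_support_single _]
    exact Finset.sum_congr rfl fun v _ => pairing_single _ _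
  have hover : pairing (fun w => mono l a w ^ (-n)) (overlapChar Y)
      = ∑ i, ∑ v ∈ (finite_inter Y i).toFinset, mono l a (boxWeight v) ^ (-n)
        - ∑ v ∈ (finite_triple Y).toFinset, mono l a (boxWeight v) ^ (-n) := by
    have h1 : ∀ s : Finset Box, (support (∑ v ∈ s, single (boxWeight v))).Finite :=
      fun s => finite_support_sum _ _ fun _ _ => finite_support_single _
    rw [overlapChar, pairing_sub _ (finite_support_sum _ _ fun _ _ => h1 _) (h1 _),
      pairing_sum _ _ _ fun _ _ => h1 _, hsum]
    simp only [hsum]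
  -- The regularized leg contributes the sum `1 / (1 - q_i^(-n))` of a geometric series over each
  -- foot; over the common denominator this leaves the two factors found in `yChar_eq`.
  have hleg : ∀ i, (∑ p ∈ (Y i).cells, rescale (logChi l a (foot i p)) (expS l (a.succAbove i)))
      (.osc n) = pairing (fun w => mono l a w ^ (-n)) (footChar Y i)
        * (1 - q l (a.succAbove i) ^ (-n))⁻¹ := by
    intro i
    rw [hfoot, Finset.sum_apply, Finset.sum_mul]
    refine Finset.sum_congr rfl fun p _ => ?_
    rw [rescale, exp_neg_mul_logChi, expS]
  have hA : ∀ v, rescale (logChi l a v) expA (.osc n) = mono l a (boxWeight v) ^ (-n) := by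
    intro v
    rw [rescale, exp_neg_mul_logChi, expA, mul_one]
  rw [pairing_yChar (fun u v => mono_zpow_add _ u v), chSet_finset, hsum, hover, expLambda, expHW]
  simp only [Pi.sub_apply, Pi.add_apply, Finset.sum_apply (Mode.osc n) Finset.univ, hleg]
  simp only [Finset.sum_apply, hA, mono_zero, one_zpow, mono_wt, Fin.prod_univ_three,
    Fin.sum_univ_three (f := fun i => pairing _ (footChar Y i) * _),
    Fin.sum_univ_three (f := fun i : Fin 3 => _ * (_ * pairing _ (footChar Y i))), expW]
  have h0 := hQ 0
  have h1 := hQ 1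
  have h2 := hQ 2
  simp only [show (0 : Fin 3) + 1 = 1 from rfl, show (0 : Fin 3) + 2 = 2 from rfl,
    show (1 : Fin 3) + 1 = 2 from rfl, show (1 : Fin 3) + 2 = 0 from rfl,
    show (2 : Fin 3) + 1 = 0 from rfl, show (2 : Fin 3) + 2 = 1 from rfl]
  field_simp
  ring

theorem expLambda_zeroModes (L : ℂ) (π : PP Y) :
    expLambda l a L Y π .logs = -l a ∧ expLambda l a L Y π .s = -l a * L ∧
      expLambda l a L Y π .dt = -l a := by
  refine ⟨?_, ?_, ?_⟩ <;> simp [expLambda, expHW, Finset.sum_apply, rescale, expA, expS, expW]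

/-- Adding a box changes the exponent by that of `A⁻¹`. -/
theorem expLambda_insert (L : ℂ) {π π' : PP Y} {v : Box} (hv : v ∉ π.1)
    (h : π'.1 = insert v π.1) :
    expLambda l a L Y π' = expLambda l a L Y π - rescale (logChi l a v) expA := by
  rw [expLambda, expLambda, h, Finset.sum_insert hv]
  abel

/-- The oscillator part of the exponent of `S_a(q_a^k x')`. -/
def screeningOsc (l : Fin 4 → ℂ) (a : Fin 4) (k : ℤ) (n : ℤ) : ℂ :=
  q l a ^ (-(n * k)) * (1 - q l a ^ (-n))⁻¹

theorem rescale_expS_osc (k n : ℤ) :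
    rescale (k * l a) (expS l a) (.osc n) = screeningOsc l a k n := by
  rw [rescale, screeningOsc, expS]
  congr 1
  rw [q, ← Complex.exp_int_mul]
  congr 1
  push_cast
  ring

theorem prod_succAbove_zpow (hprod : ∏ i, q l i = 1) (n : ℤ) :
    ∏ i, q l (a.succAbove i) ^ n = q l a ^ (-n) := by
  rw [Fin.prod_univ_succAbove _ a] at hprod
  rw [Finset.prod_zpow, zpow_neg, ← inv_zpow, ← eq_inv_of_mul_eq_one_right hprod]

/-- The contraction factor `[a_n, a_{-n}] / ∏ (1 - q^{-n}) / (1 - q_a^n)`. -/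
theorem contraction_factor (hprod : ∏ i, q l i = 1) (hnd : ∀ w, mono l a w = 1 → w = 0)
    {n : ℤ} (hn : n ≠ 0) :
    (∏ i, (1 - q l (a.succAbove i) ^ (-n)))⁻¹ * (1 - q l a ^ n)⁻¹ * bracket l n
      = q l a ^ (-n) / n := by
  have h1 := one_sub_q_self_zpow_ne_zero hprod hnd hn
  -- Three reflections give the sign `-1`, which cancels the sign of the bracket, and the product of
  -- the three parameters is `q_a⁻¹`.
  have h2 : ∏ i, (1 - q l (a.succAbove i) ^ n)
      = -q l a ^ (-n) * ∏ i, (1 - q l (a.succAbove i) ^ (-n)) := by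
    have h3 : ∀ i, 1 - q l (a.succAbove i) ^ n
        = -(q l (a.succAbove i) ^ n) * (1 - q l (a.succAbove i) ^ (-n)) := by
      intro i
      have := zpow_ne_zero n (q_ne_zero l (a.succAbove i))
      rw [zpow_neg]
      field_simp
      ring
    rw [Finset.prod_congr rfl fun i _ => h3 i, Finset.prod_mul_distrib, Finset.prod_neg,
      prod_succAbove_zpow hprod]
    norm_num
  have h3 : ∏ i, (1 - q l (a.succAbove i) ^ (-n)) ≠ 0 :=
    Finset.prod_ne_zero_iff.2 fun i _ => one_sub_q_zpow_ne_zero hnd i (neg_ne_zero.2 hn)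
  have h4 : (n : ℂ) ≠ 0 := by exact_mod_cast hn
  rw [bracket, Fin.prod_univ_succAbove _ a, h2]
  field_simp

/-- The point at which `Λ_π(x)` and `S_a(q_a^k x')` have a pole, for the weight `w`. -/
def polePoint (l : Fin 4 → ℂ) (a : Fin 4) (k : ℤ) (w : Fin 3 → ℤ) : ℂ :=
  mono l a (w + (1 - k) • wta)

theorem polePoint_ne_zero (k : ℤ) (w : Fin 3 → ℤ) : polePoint l a k w ≠ 0 := mono_ne_zero l a _

theorem polePoint_eq (hprod : ∏ i, q l i = 1) (k : ℤ) (w : Fin 3 → ℤ) :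
    polePoint l a k w = mono l a w * q l a ^ (1 - k) := by
  rw [polePoint, mono_add, mono_zsmul, mono_wta hprod]

theorem polePoint_injective (hnd : ∀ w, mono l a w = 1 → w = 0) (k : ℤ) :
    Function.Injective (polePoint l a k) := fun _ _ h =>
  add_right_cancel (mono_injective hnd h)

theorem polePoint_div (k : ℤ) (w u : Fin 3 → ℤ) :
    polePoint l a k w / polePoint l a k u = mono l a w / mono l a u := by
  rw [polePoint, polePoint, ← mono_sub, ← mono_sub, add_sub_add_right_eq_sub]

/-- The weights at which `Λ_π(x)` and the screening current have poles. -/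
def poles (π : PP Y) : Finset (Fin 3 → ℤ) :=
  (finite_support_yChar Y π.1).toFinset.filter fun w => yChar Y π.1 w = 1

theorem mem_poles (π : PP Y) (w : Fin 3 → ℤ) : w ∈ poles π ↔ yChar Y π.1 w = 1 := by
  rw [poles, Finset.mem_filter, Set.Finite.mem_toFinset, Function.mem_support]
  exact ⟨fun h => h.2, fun h => ⟨by rw [h]; exact one_ne_zero, h⟩⟩

theorem sum_yChar (π : PP Y) : ∑ w ∈ (finite_support_yChar Y π.1).toFinset, yChar Y π.1 w = 1 := by
  have h := pairing_one_yChar Y π.1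
  rw [pairing_eq_sum _ (s := (finite_support_yChar Y π.1).toFinset) (by simp)] at h
  simpa using h

/-- `S_a Λ_π` and `Λ_π S_a` have expansions of the same rational function. -/
theorem contraction_screening_expLambda (hprod : ∏ i, q l i = 1)
    (hnd : ∀ w, mono l a w = 1 → w = 0) (L : ℂ) (π : PP Y) (k : ℤ) (i : ℕ) :
    contraction l (screeningOsc l a k) (fun n => expLambda l a L Y π (.osc n)) i
      = ∑ w ∈ poles π, residueAt l a (yChar Y π.1) w * polePoint l a k w ^ (i : ℤ) := by
  have hs : support (yChar Y π.1) ⊆ (finite_support_yChar Y π.1).toFinset := by simp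
  have hlog : contractionLog l (screeningOsc l a k) (fun n => expLambda l a L Y π (.osc n))
      = tailSeries fun n => (∑ w ∈ (finite_support_yChar Y π.1).toFinset,
          (yChar Y π.1 w : ℂ) * polePoint l a k w ^ n) / n := by
    ext n
    rw [contractionLog, coeff_tailSeries, coeff_tailSeries]
    split_ifs with hn
    · rfl
    have hn' : (n : ℤ) ≠ 0 := by exact_mod_cast hn
    have hf := contraction_factor hprod hnd (neg_ne_zero.2 hn')
    -- Oddness of the bracket is extracted from the antisymmetry of the commutator, evaluated on the
    -- vacuum vector `1`.
    have hb : bracket l (-(n : ℤ)) = -bracket l n := by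
      have := heis_commutator l n (-n) hn' (neg_ne_zero.2 hn') hprod
      have h' := heis_commutator l (-n) n (neg_ne_zero.2 hn') hn' hprod
      rw [add_neg_cancel, if_pos rfl] at this
      rw [neg_add_cancel, if_pos rfl, ← neg_sub, this] at h'
      have h'' := LinearMap.congr_fun h' 1
      simp only [LinearMap.neg_apply, LinearMap.smul_apply, Module.End.one_apply] at h''
      rw [← neg_smul] at h''
      have := smul_left_injective ℂ (one_ne_zero : (1 : Fock) ≠ 0) h''
      exact this.symm
    rw [hb, neg_neg] at hf
    rw [expLambda_osc hnd L π (neg_ne_zero.2 hn'), pairing_eq_sum _ hs, screeningOsc, neg_neg]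
    rw [show ∑ w ∈ (finite_support_yChar Y π.1).toFinset, (yChar Y π.1 w : ℂ) *
        polePoint l a k w ^ n = q l a ^ ((1 - k) * n) * ∑ w ∈ (finite_support_yChar Y π.1).toFinset,
        (yChar Y π.1 w : ℂ) * mono l a w ^ (n : ℤ) by
      rw [Finset.mul_sum]
      refine Finset.sum_congr rfl fun w _ => ?_
      rw [polePoint_eq hprod, mul_pow, zpow_mul, zpow_natCast, zpow_natCast]
      ring]
    have e1 : q l a ^ ((1 - k) * (n : ℤ)) = q l a ^ (-((n : ℤ) * k)) * q l a ^ (n : ℤ) := by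
      rw [← zpow_add₀ (q_ne_zero l a)]
      congr 1
      ring
    rw [e1]
    set T := ∑ w ∈ (finite_support_yChar Y π.1).toFinset, (yChar Y π.1 w : ℂ) * mono l a w ^ (n : ℤ)
    push_cast at hf
    linear_combination (-(q l a ^ (-((n : ℤ) * k)) * T)) * hf
  rw [contraction, hlog, coeff_expSeries_partialFraction _ _ _ (fun w _ => polePoint_ne_zero k w)
    ((polePoint_injective hnd k).injOn) (fun w _ => yChar_le_one π w) (by rw [sum_yChar]; norm_num)]
  refine Finset.sum_congr rfl fun w hw => ?_
  rw [residueAt_eq_prod hs, zpow_natCast]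
  simp only [polePoint_div]
  congr!

/-- Substituting `z → 1/z` extracts a factor `-w/u` from each term. Their product is `u⁻¹`, because
the total multiplicity is `1` and the signed product is `-1`. -/
theorem residueAt_inversion (π : PP Y) {u : Fin 3 → ℤ}
    (hu : yChar Y π.1 u = 1) :
    mono l a u * ∏ w ∈ (finite_support_yChar Y π.1).toFinset.erase u,
      (1 - mono l a u / mono l a w) ^ (-yChar Y π.1 w) = residueAt l a (yChar Y π.1) u := by
  have hs : support (yChar Y π.1) ⊆ (finite_support_yChar Y π.1).toFinset := by simp
  have hus : u ∈ (finite_support_yChar Y π.1).toFinset := by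
    rw [Set.Finite.mem_toFinset, Function.mem_support, hu]
    exact one_ne_zero
  have h1 := signedProd_shiftBy (l := l) (a := a) (finite_support_yChar Y π.1) (-u)
  rw [signedProd, mulPairing_shiftBy, mulPairing_eq_prod _ hs, signedProd_yChar,
    pairing_one_yChar, zpow_one, mono_neg, ← Finset.mul_prod_erase _ _ hus, hu] at h1
  simp only [add_neg_cancel, mono_zero, zpow_one] at h1
  have h2 : ∏ w ∈ (finite_support_yChar Y π.1).toFinset.erase u,
      (-mono l a (w + -u)) ^ yChar Y π.1 w = (mono l a u)⁻¹ := by linear_combination -h1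
  rw [residueAt_eq_prod hs]
  have h3 : ∏ w ∈ (finite_support_yChar Y π.1).toFinset.erase u,
      (1 - mono l a u / mono l a w) ^ (-yChar Y π.1 w)
      = (∏ w ∈ (finite_support_yChar Y π.1).toFinset.erase u,
          (-mono l a (w + -u)) ^ yChar Y π.1 w)
        * ∏ w ∈ (finite_support_yChar Y π.1).toFinset.erase u,
          (1 - mono l a w / mono l a u) ^ (-yChar Y π.1 w) := by
    rw [← Finset.prod_mul_distrib]
    refine Finset.prod_congr rfl fun w _ => ?_
    have e1 := mono_ne_zero l a w
    have e2 := mono_ne_zero l a u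
    rw [← inv_zpow', ← inv_zpow', ← mul_zpow, ← sub_eq_add_neg, mono_sub]
    congr 1
    have e3 : 1 - mono l a u / mono l a w
        = -(mono l a w / mono l a u)⁻¹ * (1 - mono l a w / mono l a u) := by
      field_simp
      ring
    rw [e3, mul_inv, inv_neg, inv_inv]
  rw [h3, h2, mul_inv_cancel_left₀ (mono_ne_zero l a u)]

/-- The poles are inverse to those of the opposite order. The factor `q_a^(k-1)` is the ratio of the
weight to the pole point, and with it the residues become those of the opposite order. -/
theorem contraction_expLambda_screening (hprod : ∏ i, q l i = 1)
    (hnd : ∀ w, mono l a w = 1 → w = 0) (L : ℂ) (π : PP Y) (k : ℤ) (i : ℕ) :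
    q l a ^ (k - 1) * contraction l (fun n => expLambda l a L Y π (.osc n)) (screeningOsc l a k) i
      = ∑ w ∈ poles π, residueAt l a (yChar Y π.1) w * polePoint l a k w ^ (-((i : ℤ) + 1)) := by
  have hs : support (yChar Y π.1) ⊆ (finite_support_yChar Y π.1).toFinset := by simp
  have hlog : contractionLog l (fun n => expLambda l a L Y π (.osc n)) (screeningOsc l a k)
      = tailSeries fun n => (∑ w ∈ (finite_support_yChar Y π.1).toFinset,
          (yChar Y π.1 w : ℂ) * (polePoint l a k w)⁻¹ ^ n) / n := by
    ext n
    rw [contractionLog, coeff_tailSeries, coeff_tailSeries]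
    split_ifs with hn
    · rfl
    have hn' : (n : ℤ) ≠ 0 := by exact_mod_cast hn
    have hf := contraction_factor hprod hnd hn'
    rw [expLambda_osc hnd L π hn', pairing_eq_sum _ hs, screeningOsc, neg_neg]
    rw [show ∑ w ∈ (finite_support_yChar Y π.1).toFinset, (yChar Y π.1 w : ℂ) *
        (polePoint l a k w)⁻¹ ^ n = q l a ^ ((k - 1) * n) *
        ∑ w ∈ (finite_support_yChar Y π.1).toFinset,
        (yChar Y π.1 w : ℂ) * mono l a w ^ (-(n : ℤ)) by
      rw [Finset.mul_sum]
      refine Finset.sum_congr rfl fun w _ => ?_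
      rw [polePoint_eq hprod, mul_inv, ← zpow_neg, neg_sub, mul_pow, zpow_mul,
        zpow_neg (mono l a w), zpow_natCast, zpow_natCast, inv_pow]
      ring]
    have e1 : q l a ^ ((k - 1) * (n : ℤ)) = q l a ^ (-(-(n : ℤ) * k)) * q l a ^ (-(n : ℤ)) := by
      rw [← zpow_add₀ (q_ne_zero l a)]
      congr 1
      ring
    rw [e1]
    set T := ∑ w ∈ (finite_support_yChar Y π.1).toFinset, (yChar Y π.1 w : ℂ) *
      mono l a w ^ (-(n : ℤ))
    push_cast at hf
    linear_combination (q l a ^ (-(-(n : ℤ) * k)) * T) * hf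
  rw [contraction, hlog, coeff_expSeries_partialFraction _ _ _
    (fun w _ => inv_ne_zero (polePoint_ne_zero k w))
    ((inv_injective.comp (polePoint_injective hnd k)).injOn) (fun w _ => yChar_le_one π w)
    (by rw [sum_yChar]; norm_num), Finset.mul_sum]
  refine Finset.sum_congr rfl fun w hw => ?_
  have hw1 : yChar Y π.1 w = 1 := (Finset.mem_filter.1 hw).2
  rw [← residueAt_inversion π hw1]
  simp only [inv_div_inv, polePoint_div]
  have h0 := polePoint_ne_zero (l := l) (a := a) k w
  have h1 : mono l a w = polePoint l a k w * q l a ^ (k - 1) := by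
    rw [polePoint_eq hprod, mul_assoc, ← zpow_add₀ (q_ne_zero l a)]
    simp
  rw [neg_add, zpow_add₀ h0, zpow_neg, zpow_natCast, inv_pow]
  rw [show ∀ A B : ℂ, mono l a w * A * (B * polePoint l a k w ^ (-1 : ℤ))
    = mono l a w * polePoint l a k w ^ (-1 : ℤ) * A * B by intros; ring]
  have h2 : mono l a w * polePoint l a k w ^ (-1 : ℤ) = q l a ^ (k - 1) := by
    rw [h1, zpow_neg_one]
    field_simp
  rw [h2]
  rw [mul_assoc]
  congr!

end Exponents

/-! ### The commutator of a single term with the screening current. -/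

section Commutator

variable {l : Fin 4 → ℂ} {a : Fin 4} {Y : Fin 3 → YoungDiagram}

theorem oscMode_congr {φ ψ : ℤ → ℂ} (h : ∀ n ≠ 0, φ n = ψ n) (k : ℤ) :
    oscMode l φ k = oscMode l ψ k := by
  have h1 : creation φ = creation ψ := by
    have h0 : (fun n : ℕ => if n = 0 then 0 else
          (MvPolynomial.C (φ (-(n : ℤ))) * MvPolynomial.X n.toPNat' : Fock))
        = fun n : ℕ => if n = 0 then 0 else
          MvPolynomial.C (ψ (-(n : ℤ))) * MvPolynomial.X n.toPNat' := by
      funext n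
      by_cases hn : n = 0
      · rw [if_pos hn, if_pos hn]
      · rw [if_neg hn, if_neg hn, h _ (neg_ne_zero.2 (Nat.cast_ne_zero.2 hn))]
    funext j
    rw [creation, creation, h0]
  have h2 : annihilation l φ = annihilation l ψ := by
    have h0 : (fun n : ℕ+ => Polynomial.monomial (n : ℕ)
          (MvPolynomial.C (φ (n : ℕ) * bracket l (n : ℕ)) : Fock))
        = fun n : ℕ+ => Polynomial.monomial (n : ℕ)
          (MvPolynomial.C (ψ (n : ℕ) * bracket l (n : ℕ))) :=
      funext fun n => by rw [h _ (Nat.cast_ne_zero.2 n.ne_zero)]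
    refine MvPolynomial.algHom_ext fun n => ?_
    rw [annihilation, annihilation, MvPolynomial.aeval_X, MvPolynomial.aeval_X]
    exact congrArg _ (congrFun h0 n)
  rw [oscMode, oscMode, h1, h2]

theorem vertexCoeff_apply (φ : Exponent) (f : Space) {γ : ℂ} {z : ℂ × ℂ} {k : ℤ}
    (h : γ = φ .logt * z.1 + φ .logs * z.2 + k) :
    vertexCoeff l φ γ f z = Complex.exp (φ .t * z.1 + φ .s * z.2) •
      oscMode l (fun n => φ (.osc n)) k (f (z.1 + φ .dt, z.2 + φ .ds)) := by
  have hex : ∃ k : ℤ, γ = φ .logt * z.1 + φ .logs * z.2 + k := ⟨k, h⟩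
  have hk : hex.choose = k := by
    have h0 := h.symm.trans hex.choose_spec
    exact_mod_cast (add_left_cancel h0).symm
  change (if h : ∃ k : ℤ, γ = φ .logt * z.1 + φ .logs * z.2 + k then _ else _) = _
  rw [dif_pos hex, hk]

theorem vertexCoeff_apply_eq_zero (φ : Exponent) (f : Space) {γ : ℂ} {z : ℂ × ℂ}
    (h : ¬ ∃ k : ℤ, γ = φ .logt * z.1 + φ .logs * z.2 + k) : vertexCoeff l φ γ f z = 0 :=
  dif_neg h

/-- The entry `.osc 0` never enters an operator. It must be exempted because the exponents compared
in `poleTerm_insert` differ there. -/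
theorem vertexCoeff_congr {φ ψ : Exponent} (h : ∀ m, m ≠ .osc 0 → φ m = ψ m) (γ : ℂ) :
    vertexCoeff l φ γ = vertexCoeff l ψ γ := by
  refine LinearMap.ext fun f => funext fun z => ?_
  have e1 := h .logt (by simp)
  have e2 := h .logs (by simp)
  by_cases hk : ∃ k : ℤ, γ = φ .logt * z.1 + φ .logs * z.2 + k
  · obtain ⟨k, hk⟩ := hk
    rw [vertexCoeff_apply φ f hk, vertexCoeff_apply ψ f (by rwa [← e1, ← e2]), h .t (by simp),
      h .s (by simp), h .dt (by simp), h .ds (by simp),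
      oscMode_congr (ψ := fun n => ψ (.osc n)) fun n hn => h (.osc n) (by simpa using hn)]
  · rw [vertexCoeff_apply_eq_zero φ f hk, vertexCoeff_apply_eq_zero ψ f (by rwa [← e1, ← e2])]

/-- The exponent of `:Λ_π(x) S_a(q_a^k x'):` at `x' = r x`, without the power of `x'`. -/
def mergedExp (l : Fin 4 → ℂ) (a : Fin 4) (L : ℂ) (Y : Fin 3 → YoungDiagram) (π : PP Y) (k : ℤ)
    (r : ℂ) : Exponent
  | .osc n => expLambda l a L Y π (.osc n) + r ^ (-n) * screeningOsc l a k n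
  | .t => expLambda l a L Y π .t - k
  | .ds => expLambda l a L Y π .ds - (l a)⁻¹
  | m => expLambda l a L Y π m

theorem log_q_ne_zero (hprod : ∏ i, q l i = 1) (hnd : ∀ w, mono l a w = 1 → w = 0) : l a ≠ 0 := by
  intro h
  have := one_sub_q_self_zpow_ne_zero hprod hnd one_ne_zero
  rw [q, h] at this
  simp at this

theorem screening_apply (hl : l a ≠ 0) (k : ℤ) (f : Space) {α : ℂ} {z : ℂ × ℂ} {n : ℤ}
    (h : α = -(l a)⁻¹ * z.1 + n) :
    screening l a k α f z = Complex.exp (-k * z.1) •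
      oscMode l (screeningOsc l a k) n (f (z.1, z.2 - (l a)⁻¹)) := by
  rw [screening, vertexCoeff_apply (k := n)]
  · simp only [rescale_expS_osc]
    simp only [rescale, expS, add_zero, zero_mul, mul_zero, zero_add, ← sub_eq_add_neg]
    congr 3
    field_simp
  · simp only [rescale, expS]
    rw [h]
    ring

theorem screening_apply_eq_zero (k : ℤ) (f : Space) {α : ℂ} {z : ℂ × ℂ}
    (h : ¬ ∃ n : ℤ, α = -(l a)⁻¹ * z.1 + n) : screening l a k α f z = 0 := by
  refine vertexCoeff_apply_eq_zero _ f ?_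
  rintro ⟨n, hn⟩
  refine h ⟨n, ?_⟩
  simp only [rescale, expS] at hn
  rw [hn]
  ring

/-- Moving the screening current's translation of `t̃` through the zero mode of `W` costs `exp L`.
Its minus sign turns the difference of the two products into the sum handled by `oscMode_exchange`.
-/
theorem exp_expLambda_s (hl : l a ≠ 0) {L : ℂ} (hL : Complex.exp L = -q l a) (π : PP Y) (c : ℂ)
    (s : ℂ) : Complex.exp (c + expLambda l a L Y π .s * (s - (l a)⁻¹))
      = -q l a * Complex.exp (c + expLambda l a L Y π .s * s) := by
  rw [← hL, ← Complex.exp_add, (expLambda_zeroModes L π).2.1]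
  congr 1
  field_simp
  ring

/-- The commutator of `Λ_π(x)` and `S_a(q_a^k x')` is a sum of delta functions. -/
theorem commutator_expLambda_screening (hprod : ∏ i, q l i = 1)
    (hnd : ∀ w, mono l a w = 1 → w = 0) {L : ℂ} (hL : Complex.exp L = -q l a) (π : PP Y) (k : ℤ)
    (γ : ℂ) {α : ℂ} (f : Space) {z : ℂ × ℂ} {n : ℤ} (h : α = -(l a)⁻¹ * z.1 + n) :
    (vertexCoeff l (expLambda l a L Y π) γ * screening l a k α
      - screening l a k α * vertexCoeff l (expLambda l a L Y π) γ) f z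
      = ∑ w ∈ poles π, (q l a * residueAt l a (yChar Y π.1) w * polePoint l a k w ^ (-n)) •
          vertexCoeff l (mergedExp l a L Y π k (polePoint l a k w)) (γ + n - 1) f z := by
  have hl := log_q_ne_zero hprod hnd
  obtain ⟨hlogs, -, hdt⟩ := expLambda_zeroModes (l := l) (a := a) L π
  rw [LinearMap.sub_apply, Module.End.mul_apply, Module.End.mul_apply, Pi.sub_apply,
    screening_apply hl k _ h]
  by_cases hm : ∃ m : ℤ, γ = expLambda l a L Y π .logt * z.1 + expLambda l a L Y π .logs * z.2 + m
  · obtain ⟨m, hm⟩ := hm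
    -- Each operator translates the variable that multiplies the logarithm in the other, by `-log
    -- q_a` and `-1/log q_a`; so in either order the mode index of the inner operator drops by
    -- exactly `1`.
    rw [vertexCoeff_apply _ _ hm, screening_apply hl k (n := n - 1),
      vertexCoeff_apply (k := m - 1) _ _ (z := (z.1, z.2 - (l a)⁻¹)), exp_expLambda_s hl hL]
    · have hex := oscMode_exchange l (fun n => expLambda l a L Y π (.osc n)) (screeningOsc l a k)
        (q l a ^ (k - 1)) (poles π) (residueAt l a (yChar Y π.1)) (polePoint l a k)
        (fun w _ => polePoint_ne_zero k w) (contraction_expLambda_screening hprod hnd L π k)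
        (contraction_screening_expLambda hprod hnd L π k) m n
        (f (z.1 + expLambda l a L Y π .dt, z.2 + expLambda l a L Y π .ds - (l a)⁻¹))
      have hV : ∀ w, vertexCoeff l (mergedExp l a L Y π k (polePoint l a k w)) (γ + n - 1) f z
          = (Complex.exp (-k * z.1) *
              Complex.exp (expLambda l a L Y π .t * z.1 + expLambda l a L Y π .s * z.2)) •
            oscMode l (fun n => expLambda l a L Y π (.osc n)
              + polePoint l a k w ^ (-n) * screeningOsc l a k n) (m + n - 1)
              (f (z.1 + expLambda l a L Y π .dt, z.2 + expLambda l a L Y π .ds - (l a)⁻¹)) := by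
        intro w
        rw [vertexCoeff_apply (k := m + n - 1)]
        · simp only [mergedExp]
          rw [← Complex.exp_add, ← add_sub_assoc]
          congr 2
          ring
        · simp only [mergedExp]
          rw [hm]
          push_cast
          ring
      simp only [hV]
      simp only [mul_smul, map_smul]
      rw [show ∀ g : (Fin 3 → ℤ) → Fock, ∑ w ∈ poles π, q l a • residueAt l a (yChar Y π.1) w •
          polePoint l a k w ^ (-n) • Complex.exp (-k * z.1) • Complex.exp
          (expLambda l a L Y π .t * z.1 + expLambda l a L Y π .s * z.2) • g w
          = (q l a * Complex.exp (-k * z.1) * Complex.exp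
          (expLambda l a L Y π .t * z.1 + expLambda l a L Y π .s * z.2)) • ∑ w ∈ poles π,
          (residueAt l a (yChar Y π.1) w * polePoint l a k w ^ (-n)) • g w by
        intro g
        rw [Finset.smul_sum]
        refine Finset.sum_congr rfl fun w _ => ?_
        simp only [smul_smul]
        congr 1
        ring, ← hex]
      -- The translation of `t` produces `q_a^k`: one factor `q_a` matches that of the other order,
      -- and the rest is the prefactor `q_a^(k-1)` of the contraction.
      have hk : Complex.exp (-k * (z.1 + expLambda l a L Y π .dt))
          = q l a * q l a ^ (k - 1) * Complex.exp (-k * z.1) := by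
        rw [hdt, ← zpow_one_add₀ (q_ne_zero l a), add_sub_cancel, q, ← Complex.exp_int_mul,
          ← Complex.exp_add]
        congr 1
        ring
      rw [hk, show z.2 - (l a)⁻¹ + expLambda l a L Y π .ds
        = z.2 + expLambda l a L Y π .ds - (l a)⁻¹ by ring]
      module
    · rw [hm, hlogs]
      push_cast
      field_simp
      ring
    · rw [h, hdt]
      push_cast
      field_simp
      ring
  · rw [vertexCoeff_apply_eq_zero _ _ hm, vertexCoeff_apply_eq_zero, map_zero, smul_zero, sub_zero,
      Finset.sum_eq_zero]
    · intro w _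
      rw [vertexCoeff_apply_eq_zero, smul_zero]
      rintro ⟨m, hm'⟩
      simp only [mergedExp] at hm'
      refine hm ⟨m + 1 - n, ?_⟩
      push_cast
      linear_combination hm'
    · rintro ⟨m, hm'⟩
      refine hm ⟨m + 1, ?_⟩
      rw [hm', hlogs]
      push_cast
      field_simp
      ring

/-- A finite sum of delta functions at points `ρ i`. -/
theorem hasDeltaExpansion_sum {ι : Type*} (I : Finset ι) (ρ : ι → ℂˣ)
    (b : ι → ℂ → Module.End ℂ Space) {c : ℂ} {B : ℂ → ℂ → Module.End ℂ Space}
    (h : ∀ γ α f z, ∀ n : ℤ, α = c * z.1 + n →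
      B γ α f z = ∑ i ∈ I, ((ρ i : ℂ) ^ (-n)) • b i (γ + n) f z)
    (h0 : ∀ γ α f z, (¬ ∃ n : ℤ, α = c * z.1 + n) → B γ α f z = 0) :
    HasDeltaExpansion c B fun r => ∑ i ∈ I, if ρ i = r then b i else 0 := by
  have hsupp : Function.support (fun r => ∑ i ∈ I, if ρ i = r then b i else 0)
      ⊆ (I.image ρ : Finset ℂˣ) := by
    intro r hr
    by_contra hr'
    refine hr (Finset.sum_eq_zero fun i hi => if_neg fun h => hr' ?_)
    exact Finset.mem_coe.2 (Finset.mem_image.2 ⟨i, hi, h⟩)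
  refine ⟨(Finset.finite_toSet _).subset hsupp, fun γ α f z => ⟨fun n hn => ?_, h0 γ α f z⟩⟩
  rw [h γ α f z n hn, finsum_eq_sum_of_support_subset (s := I.image ρ)]
  · simp only [Finset.sum_apply, LinearMap.sum_apply, Finset.smul_sum]
    rw [Finset.sum_comm]
    refine Finset.sum_congr rfl fun i hi => ?_
    rw [Finset.sum_eq_single (ρ i), if_pos rfl]
    · intro r _ hr
      rw [if_neg hr.symm]
      simp
    · exact fun h => absurd (Finset.mem_image_of_mem ρ hi) h
  · intro r hr
    refine hsupp fun h => hr ?_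
    change ((r : ℂ) ^ (-n)) • (∑ i ∈ I, if ρ i = r then b i else 0) (γ + n) f z = 0
    rw [show (∑ i ∈ I, if ρ i = r then b i else 0) = 0 from h]
    simp

end Commutator

/-! ### Cancellation of poles and the telescoping sum. -/

section Cancellation

variable {l : Fin 4 → ℂ} {a : Fin 4} {Y : Fin 3 → YoungDiagram}

/-- The contribution to the commutator of the pole of `Λ_π` at the weight `w`. -/
def poleTerm (l : Fin 4 → ℂ) (a : Fin 4) (L : ℂ) (Y : Fin 3 → YoungDiagram) (k : ℤ)
    (i : (_ : PP Y) × (Fin 3 → ℤ)) (γ : ℂ) : Module.End ℂ Space :=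
  (Z l a Y i.1 * q l a * residueAt l a (yChar Y i.1.1) i.2) •
    vertexCoeff l (mergedExp l a L Y i.1 k (polePoint l a k i.2)) (γ - 1)

/-- The poles of the terms with `N` boxes. -/
def polesOfSize (Y : Fin 3 → YoungDiagram) (N : ℤ) : Finset ((_ : PP Y) × (Fin 3 → ℤ)) :=
  (finite_size Y N).toFinset.sigma poles

theorem mem_polesOfSize {N : ℤ} {i : (_ : PP Y) × (Fin 3 → ℤ)} :
    i ∈ polesOfSize Y N ↔ (i.1.1.card : ℤ) = N ∧ yChar Y i.1.1 i.2 = 1 := by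
  rw [polesOfSize, Finset.mem_sigma, Set.Finite.mem_toFinset, mem_poles, Set.mem_ofPred_eq]

/-- `polePoint` as a unit. -/
def poleUnit (l : Fin 4 → ℂ) (a : Fin 4) (k : ℤ) (w : Fin 3 → ℤ) : ℂˣ :=
  Units.mk0 (polePoint l a k w) (polePoint_ne_zero k w)

theorem commutator_sum_smul_apply {ι R ζ N : Type*} [CommRing R] [AddCommGroup N] [Module R N]
    (s : Finset ι) (c : ι → R) (V : ι → Module.End R (ζ → N)) (S : Module.End R (ζ → N))
    (f : ζ → N) (z : ζ) :
    ((∑ i ∈ s, c i • V i) * S - S * ∑ i ∈ s, c i • V i) f z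
      = ∑ i ∈ s, c i • (V i * S - S * V i) f z := by
  simp [LinearMap.sum_apply, Finset.sum_apply, smul_sub]

theorem hasDeltaExpansion_commutatorTerm (hprod : ∏ i, q l i = 1)
    (hnd : ∀ w, mono l a w = 1 → w = 0) {L : ℂ} (hL : Complex.exp L = -q l a) (M k : ℤ) :
    HasDeltaExpansion (-(l a)⁻¹) (commutatorTerm l a L Y M k) fun r =>
      ∑ i ∈ polesOfSize Y (M - k), if poleUnit l a k i.2 = r then poleTerm l a L Y k i else 0 := by
  have key : ∀ γ α f z, commutatorTerm l a L Y M k γ α f z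
      = ∑ π ∈ (finite_size Y (M - k)).toFinset, Z l a Y π •
        (vertexCoeff l (expLambda l a L Y π) γ * screening l a k α
          - screening l a k α * vertexCoeff l (expLambda l a L Y π) γ) f z := by
    intro γ α f z
    exact commutator_sum_smul_apply _ _ _ _ f z
  apply hasDeltaExpansion_sum (polesOfSize Y (M - k)) (fun i => poleUnit l a k i.2)
    (poleTerm l a L Y k)
  · intro γ α f z n hn
    rw [key, polesOfSize, Finset.sum_sigma]
    refine Finset.sum_congr rfl fun π _ => ?_
    rw [commutator_expLambda_screening hprod hnd hL π k γ f hn, Finset.smul_sum]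
    refine Finset.sum_congr rfl fun w _ => ?_
    rw [poleTerm, LinearMap.smul_apply, Pi.smul_apply, smul_smul, smul_smul, poleUnit,
      Units.val_mk0]
    congr 1
    ring
  · intro γ α f z h
    rw [key]
    refine Finset.sum_eq_zero fun π _ => ?_
    rw [LinearMap.sub_apply, Module.End.mul_apply, Module.End.mul_apply, Pi.sub_apply,
      screening_apply_eq_zero k _ h, sub_zero]
    by_cases hm : ∃ m : ℤ, γ = expLambda l a L Y π .logt * z.1
        + expLambda l a L Y π .logs * z.2 + m
    · obtain ⟨m, hm⟩ := hm
      have hl := log_q_ne_zero hprod hnd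
      rw [vertexCoeff_apply _ _ hm, screening_apply_eq_zero, map_zero, smul_zero, smul_zero]
      rintro ⟨n, hn⟩
      refine h ⟨n + 1, ?_⟩
      rw [hn, (expLambda_zeroModes L π).2.2]
      push_cast
      field_simp
      ring
    · rw [vertexCoeff_apply_eq_zero _ _ hm, smul_zero]

/-- The pole comes from a box that can be added. -/
def IsAddablePole (i : (_ : PP Y) × (Fin 3 → ℤ)) : Prop :=
  ∃ v, boxWeight v = i.2 ∧ IsAddable i.1.config v

/-- If `v + (1, 1, 1)` were addable, then `v + (0, 1, 1)` would be a box above the maximal box `v`.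
So the two kinds of poles never share a weight. -/
theorem not_isAddablePole_of_isCorner {π : PP Y} {v : Box} (h : IsCorner π.config v) :
    ¬ IsAddablePole (⟨π, boxWeight v - wta⟩ : (_ : PP Y) × (Fin 3 → ℤ)) := by
  rintro ⟨u, hu, hadd⟩
  have hu' : ∀ i, u i = v i + 1 := by
    intro i
    have := congrFun hu i
    simp only [boxWeight, Pi.sub_apply, wta] at this
    omega
  have h1 : Function.update u 0 (v 0) < u := by
    refine lt_of_le_of_ne (update_le_self_iff.2 (by rw [hu']; omega)) fun he => ?_
    have := congrFun he 0
    rw [Function.update_self, hu'] at this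
    omega
  refine h.2 _ ?_ (hadd.2 _ h1)
  refine lt_of_le_of_ne (fun i => ?_) fun he => ?_
  · by_cases hi : i = 0
    · subst hi
      simp
    · rw [Function.update_of_ne hi, hu']
      exact Nat.le_succ _
  · have := congrFun he 1
    rw [Function.update_of_ne (by decide), hu'] at this
    exact (Nat.lt_succ_self _).ne this

/-- The oscillator form of `A(x) = :S_a(x) / S_a(q_a x):`. -/
theorem screeningOsc_succ (hprod : ∏ i, q l i = 1) (hnd : ∀ w, mono l a w = 1 → w = 0) (k : ℤ)
    {n : ℤ} (hn : n ≠ 0) :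
    screeningOsc l a k n = screeningOsc l a (k + 1) n + q l a ^ (-(n * k)) := by
  have h := one_sub_q_self_zpow_ne_zero hprod hnd (neg_ne_zero.2 hn)
  have e : q l a ^ (-(n * (k + 1))) = q l a ^ (-(n * k)) * q l a ^ (-n) := by
    rw [← zpow_add₀ (q_ne_zero l a)]
    congr 1
    ring
  rw [screeningOsc, screeningOsc, e]
  field_simp
  ring

theorem polePoint_sub_wta (k : ℤ) (w : Fin 3 → ℤ) :
    polePoint l a k (w - wta) = polePoint l a (k + 1) w := by
  rw [polePoint, polePoint]
  congr 1
  module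

/-- The pole of `Λ_π` at an addable box cancels the pole of `Λ_{π + v}`. -/
theorem poleTerm_insert (hprod : ∏ i, q l i = 1) (hnd : ∀ w, mono l a w = 1 → w = 0) (L : ℂ) (k : ℤ)
    {π π' : PP Y} {v : Box} (hv : v ∉ π.1) (h : π'.1 = insert v π.1) :
    poleTerm l a L Y k ⟨π', boxWeight v - wta⟩ = -poleTerm l a L Y (k + 1) ⟨π, boxWeight v⟩ := by
  funext γ
  have hZ := Z_insert hnd hv h
  have h1 := Z_ne_zero hnd π
  have h2 := Z_ne_zero hnd π'
  have h3 : residueAt l a (yChar Y π'.1) (boxWeight v - wta) ≠ 0 := by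
    intro h0
    rw [h0, div_zero, neg_zero, div_eq_zero_iff] at hZ
    exact hZ.elim h2 h1
  have hZ' : Z l a Y π' * q l a * residueAt l a (yChar Y π'.1) (boxWeight v - wta)
      = -(Z l a Y π * q l a * residueAt l a (yChar Y π.1) (boxWeight v)) := by
    field_simp at hZ
    linear_combination q l a * hZ
  rw [Pi.neg_apply, poleTerm, poleTerm]
  simp only
  rw [hZ', polePoint_sub_wta, vertexCoeff_congr (fun m hm => ?_)]
  · exact neg_smul (M := Module.End ℂ Space) _ _
  have hosc : expLambda l a L Y π' = _ := expLambda_insert L hv h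
  cases m with
  | osc n =>
    have hn : n ≠ 0 := fun h0 => hm (by rw [h0])
    simp only [mergedExp]
    rw [hosc, Pi.sub_apply, rescale, exp_neg_mul_logChi, screeningOsc_succ hprod hnd k hn,
      polePoint_eq hprod, mul_zpow, ← zpow_mul, expA]
    -- At the pole `q_a^k x'` equals `χ(v)`, so the factor `A⁻¹(χ(v))` of the new box turns
    -- `S_a(q_a^k x')` into `S_a(q_a^(k+1) x')`.
    have e : q l a ^ ((1 - (k + 1)) * -n) * q l a ^ (-(n * k)) = 1 := by
      rw [← zpow_add₀ (q_ne_zero l a)]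
      convert zpow_zero _ using 2
      ring
    linear_combination mono l a (boxWeight v) ^ (-n) * e
  | t =>
    simp only [mergedExp]
    rw [hosc, Pi.sub_apply, rescale]
    simp only [expA]
    push_cast
    ring
  | _ => simp [mergedExp, hosc, rescale, expA]

/-- The contribution of the addable poles at the support point `r`. -/
def addableSum (l : Fin 4 → ℂ) (a : Fin 4) (L : ℂ) (Y : Fin 3 → YoungDiagram) (M k : ℤ) (r : ℂˣ) :
    ℂ → Module.End ℂ Space :=
  ∑ i ∈ polesOfSize Y (M - k) with IsAddablePole i,
    if poleUnit l a k i.2 = r then poleTerm l a L Y k i else 0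

/-- Adding the box is a bijection from the addable poles of configurations with `M - (k + 1)` boxes
to the removable poles of those with `M - k`; it keeps the support point and reverses the sign. -/
theorem sum_poles_eq (hprod : ∏ i, q l i = 1) (hnd : ∀ w, mono l a w = 1 → w = 0) (L : ℂ)
    (M k : ℤ) (r : ℂˣ) :
    ∑ i ∈ polesOfSize Y (M - k), (if poleUnit l a k i.2 = r then poleTerm l a L Y k i else 0)
      = addableSum l a L Y M k r - addableSum l a L Y M (k + 1) r := by
  rw [← Finset.sum_filter_add_sum_filter_not _ IsAddablePole,
    sub_eq_add_neg (addableSum l a L Y M k r), addableSum]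
  congr 1
  rw [addableSum, ← Finset.sum_neg_distrib]
  symm
  have hins : ∀ i ∈ (polesOfSize Y (M - (k + 1))).filter IsAddablePole, ∃ (v : Box) (π' : PP Y),
      boxWeight v = i.2 ∧ v ∉ i.1.1 ∧ π'.1 = insert v i.1.1 := by
    intro i hi
    obtain ⟨v, hv, hadd⟩ := (Finset.mem_filter.1 hi).2
    obtain ⟨hv', π', hπ'⟩ := exists_insert_of_isAddable hadd
    exact ⟨v, π', hv, hv', hπ'⟩
  choose v π' hw hv hπ' using hins
  refine Finset.sum_bij (fun i hi => ⟨π' i hi, i.2 - wta⟩) ?_ ?_ ?_ ?_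
  · intro i hi
    have hc := isCorner_of_insert (hv i hi) (hπ' i hi)
    rw [Finset.mem_filter, mem_polesOfSize, ← hw i hi]
    refine ⟨⟨?_, (yChar_eq_one_iff _ _).2 (Or.inr ⟨_, rfl, hc⟩)⟩, not_isAddablePole_of_isCorner hc⟩
    have hcard := (mem_polesOfSize.1 (Finset.mem_filter.1 hi).1).1
    simp only [hπ' i hi, Finset.card_insert_of_notMem (hv i hi)]
    push_cast
    linarith
  · rintro ⟨π₁, w₁⟩ h₁ ⟨π₂, w₂⟩ h₂ h
    rw [Sigma.mk.injEq, heq_eq_eq] at h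
    obtain ⟨h3, h4⟩ := h
    have h5 : w₁ = w₂ := sub_left_injective h4
    have h6 : v _ h₁ = v _ h₂ := boxWeight_injective (by rw [hw, hw]; exact h5)
    have h7 : π₁ = π₂ := by
      refine Subtype.ext ?_
      have e1 := hπ' _ h₁
      rw [h3, hπ' _ h₂, h6] at e1
      have e2 := hv _ h₁
      rw [h6] at e2
      rw [← Finset.erase_insert e2, ← e1, Finset.erase_insert (hv _ h₂)]
    rw [h5, h7]
  · rintro ⟨π, w⟩ hi
    rw [Finset.mem_filter, mem_polesOfSize] at hi
    obtain ⟨⟨hcard, hy⟩, hnot⟩ := hi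
    rcases (yChar_eq_one_iff _ _).1 hy with h | ⟨u, rfl, hc⟩
    · exact absurd h hnot
    obtain ⟨π₀, hu, hins⟩ := exists_erase_of_isCorner hc
    have hadd := isAddable_of_insert hu hins
    have hmem : (⟨π₀, boxWeight u⟩ : (_ : PP Y) × (Fin 3 → ℤ))
        ∈ (polesOfSize Y (M - (k + 1))).filter IsAddablePole := by
      rw [Finset.mem_filter, mem_polesOfSize]
      refine ⟨⟨?_, (yChar_eq_one_iff _ _).2 (Or.inl ⟨_, rfl, hadd⟩)⟩, _, rfl, hadd⟩
      have hc' : π.1.card = π₀.1.card + 1 := by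
        rw [show π.1 = insert u π₀.1 from hins, Finset.card_insert_of_notMem hu]
      change (π.1.card : ℤ) = M - k at hcard
      change (π₀.1.card : ℤ) = M - (k + 1)
      rw [hc'] at hcard
      push_cast at hcard
      linarith
    refine ⟨_, hmem, ?_⟩
    have h6 : v _ hmem = u := boxWeight_injective (hw _ hmem)
    have h7 : π' _ hmem = π := Subtype.ext (by rw [hπ', hins, h6])
    rw [h7]
  · intro i hi
    have e : poleUnit l a k (i.2 - wta) = poleUnit l a (k + 1) i.2 :=
      Units.ext (polePoint_sub_wta k i.2)
    have h := poleTerm_insert hprod hnd L k (hv i hi) (hπ' i hi)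
    rw [hw i hi] at h
    simp only [e, h]
    split_ifs
    · rfl
    · rw [neg_zero]

/-- A configuration with an addable box far from the walls has many boxes. -/
theorem pow_three_le_card {D : ℕ} (hD : ∀ i p, p ∈ Y i → p.1 < D ∧ p.2 < D) {π : PP Y} {v : Box}
    (h : IsAddable π.config v) {s : ℕ} (hs : ∀ i, D + s ≤ v i) : s ^ 3 ≤ π.1.card := by
  have hsub : Fintype.piFinset (fun _ : Fin 3 => Finset.Ico D (D + s)) ⊆ π.1 := by
    intro u hu
    simp only [Fintype.mem_piFinset, Finset.mem_Ico] at hu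
    have hlt : u < v := by
      refine lt_of_le_of_ne (fun i => ((hu i).2.le.trans (hs i))) fun he => ?_
      have h1 := (hu 0).2
      rw [he] at h1
      exact absurd (hs 0) (not_le.2 h1)
    rcases h.2 u hlt with h1 | h1
    · exact h1
    · obtain ⟨i, hi⟩ := Set.mem_iUnion.1 h1
      exact absurd (hD i _ hi).1 (not_lt.2 (hu _).1)
  simpa using Finset.card_le_card hsub

/-- Above, `k ≤ M` because box numbers are nonnegative. Below, the support point ties the addable
box to `k` along the diagonal, and the cube beneath it would outgrow the `M - k` available boxes. -/
theorem finite_support_addableSum (hnd : ∀ w, mono l a w = 1 → w = 0) (L : ℂ) (M : ℤ) (r : ℂˣ) :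
    (Function.support fun k => addableSum l a L Y M k r).Finite := by
  obtain ⟨D, hD⟩ := exists_bound Y
  have hmem : ∀ k, addableSum l a L Y M k r ≠ 0 → ∃ (π : PP Y) (v : Box),
      (π.1.card : ℤ) = M - k ∧ IsAddable π.config v ∧ polePoint l a k (boxWeight v) = r := by
    intro k hk
    obtain ⟨⟨π, w⟩, hi, hne⟩ := Finset.exists_ne_zero_of_sum_ne_zero hk
    rw [Finset.mem_filter, mem_polesOfSize] at hi
    obtain ⟨⟨hcard, -⟩, v, rfl, hadd⟩ := hi
    refine ⟨π, v, hcard, hadd, ?_⟩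
    by_contra h
    exact hne (if_neg fun h' => h (congrArg Units.val h'))
  by_cases hex : ∃ k, addableSum l a L Y M k r ≠ 0
  swap
  · push Not at hex
    rw [Function.support_eq_empty_iff.2 (funext hex)]
    exact Set.finite_empty
  obtain ⟨k₀, hk₀⟩ := hex
  obtain ⟨-, v₀, -, -, hv₀⟩ := hmem k₀ hk₀
  -- With `s = k₀ - D - k` the number of boxes is `s + (M - k₀ + D)`; for `s > |M - k₀ + D| + 2`
  -- this is less than `s ^ 3`.
  refine (Set.finite_Icc (k₀ - D - |M - k₀ + D| - 2) M).subset fun k hk => ?_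
  obtain ⟨π, v, hcard, hadd, hv⟩ := hmem k hk
  have hkM : k ≤ M := by
    have : (0 : ℤ) ≤ π.1.card := Nat.cast_nonneg _
    omega
  refine ⟨?_, hkM⟩
  by_contra hlt
  push Not at hlt
  -- Equal pole points have equal weights, and `q_a` has weight `(-1, -1, -1)`.
  have hvi : ∀ i, (v i : ℤ) = v₀ i + k₀ - k := by
    intro i
    have h1 := congrFun (mono_injective hnd (hv.trans hv₀.symm)) i
    simp only [Pi.add_apply, Pi.smul_apply, wta, boxWeight, smul_eq_mul] at h1
    linarith
  have habs := abs_nonneg (M - k₀ + D)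
  obtain ⟨s, hs⟩ : ∃ s : ℕ, (s : ℤ) = k₀ - D - k := ⟨(k₀ - D - k).toNat, by omega⟩
  have hc := pow_three_le_card hD hadd (s := s) fun i => by
    have := hvi i
    have : (0 : ℤ) ≤ v₀ i := Nat.cast_nonneg _
    omega
  have hc' : (s : ℤ) ^ 3 ≤ s + (M - k₀ + D) := by
    have : ((s ^ 3 : ℕ) : ℤ) ≤ π.1.card := by exact_mod_cast hc
    push_cast at this
    rw [hcard] at this
    linarith
  have hle := le_abs_self (M - k₀ + D)
  have h2 : |M - k₀ + D| + 2 < (s : ℤ) := by linarith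
  nlinarith [mul_self_nonneg ((s : ℤ) - 2), mul_nonneg (show (0 : ℤ) ≤ s by omega)
    (show (0 : ℤ) ≤ s - 2 by omega), mul_nonneg (show (0 : ℤ) ≤ s by omega)
    (mul_nonneg (show (0 : ℤ) ≤ s - 2 by omega) (show (0 : ℤ) ≤ s - 2 by omega))]

/-- The `qq`-character commutes with the screening charge. -/
theorem deltaSumEqZero_commutatorTerm (hprod : ∏ i, q l i = 1)
    (hnd : ∀ w, mono l a w = 1 → w = 0) {L : ℂ} (hL : Complex.exp L = -q l a) (M : ℤ) :
    DeltaSumEqZero (-(l a)⁻¹) (commutatorTerm l a L Y M) := by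
  refine ⟨fun k r => addableSum l a L Y M k r - addableSum l a L Y M (k + 1) r, fun k => ?_,
    fun r => ?_⟩
  · have h := hasDeltaExpansion_commutatorTerm (Y := Y) hprod hnd hL M k
    simp only [sum_poles_eq hprod hnd] at h
    exact h
  · have h1 := finite_support_addableSum (Y := Y) hnd L M r
    have h2 : (Function.support fun k => addableSum l a L Y M (k + 1) r).Finite :=
      h1.preimage (f := fun k : ℤ => k + 1) (add_left_injective 1).injOn
    refine ⟨(h1.union h2).subset (Function.support_sub _ _), ?_⟩
    -- With finite supports the telescoping sum splits, and the two halves differ by the reindexing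
    -- `k ↦ k + 1`.
    rw [finsum_sub_distrib h1 h2, sub_eq_zero]
    exact (finsum_comp_equiv (Equiv.addRight (1 : ℤ))
      (f := fun k => addableSum l a L Y M k r)).symm

end Cancellation

end GaugeOrigami

end

theorem mainTheorem4 (l : Fin 4 → ℂ)
    (hprod : ∏ i, q l i = 1)
    (hgen : ∀ n : Fin 4 → ℤ, ∏ i, q l i ^ n i = 1 → ∀ i j, n i = n j)
    (a : Fin 4) (L : ℂ) (hL : Complex.exp L = -q l a)
    (Y : Fin 3 → YoungDiagram) :
    (∀ x : ℂ, x ≠ 0 → ∀ C : PP Y → ℂ, ResidueRecursion l a Y x C ↔ C = Z l a Y) ∧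
    ∀ M : ℤ, DeltaSumEqZero (-(l a)⁻¹) (commutatorTerm l a L Y M) := by
  have hnd : ∀ w, mono l a w = 1 → w = 0 := fun w => mono_eq_one hgen
  exact ⟨fun x hx C => residueRecursion_iff hprod hnd hx C,
    fun M => deltaSumEqZero_commutatorTerm hprod hnd hL M⟩
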